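/- Let $d\ge 3$ and let $W$ be a complex vector space with basis $v_1,\dots,v_d$. Let $R$ be the polynomial ring over $\mathbb C$ in the variables $p_{0,ij}=p_{0,ji}$ and $p_{r,st}=p_{r,ts}$ $(1\le i,j,r,s,t\le d)$. Put $P(1)=1$, $P(x_m)=x_m$ and $P(x_ix_j)=p_{0,ij}+\sum_{m=1}^d p_{m,ij}x_m$, extended $R$-linearly to polynomials in $x_1,\dots,x_d$ of degree at most $2$, and for $1\le a,i,j,k\le d$ let $C(a;j,(i,k))\in R$ be the coefficient of $x_a$ in $P(x_kP(x_ix_j))-P(x_iP(x_kx_j))$. (These elements generate the ideal of the chart $V_d$ of $\mathrm{Hilb}^{d+1}(\mathbb C^d)$ of ideals $I$ such that $1,x_1,\dots,x_d$ is a basis of $\mathbb C[x_1,\dots,x_d]/I$.) Let $Y\subset R$ be their $\mathbb C$-linear span, in which $C(a;j,(i,k))=-C(a;j,(k,i))$. The group $GL(W)$ acts on $R$ by algebra automorphisms through $g\cdot p_{0,st}=\sum_{s',t'}g_{s's}g_{t't}\,p_{0,s't'}$ and $g\cdot p_{r,st}=\sum_{r',s',t'}(g^{-1})_{rr'}g_{s's}g_{t't}\,p_{r',s't'}$,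 where $gv_s=\sum_{s'}g_{s's}v_{s'}$; the subspace $Y$ is stable, and we regard it as a representation of $GL(W)$ through this action multiplied by $\det g$. For a partition $\lambda$ let $\mathbb S_\lambda W$ be the Schur functor, and call the sum of all subrepresentations isomorphic to $\mathbb S_\lambda W$ the isotypic component of type $\lambda$. All partitions below are partitions of $d+2$ into $d$ parts, zeros allowed. Let $$T=\textstyle\bigwedge^{d-1}W\otimes W\otimes\bigwedge^2W ,$$ and let $T'\subset T$ be the sum of its isotypic components of types $(2,2,1,\dots,1,1)$ and, if $d\ge4$, $(2,2,2,1,\dots,1,0)$. Then: 1. There is exactly one $GL(W)$-equivariant linear map $\varphi:Y\to T$ such that, for all $a,i,j,k$, $$\varphi\big(C(a;j,(i,k))\big)\equiv(-1)^a(v_1\wedge\cdots\wedge\widehat{v_a}\wedge\cdots\wedge v_d)\otimes v_j\otimes(v_i\wedge v_k)\pmod{T'} .$$ 2. The map $\varphi$ is injective, and $T=\varphi(Y)\oplus T'$; so $\varphi(Y)$ avoids the remaining isotypic components. 3. There is an isomorphism of $GL(W)$-representations $$e:\ Y\ \xrightarrow{\ \sim\ }\ \mathbb S_{(3,2,1,\dots,1,0)}W\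 \oplus\ \mathbb S_{(3,1,1,\dots,1,1)}W$$ such that $\varphi$ maps the first (second) summand, transported to $Y$ by $e$, onto the isotypic component of $T$ of type $(3,2,1,\dots,1,0)$ (of type $(3,1,1,\dots,1,1)$). -/

import Mathlib

open scoped TensorProduct

namespace HilbertSymmetric

noncomputable section

/-! ### Representations of `GL(W)` and Schur functors -/

section Schur

variable (W : Type*) [AddCommGroup W] [Module ℂ W]

/-- The group `GL(W)`. -/
abbrev GLW := LinearMap.GeneralLinearGroup ℂ W

/-- The tautological representation of `GL(W)` on `W`. -/
def stdRep : Representation ℂ (GLW W) W := Units.coeHom (W →ₗ[ℂ] W)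

/-- The representation of `GL(W)` on the exterior power `⋀^n W`. -/
def extRep (n : ℕ) : Representation ℂ (GLW W) (⋀[ℂ]^n W) where
  toFun g := exteriorPower.map n (stdRep W g)
  map_one' := by
    rw [map_one]
    exact exteriorPower.map_id
  map_mul' g h := by
    rw [map_mul]
    exact exteriorPower.map_comp (stdRep W h) (stdRep W g)

/-- The tensor power of `W` with one factor for each cell of the Young diagram `μ`. -/
abbrev CellTensor (μ : YoungDiagram) := ⨂[ℂ] _ : μ.cells, W

/-- The diagonal representation of `GL(W)` on the tensor power indexed by the cells of `μ`. -/
def cellRep (μ : YoungDiagram) : Representation ℂ (GLW W) (CellTensor W μ) where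
  toFun g := PiTensorProduct.map fun _ => stdRep W g
  map_one' := by
    rw [map_one]
    exact PiTensorProduct.map_one
  map_mul' g h := by
    rw [map_mul]
    exact PiTensorProduct.map_mul _ _

/-- The permutation of the tensor factors given by a permutation of the cells. -/
def permCells (μ : YoungDiagram) (σ : Equiv.Perm μ.cells) : CellTensor W μ →ₗ[ℂ] CellTensor W μ :=
  (PiTensorProduct.reindex ℂ (fun _ : μ.cells => W) σ).toLinearMap

/-- The action of `a_μ = ∑ σ`, summed over the permutations of the cells preserving each row. -/
def rowSymmetrizer (μ : YoungDiagram) : CellTensor W μ →ₗ[ℂ] CellTensor W μ :=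
  ∑ σ : Equiv.Perm μ.cells with ∀ c, (σ c).1.1 = c.1.1, permCells W μ σ

/-- The action of `b_μ = ∑ sgn(τ) τ`, summed over the permutations of the cells preserving each
column. -/
def colAntisymmetrizer (μ : YoungDiagram) : CellTensor W μ →ₗ[ℂ] CellTensor W μ :=
  ∑ τ : Equiv.Perm μ.cells with ∀ c, (τ c).1.2 = c.1.2,
    ((Equiv.Perm.sign τ : ℤ) : ℂ) • permCells W μ τ

/-- The action of the Young symmetrizer `c_μ = a_μ b_μ`. -/
def youngSymmetrizer (μ : YoungDiagram) : CellTensor W μ →ₗ[ℂ] CellTensor W μ :=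
  rowSymmetrizer W μ ∘ₗ colAntisymmetrizer W μ

theorem permCells_cellRep (μ : YoungDiagram) (σ : Equiv.Perm μ.cells) (g : GLW W)
    (x : CellTensor W μ) :
    permCells W μ σ (cellRep W μ g x) = cellRep W μ g (permCells W μ σ x) :=
  (PiTensorProduct.map_reindex (fun _ : μ.cells => stdRep W g) σ x).symm

theorem youngSymmetrizer_cellRep (μ : YoungDiagram) (g : GLW W) (x : CellTensor W μ) :
    youngSymmetrizer W μ (cellRep W μ g x) = cellRep W μ g (youngSymmetrizer W μ x) := by
  simp only [youngSymmetrizer, rowSymmetrizer, colAntisymmetrizer, LinearMap.comp_apply,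
    LinearMap.sum_apply, LinearMap.smul_apply, permCells_cellRep, map_sum, map_smul]

/-- The Schur functor `𝕊_μ W`: the image of the Young symmetrizer `c_μ` on the tensor power. -/
def schur (μ : YoungDiagram) : Subrepresentation (cellRep W μ) where
  toSubmodule := LinearMap.range (youngSymmetrizer W μ)
  apply_mem_toSubmodule g := by
    rintro _ ⟨x, rfl⟩
    exact ⟨cellRep W μ g x, youngSymmetrizer_cellRep W μ g x⟩

/-- `𝕊_μ W` as a representation of `GL(W)`. -/
abbrev schurRep (μ : YoungDiagram) : Representation ℂ (GLW W) (schur W μ).toSubmodule :=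
  (schur W μ).toRepresentation

/-- The representation `⋀^{d-1} W ⊗ W ⊗ ⋀² W` of `GL(W)`. -/
abbrev ambientRep (d : ℕ) :
    Representation ℂ (GLW W) (⋀[ℂ]^(d - 1) W ⊗[ℂ] (W ⊗[ℂ] ⋀[ℂ]^2 W)) :=
  (extRep W (d - 1)).tprod ((stdRep W).tprod (extRep W 2))

end Schur

/-- The `σ`-isotypic component of a representation `ρ`: the sum of all subrepresentations of `ρ`
that are isomorphic to `σ`. -/
def isotypic {G V U : Type*} [Group G] [AddCommMonoid V] [Module ℂ V] [AddCommMonoid U]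
    [Module ℂ U] (ρ : Representation ℂ G V) (σ : Representation ℂ G U) : Submodule ℂ V :=
  ⨆ (N : Subrepresentation ρ) (_ : Nonempty (N.toRepresentation.Equiv σ)), N.toSubmodule

/-! ### The four partitions of `d + 2` -/

section Partitions

/-- `(3, 2, 1, …, 1, 0)`, a partition of `d + 2` into `d` parts, for `3 ≤ d`. -/
def shape321 (d : ℕ) : YoungDiagram :=
  YoungDiagram.ofRowLens ([3, 2] ++ List.replicate (d - 3) 1 ++ [0])
    (by
      simp only [List.sortedGE_iff_pairwise, List.pairwise_append, List.pairwise_replicate]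
      grind)

/-- `(3, 1, 1, …, 1, 1)`, a partition of `d + 2` into `d` parts, for `1 ≤ d`. -/
def shape311 (d : ℕ) : YoungDiagram :=
  YoungDiagram.ofRowLens ([3] ++ List.replicate (d - 1) 1)
    (by simp [List.sortedGE_iff_pairwise, List.pairwise_replicate])

/-- `(2, 2, 1, …, 1, 1)`, a partition of `d + 2` into `d` parts, for `2 ≤ d`. -/
def shape221 (d : ℕ) : YoungDiagram :=
  YoungDiagram.ofRowLens ([2, 2] ++ List.replicate (d - 2) 1)
    (by simp [List.sortedGE_iff_pairwise, List.pairwise_replicate])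

/-- `(2, 2, 2, 1, …, 1, 0)`, a partition of `d + 2` into `d` parts, for `4 ≤ d`. -/
def shape222 (d : ℕ) : YoungDiagram :=
  YoungDiagram.ofRowLens ([2, 2, 2] ++ List.replicate (d - 4) 1 ++ [0])
    (by
      simp only [List.sortedGE_iff_pairwise, List.pairwise_append, List.pairwise_replicate]
      grind)

variable (W : Type*) [AddCommGroup W] [Module ℂ W]

/-- The sum of the isotypic components of types `(2, 2, 1, …, 1, 1)` and, if `4 ≤ d`,
`(2, 2, 2, 1, …, 1, 0)` of `⋀^{d-1} W ⊗ W ⊗ ⋀² W`. -/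
def remainingIsotypic (d : ℕ) : Submodule ℂ (⋀[ℂ]^(d - 1) W ⊗[ℂ] (W ⊗[ℂ] ⋀[ℂ]^2 W)) :=
  isotypic (ambientRep W d) (schurRep W (shape221 d)) ⊔
    ⨆ _ : 4 ≤ d, isotypic (ambientRep W d) (schurRep W (shape222 d))

end Partitions

/-! ### The generators `C(a; j, (i, k))` -/

section Generators

variable (d : ℕ)

/-- The polynomial ring `R` in the coordinates `p_{0,ij} = p_{0,ji}` (first index `none`) and
`p_{r,st} = p_{r,ts}` (first index `some r`). -/
abbrev R := MvPolynomial (Option (Fin d) × Sym2 (Fin d)) ℂ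

variable {d}

/-- The coordinate `p_{r,st}`. -/
def p (r : Option (Fin d)) (s t : Fin d) : R d := MvPolynomial.X (r, s(s, t))

/-- The coefficients of `P(x_i x_j) = p_{0,ij} + ∑ m, p_{m,ij} x_m`. A form
`ℓ_0 + ∑ m, ℓ_m x_m` over `R` is recorded by its coefficients `ℓ : Option (Fin d) → R d`. -/
def projQuad (i j : Fin d) : Option (Fin d) → R d := fun r => p r i j

/-- The coefficients of `P(x_k ℓ) = ℓ_0 x_k + ∑ m, ℓ_m P(x_k x_m)`, for a form
`ℓ = ℓ_0 + ∑ m, ℓ_m x_m`; here `P` is linear and fixes `1, x_1, …, x_d`. -/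
def projMul (k : Fin d) (l : Option (Fin d) → R d) : Option (Fin d) → R d := fun r =>
  l none * (if r = some k then 1 else 0) + ∑ m : Fin d, l (some m) * projQuad k m r

/-- `C(a; j, (i, k))`: the coefficient of `x_a` in `P(x_k P(x_i x_j)) - P(x_i P(x_k x_j))`. -/
def C (a j i k : Fin d) : R d :=
  projMul k (projQuad i j) (some a) - projMul i (projQuad k j) (some a)

theorem C_antisymm (a j i k : Fin d) : C a j i k + C a j k i = 0 := by
  simp [C]

/-- The linear span in `R` of the generators; by `C_antisymm` the relations
`C(a; j, (i, k)) + C(a; j, (k, i)) = 0` hold in it. -/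
def Yspan (d : ℕ) : Submodule ℂ (R d) :=
  Submodule.span ℂ {f | ∃ a j i k : Fin d, f = C a j i k}

variable {W : Type*} [AddCommGroup W] [Module ℂ W] (v : Module.Basis (Fin d) ℂ W)

/-- The matrix of `g` in the basis `v`, so that `g v_s = ∑ s', (mat v g s' s) v_{s'}`. -/
def mat (g : GLW W) : Matrix (Fin d) (Fin d) ℂ := LinearMap.toMatrix v v (stdRep W g)

/-- The matrix of `1 ⊕ g` on `ℂ ⊕ W` in the basis consisting of `1` and of `v`. -/
def extMat (g : GLW W) : Matrix (Option (Fin d)) (Option (Fin d)) ℂ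
  | none, none => 1
  | some r, some s => mat v g r s
  | _, _ => 0

/-- `g · p_{r,st} = ∑ (g⁻¹)_{rr'} g_{s's} g_{t't} p_{r',s't'}` for `r ≠ 0`, and
`g · p_{0,st} = ∑ g_{s's} g_{t't} p_{0,s't'}`. -/
def actVar (g : GLW W) (s t : Fin d) (r : Option (Fin d)) : R d :=
  ∑ r', extMat v g⁻¹ r r' • ∑ s', ∑ t', (mat v g s' s * mat v g t' t) • p r' s' t'

theorem p_comm (r : Option (Fin d)) (s t : Fin d) : p r s t = p r t s := by
  simp [p, Sym2.eq_swap]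

theorem actVar_comm (g : GLW W) (s t : Fin d) (r : Option (Fin d)) :
    actVar v g s t r = actVar v g t s r := by
  refine Finset.sum_congr rfl fun r' _ => ?_
  congr 1
  rw [Finset.sum_comm]
  exact Finset.sum_congr rfl fun x _ => Finset.sum_congr rfl fun y _ => by
    rw [p_comm r' y x, mul_comm]

/-- The action of `g ∈ GL(W)` on `R` by algebra homomorphisms that is induced, with `x_i = v_i`, by
the linear changes of coordinates `P ↦ g P g⁻¹` of the projectors `P`: for a function `f` of `P`,
`(g · f)(P) = f (g⁻¹ P g)`. -/
def actAlg (g : GLW W) : R d →ₐ[ℂ] R d :=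
  MvPolynomial.aeval fun q => Sym2.lift
    ⟨fun s t => actVar v g s t q.1, fun s t => actVar_comm v g s t q.1⟩ q.2

theorem actAlg_p (g : GLW W) (r : Option (Fin d)) (s t : Fin d) :
    actAlg v g (p r s t) = actVar v g s t r := by
  simp [actAlg, p]

theorem mat_one : mat v (1 : GLW W) = 1 := by
  simp [mat, Module.End.one_eq_id]

theorem mat_mul (g h : GLW W) : mat v (g * h) = mat v g * mat v h := by
  simp [mat, LinearMap.toMatrix_mul]

theorem extMat_one : extMat v (1 : GLW W) = 1 := by
  ext (_ | r) (_ | s) <;> simp [extMat, mat_one, Matrix.one_apply]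

theorem extMat_mul (g h : GLW W) : extMat v (g * h) = extMat v g * extMat v h := by
  ext (_ | r) (_ | s) <;> simp [extMat, mat_mul, Matrix.mul_apply, Fintype.sum_option]

theorem actAlg_one : actAlg v (1 : GLW W) = AlgHom.id ℂ (R d) := by
  refine MvPolynomial.algHom_ext fun ⟨r, q⟩ => ?_
  induction q with
  | _ s t =>
    change actAlg v 1 (p r s t) = p r s t
    rw [actAlg_p]
    simp only [actVar, inv_one, extMat_one, mat_one, Matrix.one_apply, ite_mul, one_mul, zero_mul,
      ite_smul, one_smul, zero_smul, Finset.sum_ite_eq, Finset.sum_ite_eq', Finset.mem_univ,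
      if_true, Finset.sum_ite_irrel, Finset.sum_const_zero]

/-- The matrix of the operator `ℓ ↦ P(x_k ℓ)` on the span of `1, x_1, …, x_d`. -/
def mulMat (k : Fin d) : Matrix (Option (Fin d)) (Option (Fin d)) (R d)
  | r, none => if r = some k then 1 else 0
  | r, some m => p r k m

theorem C_eq_mulMat (a j i k : Fin d) :
    C a j i k = (mulMat k * mulMat i - mulMat i * mulMat k) (some a) (some j) := by
  simp [C, projMul, projQuad, mulMat, Matrix.mul_apply, Fintype.sum_option, mul_comm]

/-- A complex matrix, as a matrix over `R`. -/
def scalarMat (A : Matrix (Option (Fin d)) (Option (Fin d)) ℂ) :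
    Matrix (Option (Fin d)) (Option (Fin d)) (R d) := A.map (algebraMap ℂ (R d))

theorem scalarMat_apply (A : Matrix (Option (Fin d)) (Option (Fin d)) ℂ) (r s : Option (Fin d)) :
    scalarMat A r s = algebraMap ℂ (R d) (A r s) :=
  rfl

theorem scalarMat_mul (A B : Matrix (Option (Fin d)) (Option (Fin d)) ℂ) :
    scalarMat (A * B) = scalarMat A * scalarMat B :=
  Matrix.map_mul

theorem scalarMat_one : scalarMat (1 : Matrix (Option (Fin d)) (Option (Fin d)) ℂ) = 1 :=
  Matrix.map_one _ (map_zero _) (map_one _)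

theorem actAlg_scalarMat (g : GLW W) (A : Matrix (Option (Fin d)) (Option (Fin d)) ℂ) :
    (actAlg v g).mapMatrix (scalarMat A) = scalarMat A := by
  ext r s : 2
  simp [scalarMat]

theorem scalarMat_inv_mul (g : GLW W) :
    scalarMat (extMat v g⁻¹) * scalarMat (extMat v g) = 1 := by
  rw [← scalarMat_mul, ← extMat_mul, inv_mul_cancel, extMat_one, scalarMat_one]

theorem scalarMat_mul_inv (g : GLW W) :
    scalarMat (extMat v g) * scalarMat (extMat v g⁻¹) = 1 := by
  rw [← scalarMat_mul, ← extMat_mul, mul_inv_cancel, extMat_one, scalarMat_one]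

theorem mulMat_scalarMat_none (g : GLW W) (k : Fin d) (r : Option (Fin d)) :
    (mulMat k * scalarMat (extMat v g)) r none = if r = some k then 1 else 0 := by
  rw [Matrix.mul_apply, Fintype.sum_option]
  simp [mulMat, scalarMat, extMat]

theorem mulMat_scalarMat_some (g : GLW W) (k m : Fin d) (r : Option (Fin d)) :
    (mulMat k * scalarMat (extMat v g)) r (some m) = ∑ m', mat v g m' m • p r k m' := by
  rw [Matrix.mul_apply, Fintype.sum_option]
  simp [mulMat, scalarMat, extMat, Algebra.smul_def, mul_comm]

theorem actAlg_mulMat (g : GLW W) (k : Fin d) :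
    (actAlg v g).mapMatrix (mulMat k) =
      ∑ k', mat v g k' k •
        (scalarMat (extMat v g⁻¹) * mulMat k' * scalarMat (extMat v g)) := by
  refine Matrix.ext fun r s => ?_
  simp only [AlgHom.mapMatrix_apply, Matrix.map_apply, Matrix.sum_apply, Matrix.smul_apply,
    Matrix.mul_assoc]
  cases s with
  | none =>
    have h1 := congrFun (congrFun (scalarMat_inv_mul v g) r) (some k)
    rw [Matrix.mul_apply, Fintype.sum_option] at h1
    simp only [scalarMat_apply, show extMat v g none (some k) = 0 from rfl, map_zero,
      mul_zero, zero_add, Matrix.one_apply] at h1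
    have h2 : actAlg v g (mulMat k r none) = if r = some k then 1 else 0 := by
      simp [mulMat, apply_ite (actAlg v g)]
    rw [h2, ← h1]
    refine Finset.sum_congr rfl fun x _ => ?_
    rw [Matrix.mul_apply]
    simp only [mulMat_scalarMat_none, mul_ite, mul_one, mul_zero, Finset.sum_ite_eq',
      Finset.mem_univ, if_true, scalarMat_apply, Algebra.smul_def]
    rw [mul_comm]
    rfl
  | some m =>
    change actAlg v g (p r k m) = _
    rw [actAlg_p, actVar]
    have h3 : ∀ k', (scalarMat (extMat v g⁻¹) * (mulMat k' * scalarMat (extMat v g))) r (some m) =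
        ∑ r', scalarMat (extMat v g⁻¹) r r' * ∑ m', mat v g m' m • p r' k' m' := fun k' => by
      rw [Matrix.mul_apply]
      simp only [mulMat_scalarMat_some]
    simp only [h3, scalarMat_apply, Finset.mul_sum, Algebra.smul_def, map_mul]
    rw [Finset.sum_comm]
    refine Finset.sum_congr rfl fun x _ => Finset.sum_congr rfl fun y _ =>
      Finset.sum_congr rfl fun z _ => ?_
    ring

theorem actAlg_mul (g h : GLW W) : actAlg v (g * h) = (actAlg v g).comp (actAlg v h) := by
  refine MvPolynomial.algHom_ext fun ⟨r, q⟩ => ?_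
  induction q with
  | _ s t =>
    have key : (actAlg v (g * h)).mapMatrix (mulMat s) =
        (actAlg v g).mapMatrix ((actAlg v h).mapMatrix (mulMat s)) := by
      simp only [actAlg_mulMat, map_sum, map_smul, map_mul, actAlg_scalarMat, mul_inv_rev,
        extMat_mul, scalarMat_mul, mat_mul, Matrix.mul_apply, Finset.sum_smul, Finset.mul_sum,
        Finset.sum_mul, Finset.smul_sum, mul_smul, Matrix.mul_smul, Matrix.smul_mul]
      rw [Finset.sum_comm]
      refine Finset.sum_congr rfl fun x _ => Finset.sum_congr rfl fun y _ => ?_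
      rw [smul_comm]
      simp only [Matrix.mul_assoc]
    exact congrFun (congrFun key r) (some t)

/-- The natural representation of `GL(W)` on `R`, by algebra automorphisms. -/
def coordRep : Representation ℂ (GLW W) (R d) where
  toFun g := (actAlg v g).toLinearMap
  map_one' := by rw [actAlg_one]; rfl
  map_mul' g h := by rw [actAlg_mul]; rfl

/-- The representation `det ⊗ R` of `GL(W)`: the natural action on `R`, twisted by the
determinant. -/
def twistedRep : Representation ℂ (GLW W) (R d) where
  toFun g := LinearMap.det (stdRep W g) • coordRep v g
  map_one' := by simp
  map_mul' g h := by
    simp only [map_mul]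
    rw [smul_mul_smul_comm]

theorem actAlg_comm (g : GLW W) (i k : Fin d) :
    (actAlg v g).mapMatrix (mulMat k * mulMat i - mulMat i * mulMat k) =
      ∑ k', ∑ i', (mat v g k' k * mat v g i' i) • (scalarMat (extMat v g⁻¹) *
        ((mulMat k' * mulMat i' - mulMat i' * mulMat k') * scalarMat (extMat v g))) := by
  have h : ∀ x y : Fin d,
      scalarMat (extMat v g⁻¹) * mulMat x * scalarMat (extMat v g) *
        (scalarMat (extMat v g⁻¹) * mulMat y * scalarMat (extMat v g)) =
      scalarMat (extMat v g⁻¹) * (mulMat x * mulMat y * scalarMat (extMat v g)) := fun x y => by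
    simp only [Matrix.mul_assoc]
    rw [← Matrix.mul_assoc (scalarMat (extMat v g)), scalarMat_mul_inv, Matrix.one_mul]
  have h' : ∀ x y : Fin d, (actAlg v g).mapMatrix (mulMat x * mulMat y) =
      ∑ x', ∑ y', (mat v g x' x * mat v g y' y) • (scalarMat (extMat v g⁻¹) *
        (mulMat x' * mulMat y' * scalarMat (extMat v g))) := fun x y => by
    rw [map_mul, actAlg_mulMat, actAlg_mulMat, Finset.sum_mul_sum]
    refine Finset.sum_congr rfl fun x' _ => Finset.sum_congr rfl fun y' _ => ?_
    rw [smul_mul_smul_comm, h]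
  rw [map_sub, h', h', Finset.sum_comm (f := fun x' y' => (mat v g x' i * mat v g y' k) • _),
    ← Finset.sum_sub_distrib]
  refine Finset.sum_congr rfl fun x' _ => ?_
  rw [← Finset.sum_sub_distrib]
  refine Finset.sum_congr rfl fun y' _ => ?_
  rw [mul_comm (mat v g y' i), ← smul_sub, Matrix.sub_mul, Matrix.mul_sub]

theorem conj_apply (g : GLW W) (A : Matrix (Option (Fin d)) (Option (Fin d)) (R d))
    (a j : Fin d) :
    (scalarMat (extMat v g⁻¹) * (A * scalarMat (extMat v g))) (some a) (some j) =
      ∑ a', ∑ j', (mat v g⁻¹ a a' * mat v g j' j) • A (some a') (some j') := by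
  rw [Matrix.mul_apply, Fintype.sum_option, scalarMat_apply,
    show extMat v g⁻¹ (some a) none = 0 from rfl, map_zero, zero_mul, zero_add]
  refine Finset.sum_congr rfl fun a' _ => ?_
  rw [Matrix.mul_apply, Fintype.sum_option, scalarMat_apply _ none,
    show extMat v g none (some j) = 0 from rfl, map_zero, mul_zero, zero_add, Finset.mul_sum]
  refine Finset.sum_congr rfl fun j' _ => ?_
  rw [scalarMat_apply, scalarMat_apply, Algebra.smul_def, map_mul,
    show extMat v g⁻¹ (some a) (some a') = mat v g⁻¹ a a' from rfl,
    show extMat v g (some j') (some j) = mat v g j' j from rfl]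
  ring

theorem actAlg_C (g : GLW W) (a j i k : Fin d) :
    actAlg v g (C a j i k) = ∑ k', ∑ i', (mat v g k' k * mat v g i' i) • ∑ a', ∑ j',
      (mat v g⁻¹ a a' * mat v g j' j) • C a' j' i' k' := by
  have hh := congrFun (congrFun (actAlg_comm v g i k) (some a)) (some j)
  rw [AlgHom.mapMatrix_apply, Matrix.map_apply, ← C_eq_mulMat] at hh
  rw [hh]
  simp only [Matrix.sum_apply, Matrix.smul_apply, conj_apply, C_eq_mulMat]

/-- The representation `Y` of `GL(W)` spanned by the `C(a; j, (i, k))`, as a subrepresentation of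
`det ⊗ R`. -/
def Y : Subrepresentation (twistedRep v) where
  toSubmodule := Yspan d
  apply_mem_toSubmodule g := by
    intro f hf
    refine Submodule.smul_mem _ _ ?_
    induction hf using Submodule.span_induction with
    | mem x hx =>
      obtain ⟨a, j, i, k, rfl⟩ := hx
      change actAlg v g (C a j i k) ∈ _
      rw [actAlg_C]
      exact Submodule.sum_mem _ fun k' _ => Submodule.sum_mem _ fun i' _ =>
        Submodule.smul_mem _ _ <| Submodule.sum_mem _ fun a' _ => Submodule.sum_mem _ fun j' _ =>
        Submodule.smul_mem _ _ (Submodule.subset_span ⟨a', j', i', k', rfl⟩)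
    | zero => simp
    | add x y _ _ hx hy => rw [map_add]; exact Submodule.add_mem _ hx hy
    | smul c x _ hx => rw [map_smul]; exact Submodule.smul_mem _ _ hx

/-- `Y` as a representation of `GL(W)`. -/
abbrev Yrep : Representation ℂ (GLW W) (Y v).toSubmodule := (Y v).toRepresentation

/-- `C(a; j, (i, k))` as an element of `Y`. -/
def genY (a j i k : Fin d) : (Y v).toSubmodule :=
  ⟨C a j i k, Submodule.subset_span ⟨a, j, i, k, rfl⟩⟩

/-- `v_1 ∧ ⋯ ∧ v_d` with the factor `v_a` omitted. -/
def wedgeOmit (a : Fin d) : ⋀[ℂ]^(d - 1) W :=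
  exteriorPower.ιMulti ℂ (d - 1) fun b : Fin (d - 1) =>
    v ⟨if (b : ℕ) < a then b else b + 1, by split <;> omega⟩

/-- `(-1)^a (v_1 ∧ ⋯ ∧ v̂_a ∧ ⋯ ∧ v_d) ⊗ v_j ⊗ (v_i ∧ v_k)`, where the indices, which run through
`0, …, d - 1` here, are counted from `1` in the sign. -/
def genT (a j i k : Fin d) : ⋀[ℂ]^(d - 1) W ⊗[ℂ] (W ⊗[ℂ] ⋀[ℂ]^2 W) :=
  (-1 : ℂ) ^ ((a : ℕ) + 1) •
    (wedgeOmit v a ⊗ₜ[ℂ] (v j ⊗ₜ[ℂ] exteriorPower.ιMulti ℂ 2 ![v i, v k]))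

end Generators

end

end HilbertSymmetric

open scoped TensorProduct

namespace HilbertSymmetric

noncomputable section

open Module

/-! Since `⋀^{d-1} W` is `det ⊗ W*`, the space `T` is a copy of `det ⊗ W* ⊗ W ⊗ ⋀² W`, spanned by
tensors `t(α; w, x, y)` alternating in `x, y`. The generators are entries of commutators of the
operators `ℓ ↦ P(x_k ℓ)` and transform like these tensors, so `t(v_a^*; v_j, v_i, v_k) ↦ C(a; j, (i,
k))` defines an equivariant surjection `Q : T → Y`. The congruence modulo `T'` says that `φ` is a
section of `Q`, once `T'` is known to be the kernel.

Two kinds of kernel elements are visible: cyclic sums over the three vectors, by commutativity of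
the `x_i`, and traces, because a commutator has trace zero. `ker_toR` shows that they span the
kernel. Evaluating the linear and the quadratic part of a relation at symmetric matrices determines,
up to a skew matrix, the part of its coordinates symmetric in the first two vectors; modulo cyclic
sums this part determines the element, and the skew matrix contributes nothing modulo the kernel
elements already found.

Beside the kernel there are two further pieces: the span of `t(α; w, w, x)` with `α(w) = α(x) = 0`,
and the span of the contractions `∑ t(v_a^*; w, w, v_a)`. `sup_eq_top`, `primitive_schur` and
`polarSub_inf` show that `T` is the direct sum of these and the kernel. The kernel consists of
traces, traces of cyclic sums, and cyclic sums whose covector kills all three vectors.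

Highest weight theory and complete reducibility are not used. Each piece is generated by one vector
`u`, and an intertwining map sends `u` to a vector sharing all eigenvector relations of `u`
(`StabLike`). Testing with dilations and permutations of the basis, and one transvection for traces,
leaves only multiples of `u`, or combinations of two vectors for the type `(2, 2, 1, …, 1)`. This
replaces Schur's lemma: it computes isotypic components (`isotypic_le`) and supplies the scalar in
`HilbertSymmetric.orbit_equiv_schur`, which matches a piece with the image of a Young symmetrizer.
That scalar is nonzero by a sum of squares argument, `col_row_col_ne_zero`.

Finally `exists_unique_section` inverts `Q` on the complement of its kernel. Uniqueness holds
because the difference of two sections sends each generator of the complement to a multiple of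
itself lying in the kernel. -/

theorem update_pair_zero {W : Type*} (x y z : W) : Function.update ![x, y] 0 z = ![z, y] := by
  ext i
  fin_cases i <;> simp

theorem update_pair_one {W : Type*} (x y z : W) : Function.update ![x, y] 1 z = ![x, z] := by
  ext i
  fin_cases i <;> simp

/-! ### The identification of `⋀^{d-1} W` with `det ⊗ W*` -/

section Ambient

variable {d : ℕ} {W : Type*} [AddCommGroup W] [Module ℂ W]

/-- The exterior product `x ∧ y` as a bilinear map. -/
def wedgePair : W →ₗ[ℂ] W →ₗ[ℂ] ⋀[ℂ]^2 W :=
  LinearMap.mk₂ ℂ (fun x y => exteriorPower.ιMulti ℂ 2 ![x, y])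
    (fun x x' y => by
      have := (exteriorPower.ιMulti ℂ 2).map_update_add ![x, y] 0 x x'
      simpa only [update_pair_zero, update_pair_one] using this)
    (fun c x y => by
      have := (exteriorPower.ιMulti ℂ 2).map_update_smul ![x, y] 0 c x
      simpa only [update_pair_zero, update_pair_one] using this)
    (fun x y y' => by
      have := (exteriorPower.ιMulti ℂ 2).map_update_add ![x, y] 1 y y'
      simpa only [update_pair_zero, update_pair_one] using this)
    (fun c x y => by
      have := (exteriorPower.ιMulti ℂ 2).map_update_smul ![x, y] 1 c y
      simpa only [update_pair_zero, update_pair_one] using this)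

theorem wedgePair_apply (x y : W) : wedgePair x y = exteriorPower.ιMulti ℂ 2 ![x, y] := rfl

theorem wedgePair_self (x : W) : wedgePair x x = 0 :=
  (exteriorPower.ιMulti ℂ 2).map_eq_zero_of_eq ![x, x] (i := 0) (j := 1) rfl (by simp)

/-- The linear form on an exterior power given by a family of covectors. -/
def wedgeForm {m : ℕ} (F : Fin m → Dual ℂ W) : ⋀[ℂ]^m W →ₗ[ℂ] ℂ :=
  exteriorPower.pairingDual ℂ W m (exteriorPower.ιMulti ℂ m F)

theorem wedgeForm_ιMulti {m : ℕ} (F : Fin m → Dual ℂ W) (y : Fin m → W) :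
    wedgeForm F (exteriorPower.ιMulti ℂ m y) = (Matrix.of fun i j => F i (y j)).det := by
  rw [wedgeForm, exteriorPower.pairingDual_ιMulti_ιMulti, ← Matrix.det_transpose]
  rfl

theorem wedgeForm_pair (β γ : Dual ℂ W) (x y : W) :
    wedgeForm ![β, γ] (wedgePair x y) = β x * γ y - β y * γ x := by
  rw [wedgePair_apply, wedgeForm_ιMulti, Matrix.det_fin_two]
  simp

variable (v : Basis (Fin d) ℂ W)

/-- The increasing enumeration of the indices different from `a`. -/
def omitIdx (a : Fin d) (b : Fin (d - 1)) : Fin d :=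
  ⟨if (b : ℕ) < a then b else b + 1, by split <;> omega⟩

theorem wedgeOmit_eq (a : Fin d) :
    wedgeOmit v a = exteriorPower.ιMulti ℂ (d - 1) fun b => v (omitIdx a b) := rfl

theorem omitIdx_injective (a : Fin d) : Function.Injective (omitIdx a) := by
  intro b c h
  simp only [omitIdx, Fin.mk.injEq] at h
  ext
  split_ifs at h <;> omega

theorem omitIdx_ne (a : Fin d) (b : Fin (d - 1)) : omitIdx a b ≠ a := by
  intro h
  have := congrArg Fin.val h
  simp only [omitIdx] at this
  split_ifs at this <;> omega

theorem exists_omitIdx_eq {a c : Fin d} (h : c ≠ a) : ∃ b, omitIdx a b = c := by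
  have h' : (c : ℕ) ≠ a := fun e => h (Fin.ext e)
  by_cases hc : (c : ℕ) < a
  · exact ⟨⟨c, by omega⟩, by ext; simp [omitIdx, hc]⟩
  · refine ⟨⟨c - 1, by omega⟩, ?_⟩
    ext
    simp only [omitIdx]
    split_ifs <;> omega

/-- For `a ≠ b` the factor `v_a` is present in the second wedge and is killed by every covector of
the first family, so the determinant has a zero column. -/
theorem wedgeForm_wedgeOmit (a b : Fin d) :
    wedgeForm (fun i => v.coord (omitIdx a i)) (wedgeOmit v b) = if a = b then 1 else 0 := by
  rw [wedgeOmit_eq, wedgeForm_ιMulti]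
  split_ifs with h
  · subst h
    rw [← Matrix.det_one (n := Fin (d - 1))]
    congr 1
    ext i j
    simp [Matrix.one_apply, Finsupp.single_apply, (omitIdx_injective a).eq_iff, eq_comm]
  · obtain ⟨j, hj⟩ := exists_omitIdx_eq h
    refine Matrix.det_eq_zero_of_column_eq_zero j fun i => ?_
    simp [hj, Finsupp.single_apply, (omitIdx_ne a i).symm]

/-- The map `α ↦ ∑ a, (-1)^a α(v_a) v_1 ∧ ⋯ ∧ v̂_a ∧ ⋯ ∧ v_d`, with indices counted from `1` in
the sign. -/
def dualWedge : Dual ℂ W →ₗ[ℂ] ⋀[ℂ]^(d - 1) W where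
  toFun α := ∑ a : Fin d, ((-1 : ℂ) ^ ((a : ℕ) + 1) * α (v a)) • wedgeOmit v a
  map_add' α β := by
    simp only [LinearMap.add_apply, mul_add, add_smul, Finset.sum_add_distrib]
  map_smul' c α := by
    simp only [LinearMap.smul_apply, smul_eq_mul, RingHom.id_apply, Finset.smul_sum, smul_smul]
    exact Finset.sum_congr rfl fun a _ => by ring_nf

theorem dualWedge_apply (α : Dual ℂ W) :
    dualWedge v α = ∑ a : Fin d, ((-1 : ℂ) ^ ((a : ℕ) + 1) * α (v a)) • wedgeOmit v a := rfl

theorem dualWedge_coord (a : Fin d) :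
    dualWedge v (v.coord a) = (-1 : ℂ) ^ ((a : ℕ) + 1) • wedgeOmit v a := by
  rw [dualWedge_apply, Finset.sum_eq_single a]
  · simp
  · intro b _ hb
    simp [hb]
  · simp

theorem wedgeForm_dualWedge_coord (a : Fin d) (α : Dual ℂ W) :
    wedgeForm (fun i => v.coord (omitIdx a i)) (dualWedge v α) =
      (-1 : ℂ) ^ ((a : ℕ) + 1) * α (v a) := by
  rw [dualWedge_apply, map_sum, Finset.sum_eq_single a]
  · rw [map_smul, wedgeForm_wedgeOmit]; simp
  · intro b _ hb
    rw [map_smul, wedgeForm_wedgeOmit, if_neg hb.symm]; simp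
  · simp

/-- The dual family of forms gives independence, and there are `d = (d choose d - 1)` vectors. -/
theorem span_wedgeOmit (hd : 0 < d) : Submodule.span ℂ (Set.range (wedgeOmit v)) = ⊤ := by
  have : Module.Finite ℂ W := Module.Finite.of_basis v
  have : Module.Free ℂ W := Module.Free.of_basis v
  have hli : LinearIndependent ℂ (wedgeOmit v) :=
    LinearIndependent.of_pairwise_dual_eq_zero_one _
      (fun a => wedgeForm (fun i => v.coord (omitIdx a i)))
      (fun a b h => by
        change wedgeForm _ (wedgeOmit v b) = 0
        rw [wedgeForm_wedgeOmit, if_neg h])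
      (fun a => by
        change wedgeForm _ (wedgeOmit v a) = 1
        rw [wedgeForm_wedgeOmit, if_pos rfl])
  have : Nonempty (Fin d) := ⟨⟨0, hd⟩⟩
  refine hli.span_eq_top_of_card_eq_finrank ?_
  rw [exteriorPower.finrank_eq, Module.finrank_eq_card_basis v, Fintype.card_fin,
    Nat.choose_symm (n := d) (k := 1) hd, Nat.choose_one_right]

theorem dualWedge_surjective (hd : 0 < d) : Function.Surjective (dualWedge v) := by
  rw [← LinearMap.range_eq_top, eq_top_iff, ← span_wedgeOmit v hd, Submodule.span_le]
  rintro _ ⟨a, rfl⟩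
  refine ⟨(-1 : ℂ) ^ ((a : ℕ) + 1) • v.coord a, ?_⟩
  rw [map_smul, dualWedge_coord, smul_smul, ← pow_add, ← two_mul, pow_mul]
  simp

theorem eq_zero_of_wedgeForm_eq_zero (hd : 0 < d) {ω : ⋀[ℂ]^(d - 1) W}
    (h : ∀ a : Fin d, wedgeForm (fun i => v.coord (omitIdx a i)) ω = 0) : ω = 0 := by
  obtain ⟨α, rfl⟩ := dualWedge_surjective v hd ω
  have : α = 0 := v.ext fun a => by
    have := h a
    rw [wedgeForm_dualWedge_coord] at this
    simpa using this
  rw [this, map_zero]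

/-- Laplace expansion along the row of `α`: the minors are the pairings with the wedges omitting one
vector. The minus sign appears because `dualWedge` counts indices from `1` and the expansion counts
from `0`. -/
theorem wedgeForm_dualWedge {n : ℕ} (v : Basis (Fin (n + 1)) ℂ W) (α : Dual ℂ W)
    (F : Fin n → Dual ℂ W) :
    wedgeForm (m := n + 1 - 1) F (dualWedge v α) =
      -(Matrix.of fun i j => (Fin.cons α F : Fin (n + 1) → Dual ℂ W) i (v j)).det := by
  rw [Matrix.det_succ_row_zero, dualWedge_apply, map_sum, ← Finset.sum_neg_distrib]
  refine Finset.sum_congr rfl fun a _ => ?_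
  rw [map_smul, wedgeOmit_eq, wedgeForm_ιMulti, smul_eq_mul, pow_succ]
  simp only [Matrix.of_apply, Fin.cons_zero]
  have : (Matrix.of fun i j => F i (v (omitIdx a j))) =
      (Matrix.of fun i j => (Fin.cons α F : Fin (n + 1) → Dual ℂ W) i (v j)).submatrix Fin.succ
        a.succAbove := by
    ext i j
    simp only [Matrix.of_apply, Matrix.submatrix_apply, Fin.cons_succ]
    congr 2
    ext
    simp only [omitIdx, Fin.succAbove, Fin.lt_def, Fin.val_castSucc]
    split_ifs <;> simp
  erw [this]
  ring

/-- Exchanging a covector of the family with the argument of `dualWedge` changes the sign. -/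
theorem wedgeForm_update_dualWedge (hd : 0 < d) (α : Dual ℂ W) (F : Fin (d - 1) → Dual ℂ W)
    (i : Fin (d - 1)) :
    wedgeForm (Function.update F i α) (dualWedge v (F i)) = -wedgeForm F (dualWedge v α) := by
  obtain ⟨n, rfl⟩ : ∃ n, d = n + 1 := ⟨d - 1, by omega⟩
  change Fin n → Dual ℂ W at F
  change Fin n at i
  rw [wedgeForm_dualWedge v α F]
  refine (wedgeForm_dualWedge v (F i) (Function.update F i α)).trans ?_
  -- Both sides are now determinants whose matrices differ by exchanging the row `0` with the row `i
  -- + 1`.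
  have h := Matrix.det_permute (Equiv.swap 0 i.succ)
    (Matrix.of fun k j => (Fin.cons α F : Fin (n + 1) → Dual ℂ W) k (v j))
  rw [Equiv.Perm.sign_swap (Fin.succ_ne_zero i).symm] at h
  rw [neg_neg, neg_eq_iff_eq_neg]
  refine Eq.trans ?_ (h.trans (by simp))
  congr 1
  ext k j
  simp only [Matrix.of_apply, Matrix.submatrix_apply, id]
  congr 1
  refine Fin.cases ?_ (fun l => ?_) k
  · simp
  · by_cases hl : l = i
    · subst hl; simp
    · rw [Equiv.swap_apply_of_ne_of_ne (Fin.succ_ne_zero l) (by simpa using hl)]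
      simp [hl]

theorem wedgeForm_extRep {m : ℕ} (F : Fin m → Dual ℂ W) (g : GLW W) (ω : ⋀[ℂ]^m W) :
    wedgeForm F (extRep W m g ω) = wedgeForm (fun i => F i ∘ₗ stdRep W g) ω := by
  have : wedgeForm F ∘ₗ extRep W m g = wedgeForm (fun i => F i ∘ₗ stdRep W g) := by
    refine exteriorPower.linearMap_ext (AlternatingMap.ext fun y => ?_)
    simp only [LinearMap.compAlternatingMap_apply, LinearMap.comp_apply]
    rw [show extRep W m g (exteriorPower.ιMulti ℂ m y) =
      exteriorPower.ιMulti ℂ m (stdRep W g ∘ y) from exteriorPower.map_apply_ιMulti _ _,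
      wedgeForm_ιMulti, wedgeForm_ιMulti]
    rfl
  exact LinearMap.congr_fun this ω

theorem stdRep_inv_apply (g : GLW W) (w : W) : stdRep W g⁻¹ (stdRep W g w) = w := by
  rw [← Module.End.mul_apply, ← map_mul, inv_mul_cancel, map_one, Module.End.one_apply]

theorem stdRep_apply_inv (g : GLW W) (w : W) : stdRep W g (stdRep W g⁻¹ w) = w := by
  rw [← Module.End.mul_apply, ← map_mul, mul_inv_cancel, map_one, Module.End.one_apply]

/-- The matrix on the left is the matrix of covectors times the matrix of `h`. -/
theorem det_covectors_comp {ι : Type*} [Fintype ι] [DecidableEq ι] (v : Basis ι ℂ W)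
    (F : ι → Dual ℂ W) (h : W →ₗ[ℂ] W) :
    (Matrix.of fun i j => F i (h (v j))).det =
      LinearMap.det h * (Matrix.of fun i j => F i (v j)).det := by
  rw [← LinearMap.det_toMatrix v h, mul_comm, ← Matrix.det_mul]
  congr 1
  ext i j
  rw [Matrix.mul_apply, Matrix.of_apply, ← v.sum_repr (h (v j)), map_sum]
  exact Finset.sum_congr rfl fun k _ => by
    rw [map_smul, smul_eq_mul, mul_comm, LinearMap.toMatrix_apply]; rfl

/-- Up to the determinant, `dualWedge` is equivariant. -/
theorem extRep_dualWedge (hd : 0 < d) (g : GLW W) (α : Dual ℂ W) :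
    extRep W (d - 1) g (dualWedge v α) =
      LinearMap.det (stdRep W g) • dualWedge v (α ∘ₗ stdRep W g⁻¹) := by
  rw [← sub_eq_zero]
  refine eq_zero_of_wedgeForm_eq_zero v hd fun a => ?_
  rw [map_sub, map_smul, wedgeForm_extRep, sub_eq_zero]
  obtain ⟨n, rfl⟩ : ∃ n, d = n + 1 := ⟨d - 1, by omega⟩
  -- Writing `α` as `(α ∘ g⁻¹) ∘ g` makes every row a covector composed with `g`, so that a factor
  -- `det g` comes out.
  refine (wedgeForm_dualWedge v α _).trans ?_
  rw [show wedgeForm (fun i => v.coord (omitIdx a i)) (dualWedge v (α ∘ₗ stdRep W g⁻¹)) = _ from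
    wedgeForm_dualWedge v _ _, smul_eq_mul, mul_neg, ← det_covectors_comp]
  congr 2
  ext i j
  refine Fin.cases ?_ (fun l => ?_) i
  · simp
  · simp

end Ambient

/-! ### Spanning tensors of `T` and their abstract model -/

section Tens

variable {d : ℕ} {W : Type*} [AddCommGroup W] [Module ℂ W]

/-- The trilinear map `(w, x, y) ↦ w ⊗ (x ∧ y)`. -/
def tensWedge : W →ₗ[ℂ] W →ₗ[ℂ] W →ₗ[ℂ] W ⊗[ℂ] ⋀[ℂ]^2 W where
  toFun w := wedgePair.compr₂ (TensorProduct.mk ℂ W (⋀[ℂ]^2 W) w)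
  map_add' w w' := by ext x y; simp
  map_smul' c w := by ext x y; simp [TensorProduct.smul_tmul']

variable (v : Basis (Fin d) ℂ W)

/-- The multilinear map sending a covector `α` and vectors `w, x, y` to
`dualWedge α ⊗ w ⊗ (x ∧ y)`. -/
def tens : Dual ℂ W →ₗ[ℂ] W →ₗ[ℂ] W →ₗ[ℂ] W →ₗ[ℂ] ⋀[ℂ]^(d - 1) W ⊗[ℂ] (W ⊗[ℂ] ⋀[ℂ]^2 W) where
  toFun α :=
    { toFun := fun w => (tensWedge w).compr₂ (TensorProduct.mk ℂ _ _ (dualWedge v α))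
      map_add' := fun w w' => by ext x y; simp [TensorProduct.tmul_add]
      map_smul' := fun c w => by ext x y; simp }
  map_add' α β := by ext w x y; simp
  map_smul' c α := by ext w x y; simp [TensorProduct.smul_tmul']

theorem tens_apply (α : Dual ℂ W) (w x y : W) :
    tens v α w x y = dualWedge v α ⊗ₜ[ℂ] (w ⊗ₜ[ℂ] wedgePair x y) := rfl

theorem tens_self (α : Dual ℂ W) (w x : W) : tens v α w x x = 0 := by
  rw [tens_apply, wedgePair_self, TensorProduct.tmul_zero, TensorProduct.tmul_zero]

theorem genT_eq_tens (a j i k : Fin d) :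
    genT v a j i k = tens v (v.coord a) (v j) (v i) (v k) := by
  rw [genT, tens_apply, dualWedge_coord, TensorProduct.smul_tmul', wedgePair_apply]

theorem ambientRep_tens (hd : 0 < d) (g : GLW W) (α : Dual ℂ W) (w x y : W) :
    ambientRep W d g (tens v α w x y) = LinearMap.det (stdRep W g) •
      tens v (α ∘ₗ stdRep W g⁻¹) (stdRep W g w) (stdRep W g x) (stdRep W g y) := by
  rw [tens_apply, tens_apply]
  simp only [Representation.tprod_apply, TensorProduct.map_tmul]
  rw [extRep_dualWedge v hd, TensorProduct.smul_tmul']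
  refine congrArg (fun η : ⋀[ℂ]^2 W => LinearMap.det (stdRep W g) •
    (dualWedge v (α ∘ₗ stdRep W g⁻¹) ⊗ₜ[ℂ] (stdRep W g w ⊗ₜ[ℂ] η))) ?_
  rw [wedgePair_apply, wedgePair_apply]
  refine (exteriorPower.map_apply_ιMulti _ _).trans ?_
  congr 1
  ext i
  fin_cases i <;> simp

theorem tens_span (hd : 0 < d) :
    Submodule.span ℂ {x | ∃ α w y z, x = tens v α w y z} = ⊤ := by
  rw [eq_top_iff]
  rintro x -
  induction x using TensorProduct.induction_on with
  | zero => exact Submodule.zero_mem _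
  | add x y hx hy => exact Submodule.add_mem _ hx hy
  | tmul ω s =>
    obtain ⟨α, rfl⟩ := dualWedge_surjective v hd ω
    induction s using TensorProduct.induction_on with
    | zero => rw [TensorProduct.tmul_zero]; exact Submodule.zero_mem _
    | add x y hx hy => rw [TensorProduct.tmul_add]; exact Submodule.add_mem _ hx hy
    | tmul w η =>
      have h : ⊤ ≤ (Submodule.span ℂ {x | ∃ α w y z, x = tens v α w y z}).comap
          (TensorProduct.mk ℂ _ _ (dualWedge v α) ∘ₗ TensorProduct.mk ℂ _ _ w) := by
        rw [← exteriorPower.ιMulti_span, Submodule.span_le]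
        rintro _ ⟨y, rfl⟩
        refine Submodule.subset_span ⟨α, w, y 0, y 1, ?_⟩
        have : y = ![y 0, y 1] := by ext i; fin_cases i <;> rfl
        rw [tens_apply, wedgePair_apply, ← this]
        rfl
      exact h Submodule.mem_top

/-- The linear form on `⋀^{d-1} W` that evaluates the covector corresponding to an element
at `ω`. -/
def covectorEval (ω : W) : ⋀[ℂ]^(d - 1) W →ₗ[ℂ] ℂ :=
  ∑ a : Fin d, (v.coord a ω * (-1 : ℂ) ^ ((a : ℕ) + 1)) •
    wedgeForm (fun i => v.coord (omitIdx a i))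

theorem covectorEval_dualWedge (ω : W) (α : Dual ℂ W) :
    covectorEval v ω (dualWedge v α) = α ω := by
  conv_rhs => rw [← v.sum_repr ω, map_sum]
  simp only [covectorEval, LinearMap.sum_apply, LinearMap.smul_apply, wedgeForm_dualWedge_coord]
  refine Finset.sum_congr rfl fun a _ => ?_
  rw [map_smul, smul_eq_mul, smul_eq_mul, mul_assoc, ← mul_assoc ((-1 : ℂ) ^ _), ← pow_add,
    ← two_mul, pow_mul]
  simp

/-- The linear form `dualWedge α ⊗ w ⊗ (x ∧ y) ↦ α(ω) β(w) (γ(x) δ(y) - γ(y) δ(x))`. -/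
def tensForm (ω : W) (β γ δ : Dual ℂ W) : ⋀[ℂ]^(d - 1) W ⊗[ℂ] (W ⊗[ℂ] ⋀[ℂ]^2 W) →ₗ[ℂ] ℂ :=
  LinearMap.mul' ℂ ℂ ∘ₗ TensorProduct.map (covectorEval v ω)
    (LinearMap.mul' ℂ ℂ ∘ₗ TensorProduct.map β (wedgeForm ![γ, δ]))

theorem tensForm_tens (ω : W) (β γ δ : Dual ℂ W) (α : Dual ℂ W) (w x y : W) :
    tensForm v ω β γ δ (tens v α w x y) = α ω * (β w * (γ x * δ y - γ y * δ x)) := by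
  rw [tens_apply, tensForm]
  simp [covectorEval_dualWedge, wedgeForm_pair]

/-- A vector space `T` with an action of `GL(W)` that is spanned by the values of a multilinear
map `t` on `W* × W × W × W`, alternating in the last two arguments and equivariant up to the
determinant, with enough linear forms to separate its points: a copy of
`det ⊗ W* ⊗ W ⊗ ⋀² W`. -/
structure TensModel (W T : Type*) [AddCommGroup W] [Module ℂ W] [AddCommGroup T] [Module ℂ T] where
  /-- The action of `GL(W)`. -/
  rep : Representation ℂ (GLW W) T
  /-- The universal multilinear map. -/
  t : Dual ℂ W →ₗ[ℂ] W →ₗ[ℂ] W →ₗ[ℂ] W →ₗ[ℂ] T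
  t_self (α : Dual ℂ W) (w x : W) : t α w x x = 0
  rep_t (g : GLW W) (α : Dual ℂ W) (w x y : W) : rep g (t α w x y) = LinearMap.det (stdRep W g) •
    t (α ∘ₗ stdRep W g⁻¹) (stdRep W g w) (stdRep W g x) (stdRep W g y)
  span_t : Submodule.span ℂ {z | ∃ α w x y, z = t α w x y} = ⊤
  /-- The linear forms on `T` given by a vector and three covectors. -/
  form (ω : W) (β γ δ : Dual ℂ W) : T →ₗ[ℂ] ℂ
  form_t (ω : W) (β γ δ α : Dual ℂ W) (w x y : W) :
    form ω β γ δ (t α w x y) = α ω * (β w * (γ x * δ y - γ y * δ x))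

/-- The space `⋀^{d-1} W ⊗ W ⊗ ⋀² W` as a copy of `det ⊗ W* ⊗ W ⊗ ⋀² W`. -/
def ambientModel (hd : 0 < d) : TensModel W (⋀[ℂ]^(d - 1) W ⊗[ℂ] (W ⊗[ℂ] ⋀[ℂ]^2 W)) where
  rep := ambientRep W d
  t := tens v
  t_self := tens_self v
  rep_t := ambientRep_tens v hd
  span_t := tens_span v hd
  form := tensForm v
  form_t := tensForm_tens v

end Tens

/-! ### Coordinates in the model -/

namespace TensModel

variable {d : ℕ} {W T : Type*} [AddCommGroup W] [Module ℂ W] [AddCommGroup T] [Module ℂ T]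
  (m : TensModel W T) (v : Basis (Fin d) ℂ W)

theorem t_swap (α : Dual ℂ W) (w x y : W) : m.t α w y x = -m.t α w x y := by
  have h := m.t_self α w (x + y)
  simp only [map_add, LinearMap.add_apply, m.t_self, zero_add, add_zero] at h
  rw [add_comm] at h
  exact eq_neg_of_add_eq_zero_right h

theorem ext {M : Type*} [AddCommGroup M] [Module ℂ M] {f h : T →ₗ[ℂ] M}
    (H : ∀ α w x y, f (m.t α w x y) = h (m.t α w x y)) : f = h :=
  LinearMap.ext_on m.span_t fun _ ⟨α, w, x, y, e⟩ => by rw [e, H]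

theorem _root_.HilbertSymmetric.dual_eq_sum (α : Dual ℂ W) : α = ∑ a, α (v a) • v.coord a := by
  refine v.ext fun b => ?_
  simp

theorem ext_basis {M : Type*} [AddCommGroup M] [Module ℂ M] {f h : T →ₗ[ℂ] M}
    (H : ∀ a j i k, f (m.t (v.coord a) (v j) (v i) (v k)) =
      h (m.t (v.coord a) (v j) (v i) (v k))) : f = h := by
  refine m.ext fun α w x y => ?_
  rw [dual_eq_sum v α, ← v.sum_repr w, ← v.sum_repr x, ← v.sum_repr y]
  simp only [map_sum, map_smul, LinearMap.sum_apply, LinearMap.smul_apply, H]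

/-- Moves the group element from the tensor to the data of the form, so that the action can be read
off in coordinates. -/
theorem form_rep (g : GLW W) (ω : W) (β γ δ : Dual ℂ W) (z : T) :
    m.form ω β γ δ (m.rep g z) = LinearMap.det (stdRep W g) *
      m.form (stdRep W g⁻¹ ω) (β ∘ₗ stdRep W g) (γ ∘ₗ stdRep W g) (δ ∘ₗ stdRep W g) z := by
  have : m.form ω β γ δ ∘ₗ m.rep g = LinearMap.det (stdRep W g) •
      m.form (stdRep W g⁻¹ ω) (β ∘ₗ stdRep W g) (γ ∘ₗ stdRep W g) (δ ∘ₗ stdRep W g) := by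
    refine m.ext fun α w x y => ?_
    rw [LinearMap.comp_apply, m.rep_t, map_smul, m.form_t, LinearMap.smul_apply, m.form_t]
    rfl
  exact LinearMap.congr_fun this z

/-- The coordinates of an element of `T` with respect to a basis of `W`. -/
def coord (a j i k : Fin d) : T →ₗ[ℂ] ℂ :=
  m.form (v a) (v.coord j) (v.coord i) (v.coord k)

theorem coord_t (a j i k : Fin d) (α : Dual ℂ W) (w x y : W) :
    m.coord v a j i k (m.t α w x y) =
      α (v a) * (v.coord j w * (v.coord i x * v.coord k y - v.coord i y * v.coord k x)) :=
  m.form_t ..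

theorem coord_swap (a j i k : Fin d) (z : T) :
    m.coord v a j k i z = -m.coord v a j i k z := by
  have : m.coord v a j k i = -m.coord v a j i k := by
    refine m.ext fun α w x y => ?_
    rw [LinearMap.neg_apply, coord_t, coord_t]
    ring
  rw [this, LinearMap.neg_apply]

theorem coord_self (a j i : Fin d) (z : T) : m.coord v a j i i z = 0 :=
  self_eq_neg.1 (m.coord_swap v a j i i z)

theorem _root_.HilbertSymmetric.coord_basis (a b : Fin d) :
    v.coord a (v b) = if a = b then 1 else 0 := by
  simp [Finsupp.single_apply, eq_comm]

/-- Two terms survive because the coordinates are alternating in the last two indices. For a skew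
family `c` the result is twice one term, the source of the factors `2` in the expansions. -/
theorem sum_coord_smul {M : Type*} [AddCommGroup M] [Module ℂ M]
    (c : Fin d → Fin d → Fin d → Fin d → M) (a j i k : Fin d) :
    ∑ a', ∑ j', ∑ i', ∑ k', m.coord v a' j' i' k' (m.t (v.coord a) (v j) (v i) (v k)) •
      c a' j' i' k' = c a j i k - c a j k i := by
  simp only [coord_t, coord_basis]
  simp [mul_sub, sub_smul, Finset.sum_sub_distrib]

/-- The expansion of an element of `T` in coordinates. -/
theorem two_smul_eq_sum_coord (z : T) :
    (2 : ℂ) • z = ∑ a, ∑ j, ∑ i, ∑ k,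
      m.coord v a j i k z • m.t (v.coord a) (v j) (v i) (v k) := by
  have : (2 : ℂ) • (LinearMap.id : T →ₗ[ℂ] T) = ∑ a, ∑ j, ∑ i, ∑ k,
      (m.coord v a j i k).smulRight (m.t (v.coord a) (v j) (v i) (v k)) := by
    refine m.ext_basis v fun a j i k => ?_
    simp only [LinearMap.sum_apply, LinearMap.smulRight_apply]
    rw [m.sum_coord_smul v (fun a j i k => m.t (v.coord a) (v j) (v i) (v k)),
      m.t_swap _ _ (v i)]
    simp [two_smul]
  simpa using LinearMap.congr_fun this z

theorem eq_zero_of_coord {z : T} (h : ∀ a j i k, m.coord v a j i k z = 0) : z = 0 := by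
  have := m.two_smul_eq_sum_coord v z
  simpa [h] using this

/-! ### The invariant submodules -/

/-- The trilinear map `(w, x, y) ↦ f x y w`. -/
def _root_.HilbertSymmetric.rotate (f : W →ₗ[ℂ] W →ₗ[ℂ] W →ₗ[ℂ] T) :
    W →ₗ[ℂ] W →ₗ[ℂ] W →ₗ[ℂ] T :=
  ((LinearMap.lflip (R₀ := ℂ)).toLinearMap ∘ₗ f).flip

theorem _root_.HilbertSymmetric.rotate_apply (f : W →ₗ[ℂ] W →ₗ[ℂ] W →ₗ[ℂ] T) (w x y : W) :
    rotate f w x y = f x y w := rfl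

/-- The cyclic sum of `t α w x y` over the three vectors. -/
def cyc : Dual ℂ W →ₗ[ℂ] W →ₗ[ℂ] W →ₗ[ℂ] W →ₗ[ℂ] T where
  toFun α := m.t α + rotate (m.t α) + rotate (rotate (m.t α))
  map_add' α β := by ext w x y; simp [rotate_apply]; abel
  map_smul' c α := by ext w x y; simp [rotate_apply]

theorem cyc_apply (α : Dual ℂ W) (w x y : W) :
    m.cyc α w x y = m.t α w x y + m.t α x y w + m.t α y w x := rfl

theorem cyc_rotate (α : Dual ℂ W) (w x y : W) : m.cyc α x y w = m.cyc α w x y := by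
  rw [cyc_apply, cyc_apply]; abel

theorem cyc_swap (α : Dual ℂ W) (w x y : W) : m.cyc α w y x = -m.cyc α w x y := by
  rw [cyc_apply, cyc_apply, m.t_swap α w x y, m.t_swap α y w x, m.t_swap α x y w]; abel

theorem cyc_self (α : Dual ℂ W) (w x : W) : m.cyc α w x x = 0 := by
  rw [cyc_apply, m.t_self, m.t_swap α x w x]; abel

theorem rep_cyc (g : GLW W) (α : Dual ℂ W) (w x y : W) :
    m.rep g (m.cyc α w x y) = LinearMap.det (stdRep W g) •
      m.cyc (α ∘ₗ stdRep W g⁻¹) (stdRep W g w) (stdRep W g x) (stdRep W g y) := by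
  simp only [cyc_apply, map_add, m.rep_t, smul_add]

/-- The contraction `∑ a, t(v_a^*; v_a, x, y)`. -/
def trace : W →ₗ[ℂ] W →ₗ[ℂ] T := ∑ a, m.t (v.coord a) (v a)

theorem trace_apply (x y : W) : m.trace v x y = ∑ a, m.t (v.coord a) (v a) x y := by
  simp [trace]

/-- The contraction `∑ a, (cyclic sum of t(v_a^*; v_a, x, y))`. -/
def cycTrace : W →ₗ[ℂ] W →ₗ[ℂ] T := ∑ a, m.cyc (v.coord a) (v a)

theorem cycTrace_apply (x y : W) : m.cycTrace v x y = ∑ a, m.cyc (v.coord a) (v a) x y := by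
  simp [cycTrace]

/-- The contraction `∑ a, t(v_a^*; w, x, v_a)`. -/
def polar : W →ₗ[ℂ] W →ₗ[ℂ] T := ∑ a, rotate (m.t (v.coord a)) (v a)

theorem polar_apply (w x : W) : m.polar v w x = ∑ a, m.t (v.coord a) w x (v a) := by
  simp [polar, rotate_apply]

/-- Contractions do not depend on the choice of dual bases. -/
theorem _root_.HilbertSymmetric.contraction_invariant {M : Type*} [AddCommGroup M] [Module ℂ M]
    (f : Dual ℂ W →ₗ[ℂ] W →ₗ[ℂ] M) (g : GLW W) :
    ∑ a, f (v.coord a ∘ₗ stdRep W g⁻¹) (stdRep W g (v a)) = ∑ a, f (v.coord a) (v a) := by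
  have h : ∀ a, f (v.coord a ∘ₗ stdRep W g⁻¹) (stdRep W g (v a)) =
      ∑ b, v.coord a (stdRep W g⁻¹ (v b)) • f (v.coord b) (stdRep W g (v a)) := fun a => by
    conv_lhs => rw [dual_eq_sum v (v.coord a ∘ₗ stdRep W g⁻¹)]
    simp only [map_sum, map_smul, LinearMap.sum_apply, LinearMap.smul_apply, LinearMap.comp_apply]
  simp only [h]
  rw [Finset.sum_comm]
  refine Finset.sum_congr rfl fun b _ => ?_
  conv_rhs => rw [← stdRep_apply_inv g (v b), ← v.sum_repr (stdRep W g⁻¹ (v b))]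
  simp only [map_sum, map_smul]
  rfl

theorem rep_trace (g : GLW W) (x y : W) : m.rep g (m.trace v x y) =
    LinearMap.det (stdRep W g) • m.trace v (stdRep W g x) (stdRep W g y) := by
  rw [trace_apply, map_sum]
  simp only [m.rep_t]
  rw [← Finset.smul_sum]
  congr 1
  have := contraction_invariant v m.t g
  have := congrArg (fun f => f (stdRep W g x) (stdRep W g y)) this
  simpa [trace_apply] using this

theorem rep_cycTrace (g : GLW W) (x y : W) : m.rep g (m.cycTrace v x y) =
    LinearMap.det (stdRep W g) • m.cycTrace v (stdRep W g x) (stdRep W g y) := by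
  rw [cycTrace_apply, map_sum]
  simp only [m.rep_cyc]
  rw [← Finset.smul_sum]
  congr 1
  have := contraction_invariant v m.cyc g
  have := congrArg (fun f => f (stdRep W g x) (stdRep W g y)) this
  simpa [cycTrace_apply] using this

theorem rep_polar (g : GLW W) (w x : W) : m.rep g (m.polar v w x) =
    LinearMap.det (stdRep W g) • m.polar v (stdRep W g w) (stdRep W g x) := by
  rw [polar_apply, map_sum]
  simp only [m.rep_t]
  rw [← Finset.smul_sum]
  congr 1
  have := contraction_invariant v
    ((m.t.flip (stdRep W g w)).flip (stdRep W g x)) g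
  simpa [polar_apply] using this

theorem trace_swap (x y : W) : m.trace v y x = -m.trace v x y := by
  rw [trace_apply, trace_apply, ← Finset.sum_neg_distrib]
  exact Finset.sum_congr rfl fun a _ => m.t_swap _ _ _ _

theorem cycTrace_swap (x y : W) : m.cycTrace v y x = -m.cycTrace v x y := by
  rw [cycTrace_apply, cycTrace_apply, ← Finset.sum_neg_distrib]
  exact Finset.sum_congr rfl fun a _ => m.cyc_swap _ _ _ _

/-- The span of the elements `t(α; w, w, x)` with `α(w) = α(x) = 0`. -/
def primitive : Submodule ℂ T :=
  Submodule.span ℂ {z | ∃ (α : Dual ℂ W) (w x : W), α w = 0 ∧ α x = 0 ∧ z = m.t α w w x}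

/-- The span of the elements `cyc(α; w, x, y)` with `α(w) = α(x) = α(y) = 0`. -/
def cycPrimitive : Submodule ℂ T :=
  Submodule.span ℂ {z | ∃ (α : Dual ℂ W) (w x y : W),
    α w = 0 ∧ α x = 0 ∧ α y = 0 ∧ z = m.cyc α w x y}

/-- The span of the elements `polar w w`. -/
def polarSub : Submodule ℂ T := Submodule.span ℂ {z | ∃ w, z = m.polar v w w}

/-- The span of the elements `trace x y`. -/
def traceSub : Submodule ℂ T := Submodule.span ℂ {z | ∃ x y, z = m.trace v x y}

/-- The span of the elements `cycTrace x y`. -/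
def cycTraceSub : Submodule ℂ T := Submodule.span ℂ {z | ∃ x y, z = m.cycTrace v x y}

/-- The span of all cyclic sums. -/
def cycSub : Submodule ℂ T := Submodule.span ℂ {z | ∃ α w x y, z = m.cyc α w x y}

end TensModel

/-! ### Vanishing criteria and the spanning of `T` by the four families -/

section Vanishing

variable {d : ℕ} {W M : Type*} [AddCommGroup W] [Module ℂ W] [AddCommGroup M] [Module ℂ M]

/-- For contractions whose terms agree away from an exceptional index; the factor `d - 1` is nonzero
in the range `3 ≤ d`. -/
theorem sum_const_off_one {G : Fin d → M} {c : M} (j : Fin d) (h : ∀ a, a ≠ j → G a = c) :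
    ∑ a, G a = G j + ((d : ℂ) - 1) • c := by
  rw [← Finset.add_sum_erase _ _ (Finset.mem_univ j),
    Finset.sum_congr rfl fun a ha => h a (Finset.ne_of_mem_erase ha), Finset.sum_const,
    Finset.card_erase_of_mem (Finset.mem_univ j), Finset.card_univ, Fintype.card_fin,
    ← Nat.cast_smul_eq_nsmul ℂ, Nat.cast_pred j.pos]

theorem sum_const_off_pair {G : Fin d → M} {c : M} {l j : Fin d} (hlj : l ≠ j)
    (h : ∀ a, a ≠ l → a ≠ j → G a = c) :
    ∑ a, G a = G l + G j + ((d : ℂ) - 2) • c := by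
  have h' : ∀ a, a ≠ l → G a - (if a = j then G j - c else 0) = c := fun a ha => by
    split_ifs with e
    · rw [e]; abel
    · rw [h a ha e, sub_zero]
  have := sum_const_off_one l h'
  rw [Finset.sum_sub_distrib, Finset.sum_ite_eq', if_pos (Finset.mem_univ j), if_neg hlj,
    sub_eq_iff_eq_add] at this
  rw [this]
  module

variable (v : Basis (Fin d) ℂ W) (f : Dual ℂ W →ₗ[ℂ] W →ₗ[ℂ] W →ₗ[ℂ] W →ₗ[ℂ] M)

theorem eq_zero_of_smul_eq_zero' {c : ℂ} (hc : c ≠ 0) {x : M} (h : c • x = 0) : x = 0 :=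
  (smul_eq_zero.1 h).resolve_left hc

theorem eq_zero_of_eq_neg' {x : M} (h : x = -x) : x = 0 :=
  eq_zero_of_smul_eq_zero' (c := 2) two_ne_zero (by rw [two_smul]; nth_rw 2 [h]; abel)

/-- A multilinear map that is alternating in the last two arguments vanishes if it vanishes on
primitive elements, cyclic sums and contractions. -/
theorem multilinear_eq_zero (hd : 3 ≤ d) (h_swap : ∀ α w x y, f α w y x = -f α w x y)
    (h_prim : ∀ α w x, α w = 0 → α x = 0 → f α w w x = 0)
    (h_cyc : ∀ α w x y, f α w x y + f α x y w + f α y w x = 0)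
    (h_trace : ∀ x y, ∑ a, f (v.coord a) (v a) x y = 0)
    (h_polar : ∀ w, ∑ a, f (v.coord a) w w (v a) = 0) (a j i k : Fin d) :
    f (v.coord a) (v j) (v i) (v k) = 0 := by
  have hd' : (3 : ℝ) ≤ d := by exact_mod_cast hd
  have h_self : ∀ α w x, f α w x x = 0 := fun α w x => eq_zero_of_eq_neg' (h_swap α w x x)
  have hco : ∀ {p r : Fin d}, p ≠ r → v.coord p (v r) = 0 := fun h => by
    rw [coord_basis, if_neg h]
  have hco1 : ∀ p : Fin d, v.coord p (v p) = 1 := fun p => by rw [coord_basis, if_pos rfl]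
  -- three vectors killed by the covector
  have s1 : ∀ α w x y, α w = 0 → α x = 0 → α y = 0 → f α w x y = 0 := by
    intro α w x y hw hx hy
    -- Polarization: on the kernel of `α` the map is alternating in the first two vectors as well,
    -- hence in all three, so the cyclic sum is three times one term.
    have hp : ∀ p r s, α p = 0 → α r = 0 → α s = 0 → f α p r s + f α r p s = 0 := by
      intro p r s h1 h2 h3
      have := h_prim α (p + r) s (by simp [h1, h2]) h3
      simp only [map_add, LinearMap.add_apply, h_prim α p s h1 h3, h_prim α r s h2 h3] at this
      simpa [add_comm] using this
    have e1 := hp w x y hw hx hy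
    have e2 := hp w y x hw hy hx
    have e3 := h_cyc α w x y
    rw [h_swap α x w y] at e3
    rw [h_swap α w x y] at e2
    refine eq_zero_of_smul_eq_zero' (c := 3) (by norm_num) ?_
    linear_combination (norm := module) e3 + e1 - e2
  -- one index of the exterior product contracted, the other two vectors equal
  have s2 : ∀ b l : Fin d, b ≠ l → f (v.coord b) (v l) (v l) (v b) = 0 := by
    intro b l hbl
    -- The covector `v_b^* - v_p^*` kills `v_b + v_p`; the corresponding primitive element compares
    -- two terms of the contraction.
    have h1 : ∀ p, p ≠ l → f (v.coord p) (v l) (v l) (v p) = f (v.coord b) (v l) (v l) (v b) := by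
      intro p hp
      by_cases hpb : p = b
      · rw [hpb]
      have := h_prim (v.coord b - v.coord p) (v l) (v b + v p)
        (by simp only [LinearMap.sub_apply, hco hbl, hco hp]; norm_num)
        (by simp only [LinearMap.sub_apply, map_add, hco1, hco hpb, hco (Ne.symm hpb)]; norm_num)
      simp only [map_add, map_sub, LinearMap.sub_apply,
        h_prim (v.coord b) (v l) (v p) (hco hbl) (hco (Ne.symm hpb)),
        h_prim (v.coord p) (v l) (v b) (hco hp) (hco hpb)] at this
      linear_combination (norm := module) -this
    have h2 := h_polar (v l)
    rw [sum_const_off_one l h1, h_self, zero_add] at h2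
    refine eq_zero_of_smul_eq_zero' (fun e => ?_) h2
    have := congrArg Complex.re e
    simp at this
    linarith
  have s3 : ∀ b l p : Fin d, b ≠ l → b ≠ p → l ≠ p →
      f (v.coord b) (v b) (v l) (v p) + f (v.coord b) (v l) (v b) (v p) =
        f (v.coord l) (v l) (v l) (v p) := by
    intro b l p hbl hbp hlp
    -- The difference of these two primitive relations isolates the terms mixed in `v_b, v_l`. The
    -- leftover term with covector `v_l^*` and repeated vector `v_b` is removed by `s1`.
    have e1 := h_prim (v.coord b - v.coord l) (v b + v l) (v p)
      (by simp only [LinearMap.sub_apply, map_add, hco1, hco hbl, hco hbl.symm]; norm_num)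
      (by simp only [LinearMap.sub_apply, hco hbp, hco hlp]; norm_num)
    have e2 := h_prim (v.coord b + v.coord l) (v l - v b) (v p)
      (by simp only [LinearMap.add_apply, map_sub, hco1, hco hbl, hco hbl.symm]; norm_num)
      (by simp only [LinearMap.add_apply, hco hbp, hco hlp]; norm_num)
    have e3 := s1 (v.coord l) (v b) (v b) (v p) (hco hbl.symm) (hco hbl.symm) (hco hlp)
    simp only [map_add, map_sub, LinearMap.sub_apply, LinearMap.add_apply] at e1 e2
    rw [← sub_eq_zero]
    refine eq_zero_of_smul_eq_zero' (c := 2) (by norm_num) ?_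
    linear_combination (norm := module) e1 - e2 + (2 : ℂ) • e3
  -- Two instances of `s3` and the cyclic relation are three equations for the three unknowns with
  -- covector `v_b^*`.
  have s4 : ∀ b l p : Fin d, b ≠ l → b ≠ p → l ≠ p → f (v.coord b) (v b) (v l) (v p) =
      (1 / 3 : ℂ) • (f (v.coord l) (v l) (v l) (v p) - f (v.coord p) (v p) (v p) (v l)) := by
    intro b l p hbl hbp hlp
    have e1 := s3 b l p hbl hbp hlp
    have e2 := s3 b p l hbp hbl hlp.symm
    have e3 := h_cyc (v.coord b) (v b) (v l) (v p)
    rw [h_swap _ _ (v l) (v p)] at e2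
    rw [h_swap _ _ (v b) (v p)] at e3
    linear_combination (norm := module) (1 / 3 : ℂ) • (e1 - e2 + e3)
  -- In the trace the two exceptional terms give the difference once and each of the other `d - 2`
  -- terms gives a third of it, in total the factor `(d + 1) / 3`.
  have s5 : ∀ l p : Fin d, l ≠ p →
      f (v.coord l) (v l) (v l) (v p) = f (v.coord p) (v p) (v p) (v l) := by
    intro l p hlp
    have h := h_trace (v l) (v p)
    rw [sum_const_off_pair hlp fun b hbl hbp => s4 b l p hbl hbp hlp,
      h_swap (v.coord p) (v p) (v p) (v l)] at h
    rw [← sub_eq_zero]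
    refine eq_zero_of_smul_eq_zero' (c := ((d : ℂ) + 1) / 3) (fun e => ?_) ?_
    · have := congrArg Complex.re e
      simp at this
      linarith
    · linear_combination (norm := module) h
  -- The polarized contraction is `-2 (d - 1)` times the value in question: `-2` from the indices
  -- `l, p` together and `-2` from each other index.
  have s6 : ∀ l p : Fin d, l ≠ p → f (v.coord l) (v l) (v l) (v p) = 0 := by
    intro l p hlp
    have h := h_polar (v l + v p)
    have h1 := h_polar (v l)
    have h2 := h_polar (v p)
    simp only [map_add, LinearMap.add_apply, Finset.sum_add_distrib, h1, h2] at h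
    rw [zero_add, add_zero, ← Finset.sum_add_distrib, sum_const_off_pair hlp
      (c := (-2 : ℂ) • f (v.coord l) (v l) (v l) (v p))] at h
    · rw [h_self, h_self, h_swap (v.coord l) (v l) (v l) (v p),
        h_swap (v.coord p) (v p) (v p) (v l), ← s5 l p hlp] at h
      refine eq_zero_of_smul_eq_zero' (c := -2 * ((d : ℂ) - 1)) (fun e => ?_) ?_
      · have := congrArg Complex.re e
        simp at this
        linarith
      · linear_combination (norm := module) h
    · intro b hbl hbp
      have e1 := s3 b l p hbl hbp hlp
      have e2 := s3 b p l hbp hbl hlp.symm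
      rw [h_swap _ _ (v l) (v p), ← s5 l p hlp] at e2
      rw [h_swap _ _ (v b) (v p), h_swap _ _ (v b) (v l)]
      linear_combination (norm := module) -e1 - e2
  have s7 : ∀ b l p : Fin d, b ≠ l → b ≠ p → l ≠ p → f (v.coord b) (v b) (v l) (v p) = 0 := by
    intro b l p hbl hbp hlp
    rw [s4 b l p hbl hbp hlp, s5 l p hlp, sub_self, smul_zero]
  have s8 : ∀ b l p : Fin d, b ≠ p → f (v.coord b) (v l) (v b) (v p) = 0 := by
    intro b l p hbp
    by_cases hbl : b = l
    · subst hbl; exact s6 b p hbp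
    by_cases hlp : l = p
    · subst hlp
      rw [h_swap, s2 b l hbl, neg_zero]
    have := s3 b l p hbl hbp hlp
    rwa [s6 l p hlp, s7 b l p hbl hbp hlp, zero_add] at this
  by_cases hik : i = k
  · rw [hik, h_self]
  by_cases hai : a = i
  · subst hai; exact s8 a j k hik
  by_cases hak : a = k
  · subst hak; rw [h_swap, s8 a j i hai, neg_zero]
  by_cases haj : a = j
  · subst haj; exact s7 a i k hai hak hik
  exact s1 _ _ _ _ (hco haj) (hco hai) (hco hak)

/-- A multilinear map that is alternating in the three vectors vanishes if it vanishes on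
primitive elements and contractions. -/
theorem alternating_eq_zero (hd : 3 ≤ d) (h_swap : ∀ α w x y, f α w y x = -f α w x y)
    (h_rotate : ∀ α w x y, f α x y w = f α w x y)
    (h_prim : ∀ α w x y, α w = 0 → α x = 0 → α y = 0 → f α w x y = 0)
    (h_trace : ∀ x y, ∑ a, f (v.coord a) (v a) x y = 0) (a j i k : Fin d) :
    f (v.coord a) (v j) (v i) (v k) = 0 := by
  have hd' : (3 : ℝ) ≤ d := by exact_mod_cast hd
  have h_self : ∀ α w x, f α w x x = 0 := fun α w x => eq_zero_of_eq_neg' (h_swap α w x x)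
  have h_self' : ∀ α w x, f α x x w = 0 := fun α w x => by rw [h_rotate, h_self]
  have hco : ∀ {p r : Fin d}, p ≠ r → v.coord p (v r) = 0 := fun h => by
    rw [coord_basis, if_neg h]
  have hco1 : ∀ p : Fin d, v.coord p (v p) = 1 := fun p => by rw [coord_basis, if_pos rfl]
  -- The terms of the trace with index outside `{l, p}` all agree and the other two vanish by
  -- alternation, leaving `d - 2` times one term.
  have key : ∀ b l p : Fin d, f (v.coord b) (v b) (v l) (v p) = 0 := by
    intro b l p
    by_cases hlp : l = p
    · rw [hlp, h_self]
    by_cases hbl : b = l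
    · rw [hbl, h_self']
    by_cases hbp : b = p
    · rw [hbp, h_swap, h_self', neg_zero]
    have h1 : ∀ c, c ≠ l → c ≠ p → f (v.coord c) (v c) (v l) (v p) =
        f (v.coord b) (v b) (v l) (v p) := by
      intro c hcl hcp
      by_cases hcb : c = b
      · rw [hcb]
      have := h_prim (v.coord b - v.coord c) (v b + v c) (v l) (v p)
        (by simp only [LinearMap.sub_apply, map_add, hco1, hco hcb, hco (Ne.symm hcb)]; norm_num)
        (by simp only [LinearMap.sub_apply, hco hbl, hco hcl]; norm_num)
        (by simp only [LinearMap.sub_apply, hco hbp, hco hcp]; norm_num)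
      simp only [map_add, map_sub, LinearMap.sub_apply, LinearMap.add_apply,
        h_prim (v.coord b) (v c) (v l) (v p) (hco (Ne.symm hcb)) (hco hbl) (hco hbp),
        h_prim (v.coord c) (v b) (v l) (v p) (hco hcb) (hco hcl) (hco hcp)] at this
      linear_combination (norm := module) -this
    have h2 := h_trace (v l) (v p)
    rw [sum_const_off_pair hlp h1, h_self', h_swap, h_self', neg_zero, zero_add, zero_add] at h2
    refine eq_zero_of_smul_eq_zero' (fun e => ?_) h2
    have := congrArg Complex.re e
    simp at this
    linarith
  by_cases haj : a = j
  · rw [haj, key]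
  by_cases hai : a = i
  · rw [hai, h_rotate, h_rotate, key]
  by_cases hak : a = k
  · rw [hak, h_rotate, key]
  exact h_prim _ _ _ _ (hco haj) (hco hai) (hco hak)

end Vanishing

namespace TensModel

variable {d : ℕ} {W T : Type*} [AddCommGroup W] [Module ℂ W] [AddCommGroup T] [Module ℂ T]
  (m : TensModel W T) (v : Basis (Fin d) ℂ W)

/-- The vanishing criterion is applied to the projection onto the quotient by the sum of the four
families. -/
theorem sup_eq_top (hd : 3 ≤ d) :
    m.primitive ⊔ (m.polarSub v ⊔ (m.traceSub v ⊔ m.cycSub)) = ⊤ := by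
  set N := m.primitive ⊔ (m.polarSub v ⊔ (m.traceSub v ⊔ m.cycSub)) with hN
  suffices N.mkQ = 0 by rw [← N.ker_mkQ, this, LinearMap.ker_zero]
  have hz : ∀ {z}, z ∈ N → N.mkQ z = 0 := fun h => by simpa using h
  refine m.ext_basis v fun a j i k => ?_
  rw [LinearMap.zero_apply]
  let F : Dual ℂ W →ₗ[ℂ] W →ₗ[ℂ] W →ₗ[ℂ] W →ₗ[ℂ] (T ⧸ N) :=
    { toFun := fun α =>
        { toFun := fun w => (m.t α w).compr₂ N.mkQ
          map_add' := fun w w' => by ext x y; simp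
          map_smul' := fun c w => by ext x y; simp }
      map_add' := fun α β => by ext w x y; simp
      map_smul' := fun c α => by ext w x y; simp }
  have hF : ∀ α w x y, F α w x y = N.mkQ (m.t α w x y) := fun _ _ _ _ => rfl
  refine (hF _ _ _ _).symm.trans (multilinear_eq_zero v F hd (fun α w x y => ?_)
    (fun α w x hw hx => ?_) (fun α w x y => ?_) (fun x y => ?_) (fun w => ?_) a j i k)
  · rw [hF, hF, m.t_swap, map_neg]
  · exact hz (Submodule.mem_sup_left (Submodule.subset_span ⟨α, w, x, hw, hx, rfl⟩))
  · simp only [hF, ← map_add]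
    exact hz (Submodule.mem_sup_right (Submodule.mem_sup_right (Submodule.mem_sup_right
      (Submodule.subset_span ⟨α, w, x, y, rfl⟩))))
  · simp only [hF, ← map_sum]
    exact hz (Submodule.mem_sup_right (Submodule.mem_sup_right (Submodule.mem_sup_left
      (Submodule.subset_span ⟨x, y, (m.trace_apply v x y).symm⟩))))
  · simp only [hF, ← map_sum]
    exact hz (Submodule.mem_sup_right (Submodule.mem_sup_left
      (Submodule.subset_span ⟨w, (m.polar_apply v w w).symm⟩)))

theorem cycSub_le (hd : 3 ≤ d) : m.cycSub ≤ m.cycPrimitive ⊔ m.cycTraceSub v := by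
  set N := m.cycPrimitive ⊔ m.cycTraceSub v with hN
  have hz : ∀ {z}, z ∈ N → N.mkQ z = 0 := fun h => by simpa using h
  let F : Dual ℂ W →ₗ[ℂ] W →ₗ[ℂ] W →ₗ[ℂ] W →ₗ[ℂ] (T ⧸ N) :=
    { toFun := fun α =>
        { toFun := fun w => (m.cyc α w).compr₂ N.mkQ
          map_add' := fun w w' => by ext x y; simp
          map_smul' := fun c w => by ext x y; simp }
      map_add' := fun α β => by ext w x y; simp
      map_smul' := fun c α => by ext w x y; simp }
  have hF : ∀ α w x y, F α w x y = N.mkQ (m.cyc α w x y) := fun _ _ _ _ => rfl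
  have h0 := alternating_eq_zero v F hd (fun α w x y => by rw [hF, hF, m.cyc_swap, map_neg])
    (fun α w x y => by rw [hF, hF, m.cyc_rotate])
    (fun α w x y h1 h2 h3 => hz (Submodule.mem_sup_left
      (Submodule.subset_span ⟨α, w, x, y, h1, h2, h3, rfl⟩)))
    (fun x y => by
      simp only [hF, ← map_sum]
      exact hz (Submodule.mem_sup_right
        (Submodule.subset_span ⟨x, y, (m.cycTrace_apply v x y).symm⟩)))
  refine Submodule.span_le.2 ?_
  rintro _ ⟨α, w, x, y, rfl⟩
  have : F α w x y = 0 := by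
    rw [dual_eq_sum v α, ← v.sum_repr w, ← v.sum_repr x, ← v.sum_repr y]
    simp only [map_sum, map_smul, LinearMap.sum_apply, LinearMap.smul_apply, h0, smul_zero,
      Finset.sum_const_zero]
  rw [hF] at this
  simpa using this

end TensModel

/-! ### Transitivity of `GL(W)` on independent families -/

section Transitivity

variable {W : Type*} [AddCommGroup W] [Module ℂ W]

/-- The element of `GL(W)` given by a linear automorphism. -/
abbrev toGL (e : W ≃ₗ[ℂ] W) : GLW W := LinearMap.GeneralLinearGroup.ofLinearEquiv e

theorem stdRep_toGL (e : W ≃ₗ[ℂ] W) (w : W) : stdRep W (toGL e) w = e w := rfl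

theorem stdRep_toGL_inv (e : W ≃ₗ[ℂ] W) (w : W) : stdRep W (toGL e)⁻¹ w = e.symm w := rfl

theorem det_stdRep_ne_zero (g : GLW W) : LinearMap.det (stdRep W g) ≠ 0 := by
  have : LinearMap.det (stdRep W g) * LinearMap.det (stdRep W g⁻¹) = 1 := by
    rw [← map_mul, ← map_mul, mul_inv_cancel, map_one, map_one]
  exact left_ne_zero_of_mul_eq_one this

/-- `GL(W)` acts transitively on linearly independent families of a given length. -/
theorem exists_gl_of_linearIndependent {n : ℕ} {x y : Fin n → W} (hx : LinearIndependent ℂ x)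
    (hy : LinearIndependent ℂ y) : ∃ e : W ≃ₗ[ℂ] W, ∀ i, e (x i) = y i := by
  have : FiniteDimensional ℂ (Submodule.span ℂ (Set.range x)) :=
    FiniteDimensional.span_of_finite ℂ (Set.finite_range _)
  obtain ⟨e, he⟩ := Submodule.exists_linearEquiv_restrict_eq
    (hx.linearCombinationEquiv.symm ≪≫ₗ hy.linearCombinationEquiv)
  refine ⟨e, fun i => ?_⟩
  have h := he (hx.linearCombinationEquiv (Finsupp.single i 1))
  simpa using h.symm

/-- `GL(W)` acts transitively on pairs of a nonzero covector and a linearly independent family of a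
given length in its kernel. -/
theorem exists_gl_of_linearIndependent_of_dual {n : ℕ} {x y : Fin n → W}
    (hx : LinearIndependent ℂ x) (hy : LinearIndependent ℂ y) {α β : Dual ℂ W} (hα : α ≠ 0)
    (hβ : β ≠ 0) (hαx : ∀ i, α (x i) = 0) (hβy : ∀ i, β (y i) = 0) :
    ∃ g : GLW W, (∀ i, stdRep W g (x i) = y i) ∧ α ∘ₗ stdRep W g⁻¹ = β := by
  have aux : ∀ {γ : Dual ℂ W} {z : Fin n → W}, γ ≠ 0 → LinearIndependent ℂ z →
      (∀ i, γ (z i) = 0) → ∃ p, γ p = 1 ∧ LinearIndependent ℂ (Fin.cons p z : Fin (n + 1) → W) := by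
    intro γ z hγ hz hγz
    obtain ⟨p, hp⟩ : ∃ p, γ p = 1 := by
      obtain ⟨r, hr⟩ : ∃ r, γ r ≠ 0 := by
        by_contra! h
        exact hγ (LinearMap.ext h)
      exact ⟨(γ r)⁻¹ • r, by simp [hr]⟩
    refine ⟨p, hp, linearIndependent_finCons.2 ⟨hz, fun h => ?_⟩⟩
    have : Submodule.span ℂ (Set.range z) ≤ LinearMap.ker γ := by
      rw [Submodule.span_le]
      rintro _ ⟨i, rfl⟩
      exact hγz i
    have := this h
    rw [LinearMap.mem_ker, hp] at this
    exact one_ne_zero this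
  obtain ⟨p, hp, hpx⟩ := aux hα hx hαx
  obtain ⟨r, hr, hry⟩ := aux hβ hy hβy
  obtain ⟨e, he⟩ := exists_gl_of_linearIndependent hpx hry
  have hep : e p = r := he 0
  have hex : ∀ i, e (x i) = y i := fun i => by simpa using he i.succ
  -- The map `e` need not carry `α` to `β`. The defect `γ` vanishes at `p` and at the `x i`, so the
  -- transvection `id + γ ⊗ p` is invertible, fixes the family, and corrects the covector because `β
  -- (e p) = 1`.
  let γ : Dual ℂ W := α - β ∘ₗ e.toLinearMap
  have hγp : γ p = 0 := by simp [γ, hp, hep, hr]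
  let f : W ≃ₗ[ℂ] W := LinearEquiv.ofLinearMap (LinearMap.id + γ.smulRight p)
    (LinearMap.id - γ.smulRight p) (by ext z; simp [hγp]) (by ext z; simp [hγp])
  have hf : ∀ z, f z = z + γ z • p := fun z => rfl
  refine ⟨toGL (f ≪≫ₗ e), fun i => ?_, ?_⟩
  · rw [stdRep_toGL, LinearEquiv.trans_apply, hf,
      show γ (x i) = 0 by simp [γ, hαx, hex, hβy], zero_smul, add_zero, hex]
  · have : ∀ z, β (stdRep W (toGL (f ≪≫ₗ e)) z) = α z := fun z => by
      rw [stdRep_toGL, LinearEquiv.trans_apply, hf, map_add, map_add, map_smul, map_smul, hep, hr]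
      simp [γ]
    ext z
    rw [LinearMap.comp_apply, ← this, stdRep_apply_inv]

end Transitivity

/-! ### Cyclic subrepresentations and eigenvector relations -/

section Orbit

variable {G V : Type*} [Group G] [AddCommGroup V] [Module ℂ V] (ρ : Representation ℂ G V)

/-- The subrepresentation generated by a vector. -/
def orbit (u : V) : Subrepresentation ρ where
  toSubmodule := Submodule.span ℂ (Set.range fun g => ρ g u)
  apply_mem_toSubmodule g z hz := by
    induction hz using Submodule.span_induction with
    | mem z hz =>
      obtain ⟨h, rfl⟩ := hz
      refine Submodule.subset_span ⟨g * h, ?_⟩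
      simp only [map_mul, Module.End.mul_apply]
    | zero => rw [map_zero]; exact Submodule.zero_mem _
    | add x y _ _ hx hy => rw [map_add]; exact Submodule.add_mem _ hx hy
    | smul c x _ hx => rw [map_smul]; exact Submodule.smul_mem _ _ hx

theorem rep_mem_orbit (u : V) (g : G) : ρ g u ∈ (orbit ρ u).toSubmodule :=
  Submodule.subset_span ⟨g, rfl⟩

theorem mem_orbit_self (u : V) : u ∈ (orbit ρ u).toSubmodule := by
  simpa using rep_mem_orbit ρ u 1

theorem orbit_le {N : Submodule ℂ V} {u : V} (h : ∀ g, ρ g u ∈ N) :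
    (orbit ρ u).toSubmodule ≤ N := by
  refine Submodule.span_le.2 ?_
  rintro _ ⟨g, rfl⟩
  exact h g

theorem mem_orbit_of_smul {u z : V} {g : G} {c : ℂ} (hc : c ≠ 0) (h : ρ g u = c • z) :
    z ∈ (orbit ρ u).toSubmodule := by
  have := Submodule.smul_mem _ c⁻¹ (rep_mem_orbit ρ u g)
  rwa [h, smul_smul, inv_mul_cancel₀ hc, one_smul] at this

/-- `z` is an eigenvector of every `g` that has `u` as an eigenvector, for the same eigenvalue. -/
def StabLike (u z : V) : Prop := ∀ (g : G) (c : ℂ), ρ g u = c • u → ρ g z = c • z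

theorem StabLike.refl (u : V) : StabLike ρ u u := fun _ _ h => h

variable {ρ}

theorem StabLike.sub_smul {u z z' : V} (h : StabLike ρ u z) (h' : StabLike ρ u z') (c : ℂ) :
    StabLike ρ u (z - c • z') := fun g r hg => by
  rw [map_sub, map_smul, h g r hg, h' g r hg, smul_sub, smul_comm]

end Orbit

/-- A trilinear map as a multilinear map in three variables. -/
def triMulti {W M : Type*} [AddCommGroup W] [Module ℂ W] [AddCommGroup M] [Module ℂ M]
    (f : W →ₗ[ℂ] W →ₗ[ℂ] W →ₗ[ℂ] M) : MultilinearMap ℂ (fun _ : Fin 3 => W) M where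
  toFun z := f (z 0) (z 1) (z 2)
  map_update_add' {inst} z i x y := by
    obtain rfl : inst = instDecidableEqFin _ := Subsingleton.elim _ _
    fin_cases i <;> simp
  map_update_smul' {inst} z i c x := by
    obtain rfl : inst = instDecidableEqFin _ := Subsingleton.elim _ _
    fin_cases i <;> simp

/-- A bilinear map as a multilinear map in two variables. -/
def biMulti {W M : Type*} [AddCommGroup W] [Module ℂ W] [AddCommGroup M] [Module ℂ M]
    (f : W →ₗ[ℂ] W →ₗ[ℂ] M) : MultilinearMap ℂ (fun _ : Fin 2 => W) M where
  toFun z := f (z 0) (z 1)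
  map_update_add' {inst} z i x y := by
    obtain rfl : inst = instDecidableEqFin _ := Subsingleton.elim _ _
    fin_cases i <;> simp
  map_update_smul' {inst} z i c x := by
    obtain rfl : inst = instDecidableEqFin _ := Subsingleton.elim _ _
    fin_cases i <;> simp

/-! ### The invariant submodules as cyclic subrepresentations -/

namespace TensModel

variable {d : ℕ} {W T : Type*} [AddCommGroup W] [Module ℂ W] [AddCommGroup T] [Module ℂ T]
  (m : TensModel W T) (v : Basis (Fin d) ℂ W)

theorem cyc_eq_zero_of_not_linearIndependent (α : Dual ℂ W) {w x y : W}
    (h : ¬LinearIndependent ℂ ![w, x, y]) : m.cyc α w x y = 0 := by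
  let f : W [⋀^Fin 3]→ₗ[ℂ] T :=
    { triMulti (m.cyc α) with
      map_eq_zero_of_eq' := fun z i j hz hij => by
        change m.cyc α (z 0) (z 1) (z 2) = 0
        fin_cases i <;> fin_cases j <;> simp at hij hz
        · rw [hz, m.cyc_rotate, m.cyc_self]
        · rw [hz, m.cyc_swap, m.cyc_rotate, m.cyc_self, neg_zero]
        · rw [← hz, m.cyc_rotate, m.cyc_self]
        · rw [hz, m.cyc_self]
        · rw [← hz, m.cyc_swap, m.cyc_rotate, m.cyc_self, neg_zero]
        · rw [← hz, m.cyc_self] }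
  exact f.map_linearDependent ![w, x, y] h

theorem linearIndependent_pair_of_ne_zero {M : Type*} [AddCommGroup M] [Module ℂ M]
    (f : W →ₗ[ℂ] W →ₗ[ℂ] M) (hf : ∀ w, f w w = 0) {w x : W} (h : f w x ≠ 0) :
    LinearIndependent ℂ ![w, x] := by
  have hw : w ≠ 0 := by rintro rfl; simp at h
  rw [LinearIndependent.pair_iff' hw]
  rintro c rfl
  exact h (by rw [map_smul, hf, smul_zero])

theorem linearIndependent_basis_comp {n : ℕ} (f : Fin n → Fin d) (hf : Function.Injective f) :
    LinearIndependent ℂ fun i => v (f i) := v.linearIndependent.comp f hf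

/-- If `t(α; w, w, x)` is nonzero, then `α ≠ 0` and alternation makes `w, x` independent; all such
data in the kernel of the covector form one `GL(W)`-orbit. -/
theorem primitive_eq_orbit {a j k : Fin d} (haj : a ≠ j) (hak : a ≠ k) (hjk : j ≠ k) :
    m.primitive = (orbit m.rep (m.t (v.coord a) (v j) (v j) (v k))).toSubmodule := by
  apply le_antisymm
  · refine Submodule.span_le.2 ?_
    rintro _ ⟨α, w, x, hw, hx, rfl⟩
    by_cases h0 : m.t α w w x = 0
    · rw [h0]; exact Submodule.zero_mem _
    have hα : α ≠ 0 := by rintro rfl; simp at h0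
    have hli : LinearIndependent ℂ ![w, x] := by
      have hw : w ≠ 0 := by rintro rfl; simp at h0
      rw [LinearIndependent.pair_iff' hw]
      rintro c rfl
      exact h0 (by rw [map_smul, m.t_self, smul_zero])
    have hli' : LinearIndependent ℂ ![v j, v k] := by
      have := linearIndependent_basis_comp v ![j, k] (by
        intro p r h; fin_cases p <;> fin_cases r <;> simp_all)
      convert this using 1
      ext i; fin_cases i <;> rfl
    obtain ⟨g, hg, hgα⟩ := exists_gl_of_linearIndependent_of_dual hli' hli
      (α := v.coord a) (β := α) (fun h => by simpa using LinearMap.congr_fun h (v a)) hα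
      (fun i => by fin_cases i <;> simp [haj.symm, hak.symm])
      (fun i => by fin_cases i <;> simp [hw, hx])
    have h1 : stdRep W g (v j) = w := hg 0
    have h2 : stdRep W g (v k) = x := hg 1
    exact mem_orbit_of_smul _ (det_stdRep_ne_zero g) (by rw [m.rep_t, h1, h2, hgα])
  · refine orbit_le _ fun g => ?_
    rw [m.rep_t]
    refine Submodule.smul_mem _ _ (Submodule.subset_span ⟨_, _, _, ?_, ?_, rfl⟩)
    · simp [haj.symm]
    · simp [hak.symm]

theorem cycPrimitive_eq_orbit {a j i k : Fin d} (haj : a ≠ j) (hai : a ≠ i) (hak : a ≠ k)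
    (hji : j ≠ i) (hjk : j ≠ k) (hik : i ≠ k) :
    m.cycPrimitive = (orbit m.rep (m.cyc (v.coord a) (v j) (v i) (v k))).toSubmodule := by
  apply le_antisymm
  · refine Submodule.span_le.2 ?_
    rintro _ ⟨α, w, x, y, hw, hx, hy, rfl⟩
    by_cases h0 : m.cyc α w x y = 0
    · rw [h0]; exact Submodule.zero_mem _
    have hα : α ≠ 0 := by rintro rfl; simp at h0
    have hli : LinearIndependent ℂ ![w, x, y] := by
      by_contra h
      exact h0 (m.cyc_eq_zero_of_not_linearIndependent α h)
    have hli' : LinearIndependent ℂ ![v j, v i, v k] := by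
      have := linearIndependent_basis_comp v ![j, i, k] (by
        intro p r h; fin_cases p <;> fin_cases r <;> simp_all)
      convert this using 1
      ext i; fin_cases i <;> rfl
    obtain ⟨g, hg, hgα⟩ := exists_gl_of_linearIndependent_of_dual hli' hli
      (α := v.coord a) (β := α) (fun h => by simpa using LinearMap.congr_fun h (v a)) hα
      (fun i => by fin_cases i <;> simp [haj.symm, hai.symm, hak.symm])
      (fun i => by fin_cases i <;> simp [hw, hx, hy])
    have h1 : stdRep W g (v j) = w := hg 0
    have h2 : stdRep W g (v i) = x := hg 1
    have h3 : stdRep W g (v k) = y := hg 2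
    exact mem_orbit_of_smul _ (det_stdRep_ne_zero g) (by rw [m.rep_cyc, h1, h2, h3, hgα])
  · refine orbit_le _ fun g => ?_
    rw [m.rep_cyc]
    refine Submodule.smul_mem _ _ (Submodule.subset_span ⟨_, _, _, _, ?_, ?_, ?_, rfl⟩)
    · simp [haj.symm]
    · simp [hai.symm]
    · simp [hak.symm]

/-- Three independent vectors span `W`, so a covector killing them is zero. This is why the type
`(2, 2, 2, 1, …, 1, 0)` enters only for `4 ≤ d`. -/
theorem cycPrimitive_eq_bot (hd : d = 3) (v : Basis (Fin d) ℂ W) : m.cycPrimitive = ⊥ := by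
  refine (Submodule.span_eq_bot).2 ?_
  rintro _ ⟨α, w, x, y, hw, hx, hy, rfl⟩
  by_contra h0
  have hli : LinearIndependent ℂ ![w, x, y] := by
    by_contra h
    exact h0 (m.cyc_eq_zero_of_not_linearIndependent α h)
  have hspan := hli.span_eq_top_of_card_eq_finrank
    (by rw [Module.finrank_eq_card_basis v, hd])
  have : α = 0 := by
    refine LinearMap.ext_on hspan ?_
    rintro _ ⟨i, rfl⟩
    fin_cases i <;> simp [hw, hx, hy]
  exact h0 (by rw [this]; simp)

theorem polarSub_eq_orbit (j : Fin d) :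
    m.polarSub v = (orbit m.rep (m.polar v (v j) (v j))).toSubmodule := by
  apply le_antisymm
  · refine Submodule.span_le.2 ?_
    rintro _ ⟨w, rfl⟩
    by_cases h0 : w = 0
    · rw [h0]; simp
    obtain ⟨e, he⟩ := exists_gl_of_linearIndependent (x := ![v j]) (y := ![w])
      (linearIndependent_unique_iff.2 (by simpa using v.ne_zero j))
      (linearIndependent_unique_iff.2 (by simpa using h0))
    have h1 : stdRep W (toGL e) (v j) = w := he 0
    exact mem_orbit_of_smul _ (det_stdRep_ne_zero (toGL e)) (by rw [m.rep_polar, h1])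
  · refine orbit_le _ fun g => ?_
    rw [m.rep_polar]
    exact Submodule.smul_mem _ _ (Submodule.subset_span ⟨_, rfl⟩)

/-- The span of the values of an alternating bilinear map that is equivariant up to the determinant
is generated by one of them. -/
theorem span_eq_orbit (f : W →ₗ[ℂ] W →ₗ[ℂ] T) (hf : ∀ w, f w w = 0)
    (hrep : ∀ g x y, m.rep g (f x y) =
      LinearMap.det (stdRep W g) • f (stdRep W g x) (stdRep W g y))
    {i k : Fin d} (hik : i ≠ k) :
    Submodule.span ℂ {z | ∃ x y, z = f x y} = (orbit m.rep (f (v i) (v k))).toSubmodule := by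
  apply le_antisymm
  · refine Submodule.span_le.2 ?_
    rintro _ ⟨w, x, rfl⟩
    by_cases h0 : f w x = 0
    · rw [h0]; exact Submodule.zero_mem _
    have hli' : LinearIndependent ℂ ![v i, v k] := by
      have := linearIndependent_basis_comp v ![i, k] (by
        intro p r h; fin_cases p <;> fin_cases r <;> simp_all)
      convert this using 1
      ext i; fin_cases i <;> rfl
    obtain ⟨e, he⟩ := exists_gl_of_linearIndependent hli'
      (linearIndependent_pair_of_ne_zero f hf h0)
    have h1 : stdRep W (toGL e) (v i) = w := he 0
    have h2 : stdRep W (toGL e) (v k) = x := he 1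
    exact mem_orbit_of_smul _ (det_stdRep_ne_zero (toGL e)) (by rw [hrep, h1, h2])
  · refine orbit_le _ fun g => ?_
    rw [hrep]
    exact Submodule.smul_mem _ _ (Submodule.subset_span ⟨_, _, rfl⟩)

end TensModel

/-! ### Dilations, permutations and transvections -/

section Elements

variable {d : ℕ} {W : Type*} [AddCommGroup W] [Module ℂ W] (v : Basis (Fin d) ℂ W)

/-- The weight of `v_i` under `dilation v p`. -/
def dilWeight (p i : Fin d) : ℤ := if i = p then 1 else 0

/-- The automorphism of `W` that doubles `v_p` and fixes the other basis vectors. -/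
def dilation (p : Fin d) : GLW W :=
  toGL (v.equiv (v.unitsSMul fun i => if i = p then Units.mk0 2 two_ne_zero else 1)
    (Equiv.refl _))

theorem dilation_apply (p i : Fin d) :
    stdRep W (dilation v p) (v i) = (2 : ℂ) ^ dilWeight p i • v i := by
  rw [dilation, stdRep_toGL, Basis.equiv_apply, Equiv.refl_apply, Basis.unitsSMul_apply, dilWeight]
  split_ifs <;> simp [Units.smul_def]

theorem dilation_inv_apply (p i : Fin d) :
    stdRep W (dilation v p)⁻¹ (v i) = (2 : ℂ) ^ (-dilWeight p i) • v i := by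
  have h := stdRep_inv_apply (dilation v p) (v i)
  rw [dilation_apply, map_smul] at h
  rw [← one_smul ℂ (stdRep W (dilation v p)⁻¹ (v i)),
    ← zpow_neg_mul_zpow_self (dilWeight p i) (two_ne_zero (α := ℂ)), mul_smul, h]

theorem coord_comp_dilation (p j : Fin d) :
    v.coord j ∘ₗ stdRep W (dilation v p) = (2 : ℂ) ^ dilWeight p j • v.coord j := by
  refine v.ext fun i => ?_
  rw [LinearMap.comp_apply, dilation_apply, map_smul, LinearMap.smul_apply, coord_basis]
  split_ifs with h
  · rw [h]
  · simp

/-- The automorphism of `W` that permutes the basis vectors by `σ`. -/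
def permutation (σ : Equiv.Perm (Fin d)) : GLW W := toGL (v.equiv v σ)

theorem permutation_apply (σ : Equiv.Perm (Fin d)) (i : Fin d) :
    stdRep W (permutation v σ) (v i) = v (σ i) := by
  rw [permutation, stdRep_toGL, Basis.equiv_apply]

theorem permutation_inv_apply (σ : Equiv.Perm (Fin d)) (i : Fin d) :
    stdRep W (permutation v σ)⁻¹ (v i) = v (σ.symm i) := by
  rw [permutation, stdRep_toGL_inv, Basis.equiv_symm, Basis.equiv_apply]

theorem coord_comp_permutation (σ : Equiv.Perm (Fin d)) (j : Fin d) :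
    v.coord j ∘ₗ stdRep W (permutation v σ) = v.coord (σ.symm j) := by
  refine v.ext fun i => ?_
  rw [LinearMap.comp_apply, permutation_apply, coord_basis, coord_basis]
  simp only [Equiv.symm_apply_eq]

/-- The automorphism of `W` that maps `v_p` to `v_p + v_r` and fixes the other basis vectors. -/
def addBasis {p r : Fin d} (h : r ≠ p) : GLW W :=
  toGL (LinearEquiv.ofLinearMap (LinearMap.id + (v.coord p).smulRight (v r))
    (LinearMap.id - (v.coord p).smulRight (v r))
    (by ext z; simp [h]) (by ext z; simp [h]))

theorem addBasis_apply {p r : Fin d} (h : r ≠ p) (z : W) :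
    stdRep W (addBasis v h) z = z + v.coord p z • v r := rfl

theorem addBasis_inv_apply {p r : Fin d} (h : r ≠ p) (z : W) :
    stdRep W (addBasis v h)⁻¹ z = z - v.coord p z • v r := rfl

end Elements

/-! ### Weights, and the vectors sharing the eigenvector relations of a generator -/

namespace TensModel

variable {d : ℕ} {W T : Type*} [AddCommGroup W] [Module ℂ W] [AddCommGroup T] [Module ℂ T]
  (m : TensModel W T) (v : Basis (Fin d) ℂ W)

/-- The weight of `t(v_a^*; v_j, v_i, v_k)` under `dilation v p`. -/
def weight (p a j i k : Fin d) : ℤ :=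
  dilWeight p j + dilWeight p i + dilWeight p k - dilWeight p a

theorem mem_of_weight_pos {p a j i k : Fin d} (h : 0 < weight p a j i k) :
    p = j ∨ p = i ∨ p = k := by
  by_contra! hh
  simp only [weight, dilWeight, if_neg hh.1.symm, if_neg hh.2.1.symm, if_neg hh.2.2.symm] at h
  split_ifs at h <;> omega

theorem eq_of_weight_neg {p a j i k : Fin d} (h : weight p a j i k < 0) : p = a := by
  by_contra hh
  simp only [weight, dilWeight, if_neg (Ne.symm hh)] at h
  split_ifs at h <;> omega

/-- A negative weight locates the covector index, and the positive weights locate the three vectors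
up to order. -/
theorem indices_of_distinct {a j i k a' j' i' k' : Fin d} (haj : a ≠ j)
    (hai : a ≠ i) (hak : a ≠ k) (hji : j ≠ i) (hjk : j ≠ k) (hik : i ≠ k)
    (h : ∀ p, weight p a' j' i' k' = weight p a j i k) :
    a' = a ∧ (j' = j ∧ i' = i ∧ k' = k ∨ j' = j ∧ i' = k ∧ k' = i ∨ j' = i ∧ i' = j ∧ k' = k ∨
    j' = i ∧ i' = k ∧ k' = j ∨ j' = k ∧ i' = i ∧ k' = j ∨ j' = k ∧ i' = j ∧ k' = i) := by
  have h1 : a = a' := eq_of_weight_neg (j := j') (i := i') (k := k') (by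
    rw [h]; simp [weight, dilWeight, haj.symm, hai.symm, hak.symm])
  have h2 := mem_of_weight_pos (p := j) (a := a') (j := j') (i := i') (k := k') (by
    rw [h]; simp [weight, dilWeight, haj, hji.symm, hjk.symm])
  have h3 := mem_of_weight_pos (p := i) (a := a') (j := j') (i := i') (k := k') (by
    rw [h]; simp [weight, dilWeight, hai, hji, hik.symm])
  have h4 := mem_of_weight_pos (p := k) (a := a') (j := j') (i := i') (k := k') (by
    rw [h]; simp [weight, dilWeight, hak, hjk, hik])
  clear h
  grind

/-- No weight is negative here, so the covector index must cancel against one of the vectors and the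
other two are `v_p` and `v_r`. -/
theorem indices_of_pair {p r a j i k : Fin d} (hpr : p ≠ r) (hik : i ≠ k)
    (h : ∀ q, weight q a j i k = dilWeight q p + dilWeight q r) :
    (a = p ∨ a = r) ∧ (j = a ∧ (i = p ∧ k = r ∨ i = r ∧ k = p)) ∨
    (a ≠ p ∧ a ≠ r ∧ (j = p ∧ (i = r ∧ k = a ∨ i = a ∧ k = r) ∨
      j = r ∧ (i = p ∧ k = a ∨ i = a ∧ k = p) ∨ j = a ∧ (i = p ∧ k = r ∨ i = r ∧ k = p))) := by
  have h2 := mem_of_weight_pos (p := p) (a := a) (j := j) (i := i) (k := k) (by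
    rw [h]; simp [dilWeight, hpr.symm])
  have h3 := mem_of_weight_pos (p := r) (a := a) (j := j) (i := i) (k := k) (by
    rw [h]; simp [dilWeight, hpr])
  have h4 : a = j ∨ a = i ∨ a = k := by
    by_contra! hh
    have := h a
    simp only [weight, dilWeight, if_neg hh.1.symm, if_neg hh.2.1.symm, if_neg hh.2.2.symm] at this
    split_ifs at this <;> omega
  have h5 : a = p → j = p ∧ (i = p ∨ k = p) := by
    rintro rfl
    have := h a
    simp only [weight, dilWeight, if_neg hpr.symm, if_true] at this
    split_ifs at this <;> omega
  have h6 : a = r → j = r ∧ (i = r ∨ k = r) := by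
    rintro rfl
    have := h a
    simp only [weight, dilWeight, if_neg hpr, if_true] at this
    split_ifs at this <;> omega
  clear h
  by_cases hap : a = p
  · grind
  by_cases har : a = r
  · grind
  right
  refine ⟨hap, har, ?_⟩
  grind
theorem form_smul (c c₁ c₂ c₃ : ℂ) (ω : W) (β γ δ : Dual ℂ W) :
    m.form (c • ω) (c₁ • β) (c₂ • γ) (c₃ • δ) = (c * (c₁ * (c₂ * c₃))) • m.form ω β γ δ := by
  refine m.ext fun α w x y => ?_
  rw [LinearMap.smul_apply, m.form_t, m.form_t]
  simp only [map_smul, LinearMap.smul_apply, smul_eq_mul]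
  ring

theorem coord_rep_dilation (p a j i k : Fin d) (z : T) :
    m.coord v a j i k (m.rep (dilation v p) z) = LinearMap.det (stdRep W (dilation v p)) *
      (2 : ℂ) ^ weight p a j i k * m.coord v a j i k z := by
  rw [coord, m.form_rep, dilation_inv_apply, coord_comp_dilation, coord_comp_dilation,
    coord_comp_dilation, form_smul, LinearMap.smul_apply, smul_eq_mul, ← zpow_add₀ two_ne_zero,
    ← zpow_add₀ two_ne_zero, ← zpow_add₀ two_ne_zero, mul_assoc, weight]
  ring_nf

theorem coord_rep_permutation (σ : Equiv.Perm (Fin d)) (a j i k : Fin d) (z : T) :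
    m.coord v a j i k (m.rep (permutation v σ) z) = LinearMap.det (stdRep W (permutation v σ)) *
      m.coord v (σ.symm a) (σ.symm j) (σ.symm i) (σ.symm k) z := by
  rw [coord, m.form_rep, permutation_inv_apply, coord_comp_permutation, coord_comp_permutation,
    coord_comp_permutation, coord]

variable {v m}

/-- The coordinates of an eigenvector of a dilation are concentrated in one weight. -/
theorem weight_eq_of_coord_ne_zero {p a j i k : Fin d} {z : T} {e : ℤ}
    (h : m.rep (dilation v p) z =
      (LinearMap.det (stdRep W (dilation v p)) * (2 : ℂ) ^ e) • z)
    (hz : m.coord v a j i k z ≠ 0) : weight p a j i k = e := by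
  have h' := congrArg (m.coord v a j i k) h
  rw [coord_rep_dilation, map_smul, smul_eq_mul] at h'
  have h'' := mul_left_cancel₀ (det_stdRep_ne_zero _) (mul_right_cancel₀ hz h')
  -- The comparison of exponents is made over `ℝ`, where `n ↦ 2 ^ n` is known to be injective.
  have h3 : ((2 : ℝ) ^ weight p a j i k) = (2 : ℝ) ^ e :=
    Complex.ofReal_injective (by push_cast; exact h'')
  exact zpow_right_injective₀ two_pos (by norm_num) h3

variable (v m)

theorem rep_dilation_t (p a j i k : Fin d) :
    m.rep (dilation v p) (m.t (v.coord a) (v j) (v i) (v k)) =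
      (LinearMap.det (stdRep W (dilation v p)) * (2 : ℂ) ^ weight p a j i k) •
        m.t (v.coord a) (v j) (v i) (v k) := by
  have hc : v.coord a ∘ₗ stdRep W (dilation v p)⁻¹ = (2 : ℂ) ^ (-dilWeight p a) • v.coord a := by
    refine v.ext fun i => ?_
    rw [LinearMap.comp_apply, dilation_inv_apply, map_smul, LinearMap.smul_apply, coord_basis]
    split_ifs with h
    · rw [h]
    · simp
  rw [m.rep_t, hc, dilation_apply, dilation_apply, dilation_apply]
  simp only [map_smul, LinearMap.smul_apply, smul_smul, weight, sub_eq_add_neg,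
    zpow_add₀ (two_ne_zero (α := ℂ))]
  congr 1
  ring

theorem rep_dilation_cyc (p a j i k : Fin d) :
    m.rep (dilation v p) (m.cyc (v.coord a) (v j) (v i) (v k)) =
      (LinearMap.det (stdRep W (dilation v p)) * (2 : ℂ) ^ weight p a j i k) •
        m.cyc (v.coord a) (v j) (v i) (v k) := by
  rw [m.cyc_apply, map_add, map_add, rep_dilation_t, rep_dilation_t, rep_dilation_t, smul_add,
    smul_add, show weight p a i k j = weight p a j i k by simp only [weight]; ring,
    show weight p a k j i = weight p a j i k by simp only [weight]; ring]

theorem rep_dilation_bilin (f : W →ₗ[ℂ] W →ₗ[ℂ] T)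
    (hrep : ∀ g x y, m.rep g (f x y) =
      LinearMap.det (stdRep W g) • f (stdRep W g x) (stdRep W g y)) (p i k : Fin d) :
    m.rep (dilation v p) (f (v i) (v k)) = (LinearMap.det (stdRep W (dilation v p)) *
      (2 : ℂ) ^ (dilWeight p i + dilWeight p k)) • f (v i) (v k) := by
  rw [hrep, dilation_apply, dilation_apply]
  simp only [map_smul, LinearMap.smul_apply, smul_smul, zpow_add₀ (two_ne_zero (α := ℂ))]
  congr 1
  ring

/-- Dilations alone suffice: the weight forces the vectors to be `v_j, v_j, v_k`, and the
alternating pair cannot be `v_j, v_j`. -/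
theorem primitive_eigenvector {a j k : Fin d} (haj : a ≠ j) (hak : a ≠ k) (hjk : j ≠ k) {z : T}
    (hz : StabLike m.rep (m.t (v.coord a) (v j) (v j) (v k)) z) :
    z = m.coord v a j j k z • m.t (v.coord a) (v j) (v j) (v k) := by
  rw [← sub_eq_zero]
  set z' := z - m.coord v a j j k z • m.t (v.coord a) (v j) (v j) (v k) with hz'
  have hs := hz.sub_smul (StabLike.refl _ _) (m.coord v a j j k z)
  rw [← hz'] at hs
  have h0 : m.coord v a j j k z' = 0 := by
    simp [hz', coord_t, hjk, hjk.symm]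
  have hw := fun p => hs (dilation v p) _ (m.rep_dilation_t v p a j j k)
  refine m.eq_zero_of_coord v fun a' j' i' k' => ?_
  by_contra hne
  have key := fun p => weight_eq_of_coord_ne_zero (hw p) hne
  have hik : i' ≠ k' := by rintro rfl; exact hne (m.coord_self v _ _ _ _)
  have e1 := key a
  have e2 := key j
  have e3 := key k
  simp only [weight, dilWeight] at e1 e2 e3
  have h0' : m.coord v a j k j z' = 0 := by rw [coord_swap, h0, neg_zero]
  have : a' = a := by grind
  have : j' = j := by grind
  have : i' = j ∧ k' = k ∨ i' = k ∧ k' = j := by grind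
  grind

theorem rep_permutation_bilin (f : W →ₗ[ℂ] W →ₗ[ℂ] T)
    (hrep : ∀ g x y, m.rep g (f x y) =
      LinearMap.det (stdRep W g) • f (stdRep W g x) (stdRep W g y))
    (σ : Equiv.Perm (Fin d)) (i k : Fin d) :
    m.rep (permutation v σ) (f (v i) (v k)) =
      LinearMap.det (stdRep W (permutation v σ)) • f (v (σ i)) (v (σ k)) := by
  rw [hrep, permutation_apply, permutation_apply]

theorem rep_permutation_cyc (σ : Equiv.Perm (Fin d)) (a j i k : Fin d) :
    m.rep (permutation v σ) (m.cyc (v.coord a) (v j) (v i) (v k)) =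
      LinearMap.det (stdRep W (permutation v σ)) •
        m.cyc (v.coord (σ a)) (v (σ j)) (v (σ i)) (v (σ k)) := by
  have hc : v.coord a ∘ₗ stdRep W (permutation v σ)⁻¹ = v.coord (σ a) := by
    refine v.ext fun i => ?_
    rw [LinearMap.comp_apply, permutation_inv_apply, coord_basis, coord_basis]
    simp only [Equiv.eq_symm_apply]
  rw [m.rep_cyc, hc, permutation_apply, permutation_apply, permutation_apply]

variable {v m}

/-- The symmetry of the coordinates of an eigenvector of a permutation. -/
theorem coord_eq_of_permutation {σ : Equiv.Perm (Fin d)} {z : T} {c : ℂ}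
    (h : m.rep (permutation v σ) z =
      (LinearMap.det (stdRep W (permutation v σ)) * c) • z) (a j i k : Fin d) :
    m.coord v a j i k z = c * m.coord v (σ a) (σ j) (σ i) (σ k) z := by
  have h' := congrArg (m.coord v (σ a) (σ j) (σ i) (σ k)) h
  rw [coord_rep_permutation, map_smul, smul_eq_mul, mul_assoc] at h'
  simpa using mul_left_cancel₀ (det_stdRep_ne_zero _) h'

variable (v m)

theorem coord_polar (a j i k p r : Fin d) : m.coord v a j i k (m.polar v (v p) (v r)) =
    (if j = p then 1 else 0) * ((if i = r then 1 else 0) * (if k = a then 1 else 0) -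
      (if i = a then 1 else 0) * (if k = r then 1 else 0)) := by
  rw [polar_apply, map_sum]
  simp only [coord_t, coord_basis]
  rw [Finset.sum_eq_single a (fun b _ hb => by simp [hb]) (by simp)]
  simp

/-- The weight leaves the coordinates with covector and one vector of equal index `a ≠ j`.
Permutations fixing `j` make them equal for all `a`, so one of them determines `z`. -/
theorem polar_eigenvector {b j : Fin d} (hbj : b ≠ j) {z : T}
    (hz : StabLike m.rep (m.polar v (v j) (v j)) z) :
    z = m.coord v b j j b z • m.polar v (v j) (v j) := by
  rw [← sub_eq_zero]
  set z' := z - m.coord v b j j b z • m.polar v (v j) (v j) with hz'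
  have hs := hz.sub_smul (StabLike.refl _ _) (m.coord v b j j b z)
  rw [← hz'] at hs
  have h0 : m.coord v b j j b z' = 0 := by
    simp [hz', coord_polar, hbj, hbj.symm]
  have hw := fun p => hs (dilation v p) _ (m.rep_dilation_bilin v _ (m.rep_polar v) p j j)
  have h1 : ∀ a, a ≠ j → m.coord v a j j a z' = 0 := fun a ha => by
    have h2 := hs (permutation v (Equiv.swap a b))
      (LinearMap.det (stdRep W (permutation v (Equiv.swap a b))) * 1) (by
        rw [m.rep_permutation_bilin v _ (m.rep_polar v), mul_one,
          Equiv.swap_apply_of_ne_of_ne ha.symm hbj.symm])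
    rw [coord_eq_of_permutation h2, Equiv.swap_apply_of_ne_of_ne ha.symm hbj.symm,
      Equiv.swap_apply_left, h0, mul_zero]
  refine m.eq_zero_of_coord v fun a' j' i' k' => ?_
  by_contra hne
  have key := fun p => weight_eq_of_coord_ne_zero (hw p) hne
  have hik : i' ≠ k' := by rintro rfl; exact hne (m.coord_self v _ _ _ _)
  have e1 := key a'
  have e2 := key j
  have e3 := key j'
  have e4 := key i'
  have e5 := key k'
  simp only [weight, dilWeight] at e1 e2 e3 e4 e5
  have h0' : ∀ a, a ≠ j → m.coord v a j a j z' = 0 := fun a ha => by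
    rw [coord_swap, h1 a ha, neg_zero]
  have : a' ≠ j := by grind
  have : j' = j := by grind
  have : i' = j ∧ k' = a' ∨ i' = a' ∧ k' = j := by grind
  grind

/-- The weight leaves the six orderings of the three vectors; transpositions act on the generator by
`-1`, apart from the determinant, so one ordering determines the rest. -/
theorem cyc_eigenvector {a j i k : Fin d} (haj : a ≠ j) (hai : a ≠ i) (hak : a ≠ k)
    (hji : j ≠ i) (hjk : j ≠ k) (hik : i ≠ k) {z : T}
    (hz : StabLike m.rep (m.cyc (v.coord a) (v j) (v i) (v k)) z) :
    z = m.coord v a j i k z • m.cyc (v.coord a) (v j) (v i) (v k) := by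
  rw [← sub_eq_zero]
  set z' := z - m.coord v a j i k z • m.cyc (v.coord a) (v j) (v i) (v k) with hz'
  have hs := hz.sub_smul (StabLike.refl _ _) (m.coord v a j i k z)
  rw [← hz'] at hs
  have h0 : m.coord v a j i k z' = 0 := by
    simp [hz', cyc_apply, coord_t, hji, hji.symm, hik, hik.symm, hjk, hjk.symm]
  have hw := fun p => hs (dilation v p) _ (m.rep_dilation_cyc v p a j i k)
  have h1 := hs (permutation v (Equiv.swap j i))
      (LinearMap.det (stdRep W (permutation v (Equiv.swap j i))) * (-1)) (by
        rw [m.rep_permutation_cyc v, Equiv.swap_apply_left, Equiv.swap_apply_right,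
          Equiv.swap_apply_of_ne_of_ne hjk.symm hik.symm, Equiv.swap_apply_of_ne_of_ne haj hai,
          ← m.cyc_rotate, m.cyc_swap, mul_neg, mul_one, smul_neg, neg_smul])
  have h2 := hs (permutation v (Equiv.swap i k))
      (LinearMap.det (stdRep W (permutation v (Equiv.swap i k))) * (-1)) (by
        rw [m.rep_permutation_cyc v, Equiv.swap_apply_left, Equiv.swap_apply_right,
          Equiv.swap_apply_of_ne_of_ne hji hjk, Equiv.swap_apply_of_ne_of_ne hai hak,
          m.cyc_swap, mul_neg, mul_one, smul_neg, neg_smul])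
  have h3 := coord_eq_of_permutation h1
  have h4 := coord_eq_of_permutation h2
  refine m.eq_zero_of_coord v fun a' j' i' k' => ?_
  by_contra hne
  have key := indices_of_distinct haj hai hak hji hjk hik
    fun p => weight_eq_of_coord_ne_zero (hw p) hne
  have c1 : m.coord v a j k i z' = 0 := by rw [coord_swap, h0, neg_zero]
  have c2 : m.coord v a i j k z' = 0 := by
    rw [h3, Equiv.swap_apply_left, Equiv.swap_apply_right,
      Equiv.swap_apply_of_ne_of_ne hjk.symm (by grind), Equiv.swap_apply_of_ne_of_ne haj hai, h0,
      mul_zero]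
  have c3 : m.coord v a i k j z' = 0 := by rw [coord_swap, c2, neg_zero]
  have c4 : m.coord v a k j i z' = 0 := by
    rw [h4, Equiv.swap_apply_left, Equiv.swap_apply_right,
      Equiv.swap_apply_of_ne_of_ne hji hjk, Equiv.swap_apply_of_ne_of_ne hai hak, c2,
      mul_zero]
  have c5 : m.coord v a k i j z' = 0 := by rw [coord_swap, c4, neg_zero]
  obtain ⟨rfl, h⟩ := key
  rcases h with ⟨rfl, rfl, rfl⟩ | ⟨rfl, rfl, rfl⟩ | ⟨rfl, rfl, rfl⟩ | ⟨rfl, rfl, rfl⟩ |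
    ⟨rfl, rfl, rfl⟩ | ⟨rfl, rfl, rfl⟩ <;> contradiction

theorem coord_trace (a j i k p r : Fin d) : m.coord v a j i k (m.trace v (v p) (v r)) =
    (if j = a then 1 else 0) * ((if i = p then 1 else 0) * (if k = r then 1 else 0) -
      (if i = r then 1 else 0) * (if k = p then 1 else 0)) := by
  rw [trace_apply, map_sum]
  simp only [coord_t, coord_basis]
  rw [Finset.sum_eq_single a (fun b _ hb => by simp [hb]) (by simp)]
  simp

theorem coord_cycTrace (a j i k p r : Fin d) : m.coord v a j i k (m.cycTrace v (v p) (v r)) =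
    (if j = a then 1 else 0) * ((if i = p then 1 else 0) * (if k = r then 1 else 0) -
      (if i = r then 1 else 0) * (if k = p then 1 else 0)) +
    (if j = p then 1 else 0) * ((if i = r then 1 else 0) * (if k = a then 1 else 0) -
      (if i = a then 1 else 0) * (if k = r then 1 else 0)) +
    (if j = r then 1 else 0) * ((if i = a then 1 else 0) * (if k = p then 1 else 0) -
      (if i = p then 1 else 0) * (if k = a then 1 else 0)) := by
  rw [cycTrace_apply, map_sum]
  simp only [cyc_apply, map_add, coord_t, coord_basis]
  rw [Finset.sum_eq_single a (fun b _ hb => by simp [hb]) (by simp)]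
  simp

/-- The vector `v_s` becomes `v_s - v_p` and each of the two forms `v_p^*` becomes `v_p^* + v_s^*`;
multiplying out gives the eight terms. -/
theorem coord_rep_addBasis {p s : Fin d} (h : p ≠ s) (r : Fin d) (hrs : r ≠ p) (z : T) :
    m.coord v s p p r (m.rep (addBasis v h) z) = LinearMap.det (stdRep W (addBasis v h)) *
      (m.coord v s p p r z + m.coord v s p s r z + m.coord v s s p r z + m.coord v s s s r z -
      m.coord v p p p r z - m.coord v p p s r z - m.coord v p s p r z - m.coord v p s s r z) := by
  have : m.coord v s p p r ∘ₗ m.rep (addBasis v h) = LinearMap.det (stdRep W (addBasis v h)) •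
      (m.coord v s p p r + m.coord v s p s r + m.coord v s s p r + m.coord v s s s r -
      m.coord v p p p r - m.coord v p p s r - m.coord v p s p r - m.coord v p s s r) := by
    refine m.ext fun α w x y => ?_
    rw [LinearMap.comp_apply, m.rep_t, map_smul, coord_t]
    simp only [LinearMap.comp_apply, addBasis_apply, addBasis_inv_apply, map_add, map_sub, map_smul,
      coord_basis, LinearMap.smul_apply, LinearMap.add_apply, LinearMap.sub_apply, coord_t,
      smul_eq_mul, if_true, if_neg hrs]
    ring
  exact LinearMap.congr_fun this z

/-- The two chosen coordinates are dual to the two contractions. After they are removed, weights and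
permutations leave only the coordinate in which the first vector is paired with the covector of a
third index, and a transvection settles that one. -/
theorem trace_eigenvector {p r s : Fin d} (hpr : p ≠ r) (hps : p ≠ s) (hrs : r ≠ s) {z : T}
    (hz : StabLike m.rep (m.trace v (v p) (v r)) z) :
    z = m.coord v p p p r z • m.trace v (v p) (v r) +
      m.coord v s p r s z • m.cycTrace v (v p) (v r) := by
  rw [← sub_eq_zero]
  set z' := z - (m.coord v p p p r z • m.trace v (v p) (v r) +
      m.coord v s p r s z • m.cycTrace v (v p) (v r)) with hz'
  -- The hypothesis ranges over all alternating maps so that it applies to both contractions at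
  -- once.
  have hs : ∀ (g : GLW W) (c : ℂ), (∀ f : W →ₗ[ℂ] W →ₗ[ℂ] T, (∀ x y, f y x = -f x y) →
      f (stdRep W g (v p)) (stdRep W g (v r)) = c • f (v p) (v r)) →
      m.rep g z' = (LinearMap.det (stdRep W g) * c) • z' := fun g c h => by
    have h1 := h _ (m.trace_swap v)
    have h2 := h _ (m.cycTrace_swap v)
    have h3 := hz g (LinearMap.det (stdRep W g) * c) (by rw [m.rep_trace, h1, smul_smul])
    rw [hz', map_sub, map_add, map_smul, map_smul, m.rep_trace, m.rep_cycTrace, h1, h2, h3]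
    module
  have h0 : m.coord v p p p r z' = 0 := by
    simp [hz', coord_trace, coord_cycTrace, hpr, hpr.symm]
  have h0' : m.coord v s p r s z' = 0 := by
    simp [hz', coord_trace, coord_cycTrace, hpr, hpr.symm, hps, hps.symm, hrs, hrs.symm]
  have hw := fun q => hs (dilation v q) ((2 : ℂ) ^ (dilWeight q p + dilWeight q r)) fun f hf => by
    rw [dilation_apply, dilation_apply, zpow_add₀ two_ne_zero, mul_comm]
    simp only [map_smul, LinearMap.smul_apply, smul_smul]
  have hsw := hs (permutation v (Equiv.swap p r)) (-1) fun f hf => by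
    rw [permutation_apply, permutation_apply, Equiv.swap_apply_left, Equiv.swap_apply_right, hf,
      neg_one_smul]
  have hsw := coord_eq_of_permutation hsw
  have hperm : ∀ a, a ≠ p → a ≠ r → ∀ j i k, m.coord v a j i k z' =
      m.coord v s (Equiv.swap a s j) (Equiv.swap a s i) (Equiv.swap a s k) z' :=
    fun a hap har j i k => by
      have h := hs (permutation v (Equiv.swap a s)) 1 fun f hf => by
        rw [permutation_apply, permutation_apply, Equiv.swap_apply_of_ne_of_ne hap.symm hps,
          Equiv.swap_apply_of_ne_of_ne har.symm hrs, one_smul]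
      rw [coord_eq_of_permutation h, Equiv.swap_apply_left, one_mul]
  have hzero : ∀ {a j i k}, i ≠ k → ¬ (∀ q, weight q a j i k = dilWeight q p + dilWeight q r) →
      m.coord v a j i k z' = 0 := fun hik h => by
    by_contra hne
    exact h fun q => weight_eq_of_coord_ne_zero (hw q) hne
  -- The transvection `v_s ↦ v_s + v_p` fixes `v_p` and `v_r`, hence imposes a relation between
  -- coordinates of different kinds.
  have htr := hs (addBasis v hps) 1 fun f hf => by
    rw [addBasis_apply, addBasis_apply, coord_basis, coord_basis, if_neg hps.symm,
      if_neg hrs.symm]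
    simp
  have htr := congrArg (m.coord v s p p r) htr
  rw [m.coord_rep_addBasis v hps r hpr.symm, map_smul, smul_eq_mul, mul_assoc] at htr
  have htr := mul_left_cancel₀ (det_stdRep_ne_zero _) htr
  have c1 : m.coord v s s s r z' = 0 := hzero hrs.symm fun h => by
    have := h s; simp [weight, dilWeight, hps, hrs] at this
  have c2 : m.coord v p p s r z' = 0 := hzero hrs.symm fun h => by
    have := h s; simp [weight, dilWeight, hps, hrs] at this
  have c3 : m.coord v p s p r z' = 0 := hzero hpr fun h => by
    have := h s; simp [weight, dilWeight, hps, hrs] at this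
  have c4 : m.coord v p s s r z' = 0 := hzero hrs.symm fun h => by
    have := h s; simp [weight, dilWeight, hps, hrs] at this
  have c5 : m.coord v s p s r z' = 0 := by rw [coord_swap, h0', neg_zero]
  have c6 : m.coord v s s p r z' = 0 := by
    rw [c1, c2, c3, c4, c5, h0] at htr
    linear_combination htr
  have d1 : m.coord v r r r p z' = 0 := by
    rw [hsw, Equiv.swap_apply_left, Equiv.swap_apply_right, h0, mul_zero]
  have d2 : m.coord v s r p s z' = 0 := by
    rw [hsw, Equiv.swap_apply_left, Equiv.swap_apply_right,
      Equiv.swap_apply_of_ne_of_ne hps.symm hrs.symm, h0', mul_zero]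
  refine m.eq_zero_of_coord v fun a j i k => ?_
  by_contra hne
  have hik : i ≠ k := by rintro rfl; exact hne (m.coord_self v _ _ _ _)
  rcases indices_of_pair hpr hik fun q => weight_eq_of_coord_ne_zero (hw q) hne with
    ⟨ha, rfl, hh⟩ | ⟨hap, har, hh⟩
  · rcases ha with rfl | rfl <;> rcases hh with ⟨rfl, rfl⟩ | ⟨rfl, rfl⟩
    · exact hne h0
    · exact hne (by rw [coord_swap, h0, neg_zero])
    · exact hne (by rw [coord_swap, d1, neg_zero])
    · exact hne d1
  · have hp : Equiv.swap a s p = p := Equiv.swap_apply_of_ne_of_ne hap.symm hps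
    have hr : Equiv.swap a s r = r := Equiv.swap_apply_of_ne_of_ne har.symm hrs
    refine hne ?_
    rw [hperm a hap har]
    rcases hh with ⟨rfl, ⟨rfl, rfl⟩ | ⟨rfl, rfl⟩⟩ | ⟨rfl, ⟨rfl, rfl⟩ | ⟨rfl, rfl⟩⟩ |
      ⟨rfl, ⟨rfl, rfl⟩ | ⟨rfl, rfl⟩⟩ <;> rw [hp, hr, Equiv.swap_apply_left]
    · exact h0'
    · exact c5
    · exact d2
    · rw [coord_swap, d2, neg_zero]
    · exact c6
    · rw [coord_swap, c6, neg_zero]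

end TensModel

/-! ### The Young symmetrizer in coordinates -/

section SchurModule

variable {d : ℕ} {W : Type*} [AddCommGroup W] [Module ℂ W] (v : Basis (Fin d) ℂ W)
  (μ : YoungDiagram)

/-- The coefficient of `v_{f(c₁)} ⊗ v_{f(c₂)} ⊗ ⋯` in an element of the tensor power. -/
def coef (f : μ.cells → Fin d) : CellTensor W μ →ₗ[ℂ] ℂ :=
  (Basis.piTensorProduct fun _ : μ.cells => v).coord f

theorem coef_tprod (f : μ.cells → Fin d) (y : μ.cells → W) :
    coef v μ f (PiTensorProduct.tprod ℂ y) = ∏ c, v.coord (f c) (y c) := by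
  rw [coef, Basis.coord_apply, Basis.piTensorProduct_repr_tprod_apply]
  rfl

variable {v μ} in
theorem eq_zero_of_coef {z : CellTensor W μ} (h : ∀ f, coef v μ f z = 0) : z = 0 :=
  (Basis.piTensorProduct fun _ : μ.cells => v).ext_elem fun f => by
    simpa [coef] using h f

theorem permCells_tprod (σ : Equiv.Perm μ.cells) (y : μ.cells → W) :
    permCells W μ σ (PiTensorProduct.tprod ℂ y) = PiTensorProduct.tprod ℂ fun c => y (σ.symm c) :=
  PiTensorProduct.reindex_tprod σ y

theorem coef_permCells (σ : Equiv.Perm μ.cells) (f : μ.cells → Fin d) (z : CellTensor W μ) :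
    coef v μ f (permCells W μ σ z) = coef v μ (f ∘ σ) z := by
  have : coef v μ f ∘ₗ permCells W μ σ = coef v μ (f ∘ σ) := by
    refine PiTensorProduct.ext (MultilinearMap.ext fun y => ?_)
    simp only [LinearMap.compMultilinearMap_apply, LinearMap.comp_apply, permCells_tprod,
      coef_tprod]
    rw [← Equiv.prod_comp σ]
    simp
  exact LinearMap.congr_fun this z

/-- The permutations of the cells preserving each row. -/
def rowPerms : Finset (Equiv.Perm μ.cells) := {σ | ∀ c, (σ c).1.1 = c.1.1}

/-- The permutations of the cells preserving each column. -/
def colPerms : Finset (Equiv.Perm μ.cells) := {σ | ∀ c, (σ c).1.2 = c.1.2}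

variable {μ} in
theorem mem_rowPerms {σ : Equiv.Perm μ.cells} : σ ∈ rowPerms μ ↔ ∀ c, (σ c).1.1 = c.1.1 := by
  simp [rowPerms]

variable {μ} in
theorem mem_colPerms {σ : Equiv.Perm μ.cells} : σ ∈ colPerms μ ↔ ∀ c, (σ c).1.2 = c.1.2 := by
  simp [colPerms]

theorem coef_rowSymmetrizer (f : μ.cells → Fin d) (z : CellTensor W μ) :
    coef v μ f (rowSymmetrizer W μ z) = ∑ σ ∈ rowPerms μ, coef v μ (f ∘ σ) z := by
  simp only [rowSymmetrizer, LinearMap.sum_apply, map_sum, coef_permCells]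
  rfl

theorem coef_colAntisymmetrizer (f : μ.cells → Fin d) (z : CellTensor W μ) :
    coef v μ f (colAntisymmetrizer W μ z) =
      ∑ τ ∈ colPerms μ, ((Equiv.Perm.sign τ : ℤ) : ℂ) * coef v μ (f ∘ τ) z := by
  simp only [colAntisymmetrizer, LinearMap.sum_apply, map_sum, LinearMap.smul_apply, map_smul,
    coef_permCells, smul_eq_mul]
  rfl

theorem coef_comp_rowSymmetrizer (f : μ.cells → Fin d) {σ : Equiv.Perm μ.cells}
    (hσ : σ ∈ rowPerms μ) (z : CellTensor W μ) :
    coef v μ (f ∘ σ) (rowSymmetrizer W μ z) = coef v μ f (rowSymmetrizer W μ z) := by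
  rw [coef_rowSymmetrizer, coef_rowSymmetrizer]
  refine Finset.sum_bij' (fun τ _ => σ * τ) (fun τ _ => σ⁻¹ * τ) ?_ ?_ ?_ ?_ ?_
  · intro τ hτ
    rw [mem_rowPerms] at *
    intro c
    rw [Equiv.Perm.mul_apply, hσ, hτ]
  · intro τ hτ
    rw [mem_rowPerms] at *
    intro c
    rw [Equiv.Perm.mul_apply, ← hσ, show σ (σ⁻¹ (τ c)) = τ c from σ.apply_symm_apply _, hτ]
  · simp
  · simp
  · intro τ _
    rfl

/-- The tensor product of the vectors `v_{ρ(c)}`. -/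
def cellVec (ρ : μ.cells → Fin d) : CellTensor W μ := PiTensorProduct.tprod ℂ fun c => v (ρ c)

theorem coef_cellVec (f ρ : μ.cells → Fin d) :
    coef v μ f (cellVec v μ ρ) = if f = ρ then 1 else 0 := by
  rw [cellVec, coef_tprod]
  simp only [coord_basis]
  rw [Fintype.prod_ite_zero]
  simp only [Finset.prod_const_one, funext_iff]

variable {μ} {ρ : μ.cells → Fin d}

/-- A permutation preserving columns and the row labelling is the identity, so a single term
contributes. -/
theorem coef_colAntisymmetrizer_self (hρ : ∀ c, (ρ c : ℕ) = c.1.1) :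
    coef v μ ρ (colAntisymmetrizer W μ (cellVec v μ ρ)) = 1 := by
  rw [coef_colAntisymmetrizer, Finset.sum_eq_single 1]
  · simp [coef_cellVec]
  · intro τ hτ h1
    rw [coef_cellVec, if_neg, mul_zero]
    intro h
    refine h1 (Equiv.ext fun c => ?_)
    refine Subtype.ext (Prod.ext ?_ (mem_colPerms.1 hτ c))
    rw [← hρ, ← hρ]
    exact congrArg _ (congrFun h c)
  · intro h
    exact absurd (mem_colPerms.2 fun c => rfl) h

theorem comp_rowPerms (hρ : ∀ c, (ρ c : ℕ) = c.1.1) {σ : Equiv.Perm μ.cells}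
    (hσ : σ ∈ rowPerms μ) : ρ ∘ σ = ρ := by
  funext c
  refine Fin.ext ?_
  rw [Function.comp_apply, hρ, hρ, mem_rowPerms.1 hσ]

/-- Reality is what allows a vanishing sum of squares to be split into vanishing terms. -/
theorem exists_real_coef_row {z : CellTensor W μ} (h : ∀ f, ∃ r : ℝ, coef v μ f z = r) (f) :
    ∃ r : ℝ, coef v μ f (rowSymmetrizer W μ z) = r := by
  choose r hr using h
  refine ⟨∑ σ ∈ rowPerms μ, r (f ∘ σ), ?_⟩
  rw [coef_rowSymmetrizer]
  simp [hr]

theorem exists_real_coef_col {z : CellTensor W μ} (h : ∀ f, ∃ r : ℝ, coef v μ f z = r) (f) :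
    ∃ r : ℝ, coef v μ f (colAntisymmetrizer W μ z) = r := by
  choose r hr using h
  refine ⟨∑ σ ∈ colPerms μ, ((Equiv.Perm.sign σ : ℤ) : ℝ) * r (f ∘ σ), ?_⟩
  rw [coef_colAntisymmetrizer]
  simp [hr]

/-- For the bilinear form making the basis tensors orthonormal, the row symmetrizer `a` and the
column antisymmetrizer `b` are self-adjoint, and `a² = |rowPerms| a`. Hence `⟨e, b a b e⟩` times the
number of row permutations is `⟨a b e, a b e⟩`. -/
theorem coef_col_row_col :
    coef v μ ρ (colAntisymmetrizer W μ (rowSymmetrizer W μ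
      (colAntisymmetrizer W μ (cellVec v μ ρ)))) * (rowPerms μ).card =
    ∑ f, coef v μ f (rowSymmetrizer W μ (colAntisymmetrizer W μ (cellVec v μ ρ))) ^ 2 := by
  set y := colAntisymmetrizer W μ (cellVec v μ ρ) with hy
  have h1 : ∀ σ ∈ rowPerms μ, ∑ f, coef v μ (f ∘ σ) y * coef v μ f (rowSymmetrizer W μ y) =
      ∑ f, coef v μ f y * coef v μ f (rowSymmetrizer W μ y) := fun σ hσ => by
    rw [← (Equiv.arrowCongr σ (Equiv.refl (Fin d))).symm.sum_comp
      fun f => coef v μ f y * coef v μ f (rowSymmetrizer W μ y)]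
    refine Finset.sum_congr rfl fun f _ => ?_
    rw [← coef_comp_rowSymmetrizer v μ f hσ]
    rfl
  have h2 : ∑ f, coef v μ f y * coef v μ f (rowSymmetrizer W μ y) =
      coef v μ ρ (colAntisymmetrizer W μ (rowSymmetrizer W μ y)) := by
    conv_lhs => enter [2, f, 1]; rw [hy, coef_colAntisymmetrizer]
    rw [coef_colAntisymmetrizer]
    simp only [Finset.sum_mul]
    rw [Finset.sum_comm]
    refine Finset.sum_bij' (fun τ _ => τ⁻¹) (fun τ _ => τ⁻¹) ?_ ?_ ?_ ?_ ?_
    · intro τ hτ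
      rw [mem_colPerms] at *
      intro c
      rw [← hτ, show τ (τ⁻¹ c) = c from τ.apply_symm_apply c]
    · intro τ hτ
      rw [mem_colPerms] at *
      intro c
      rw [← hτ, show τ (τ⁻¹ c) = c from τ.apply_symm_apply c]
    · simp
    · simp
    · intro τ _
      rw [Finset.sum_eq_single (ρ ∘ ⇑τ⁻¹)]
      · have : (ρ ∘ ⇑τ⁻¹) ∘ ⇑τ = ρ := by funext c; simp
        rw [coef_cellVec, this, if_pos rfl, mul_one, Equiv.Perm.sign_inv]
      · intro f _ hf
        rw [coef_cellVec, if_neg, mul_zero, zero_mul]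
        rintro rfl
        exact hf (by funext c; simp)
      · simp
  rw [← h2, mul_comm, ← nsmul_eq_mul, ← Finset.sum_const, ← Finset.sum_congr rfl h1,
    Finset.sum_comm]
  refine Finset.sum_congr rfl fun f _ => ?_
  rw [← Finset.sum_mul, ← coef_rowSymmetrizer, sq]

/-- The Young symmetrizer, followed by the column antisymmetrizer, does not kill the tensor
product of the basis vectors indexed by the rows. -/
theorem col_row_col_ne_zero (hρ : ∀ c, (ρ c : ℕ) = c.1.1) :
    colAntisymmetrizer W μ (rowSymmetrizer W μ
      (colAntisymmetrizer W μ (cellVec v μ ρ))) ≠ 0 := by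
  intro h0
  have h := coef_col_row_col v (ρ := ρ)
  rw [h0, map_zero, zero_mul] at h
  have hreal := exists_real_coef_row v (exists_real_coef_col v (z := cellVec v μ ρ) fun f =>
    ⟨if f = ρ then 1 else 0, by rw [coef_cellVec]; split_ifs <;> simp⟩)
  choose r hr using hreal
  simp only [hr] at h
  have h' : ∑ f, r f ^ 2 = 0 := by exact_mod_cast h.symm
  rw [Finset.sum_eq_zero_iff_of_nonneg fun f _ => sq_nonneg _] at h'
  have h1 : r ρ = 0 := by simpa using h' ρ (Finset.mem_univ _)
  have h2 := hr ρ
  -- The coefficient at `ρ` is the number of row permutations: row permutations fix `ρ`, and each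
  -- contributes `1`.
  rw [h1, coef_rowSymmetrizer, Finset.sum_congr rfl fun σ hσ => by
    rw [comp_rowPerms hρ hσ, coef_colAntisymmetrizer_self v hρ]] at h2
  have h3 : (1 : Equiv.Perm μ.cells) ∈ rowPerms μ := mem_rowPerms.2 fun c => rfl
  have h4 : (rowPerms μ).card ≠ 0 := Finset.card_ne_zero_of_mem h3
  simp [h4] at h2

end SchurModule

/-! ### Recognizing a Schur functor -/

section Criterion

variable {d : ℕ} {W T : Type*} [AddCommGroup W] [Module ℂ W] [AddCommGroup T] [Module ℂ T]
  {v : Basis (Fin d) ℂ W} {μ : YoungDiagram} {ρ : μ.cells → Fin d}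
  {τ : Representation ℂ (GLW W) T} {B : CellTensor W μ →ₗ[ℂ] T} {A : T →ₗ[ℂ] CellTensor W μ}
  {K : Submodule ℂ T}

/-- A criterion for the representation generated by a vector to be a Schur functor. -/
theorem orbit_equiv_schur (hρ : ∀ c, (ρ c : ℕ) = c.1.1)
    (hB : ∀ g z, B (cellRep W μ g z) = τ g (B z))
    (hA : ∀ z, A (B z) = colAntisymmetrizer W μ z)
    (hK : ∀ k ∈ K, rowSymmetrizer W μ (A k) = 0)
    (hrange : LinearMap.range B ≤ (orbit τ (B (cellVec v μ ρ))).toSubmodule ⊔ K)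
    (hstab : ∀ z ∈ LinearMap.range B, StabLike τ (B (cellVec v μ ρ)) z →
      ∃ c : ℂ, z = c • B (cellVec v μ ρ)) :
    Nonempty ((orbit τ (B (cellVec v μ ρ))).toRepresentation.Equiv (schurRep W μ)) ∧
      (orbit τ (B (cellVec v μ ρ))).toSubmodule ⊓ K = ⊥ := by
  set u := B (cellVec v μ ρ) with hu
  let H : T →ₗ[ℂ] CellTensor W μ := rowSymmetrizer W μ ∘ₗ A
  have hHB : ∀ z, H (B z) = youngSymmetrizer W μ z := fun z => by
    simp only [H, LinearMap.comp_apply, hA, youngSymmetrizer]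
  have hHg : ∀ g, ∀ z ∈ LinearMap.range B, H (τ g z) = cellRep W μ g (H z) := by
    rintro g _ ⟨y, rfl⟩
    rw [← hB, hHB, hHB, youngSymmetrizer_cellRep]
  have horb : (orbit τ u).toSubmodule ≤ LinearMap.range B := orbit_le _ fun g => by
    rw [hu, ← hB]; exact LinearMap.mem_range_self _ _
  -- On the range of `B` the composite `B ∘ H` is equivariant, so its value at `u` inherits the
  -- eigenvector relations of `u`.
  obtain ⟨c, hc⟩ := hstab (B (H u)) (LinearMap.mem_range_self _ _) fun g r hg => by
    rw [← hB, ← hHg g u (LinearMap.mem_range_self _ _), hg, map_smul, map_smul]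
  -- Applying `A` to `B (H u)` gives `b a b` on the row tensor, which does not vanish.
  have hc0 : c ≠ 0 := by
    rintro rfl
    rw [zero_smul] at hc
    have h1 := congrArg A hc
    rw [hA, map_zero, hu, hHB] at h1
    exact col_row_col_ne_zero v hρ h1
  have hBH : ∀ z ∈ (orbit τ u).toSubmodule, B (H z) = c • z := fun z hz => by
    have : (orbit τ u).toSubmodule ≤ LinearMap.eqLocus (B ∘ₗ H) (c • LinearMap.id) := by
      refine orbit_le _ fun g => ?_
      change B (H (τ g u)) = c • τ g u
      rw [hHg g u (LinearMap.mem_range_self _ _), hB, hc, map_smul]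
    exact this hz
  have hinj : ∀ z ∈ (orbit τ u).toSubmodule, H z = 0 → z = 0 := fun z hz h => by
    have := hBH z hz
    rw [h, map_zero] at this
    exact (smul_eq_zero.1 this.symm).resolve_left hc0
  constructor
  · let F : (orbit τ u).toSubmodule →ₗ[ℂ] (schur W μ).toSubmodule :=
      H.restrict fun z hz => by
        obtain ⟨y, rfl⟩ := horb hz
        rw [hHB]
        exact ⟨y, rfl⟩
    have hF : Function.Bijective F := by
      constructor
      · rw [← LinearMap.ker_eq_bot, LinearMap.ker_eq_bot']
        intro z hz
        exact Subtype.ext (hinj z z.2 (congrArg Subtype.val hz))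
      · rintro ⟨_, y, rfl⟩
        -- Modulo `K`, which `H` kills, the vector `B y` lies in the cyclic subrepresentation; this
        -- gives surjectivity.
        obtain ⟨z, hz, k, hk, hzk⟩ := Submodule.mem_sup.1 (hrange (LinearMap.mem_range_self B y))
        refine ⟨⟨z, hz⟩, Subtype.ext ?_⟩
        change H z = youngSymmetrizer W μ y
        rw [← hHB, ← hzk, map_add, show H k = 0 from hK k hk, add_zero]
    refine ⟨Representation.Equiv.mk (LinearEquiv.ofBijective F hF) fun g => ?_⟩
    refine LinearMap.ext fun z => Subtype.ext ?_
    exact hHg g z (horb z.2)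
  · rw [eq_bot_iff]
    rintro z ⟨hz, hzK⟩
    exact hinj z hz (hK z hzK)

end Criterion

/-- A description of the cells of `μ`: its first column has `n ≤ d` cells, and the cells outside
the first column are enumerated by `extra`. -/
structure Columns (d : ℕ) (μ : YoungDiagram) (n k : ℕ) where
  /-- The cells outside the first column. -/
  extra : Fin k → ℕ × ℕ
  injective : Function.Injective extra
  col_ne_zero (l : Fin k) : (extra l).2 ≠ 0
  mem_iff (c : ℕ × ℕ) : c ∈ μ ↔ (c.1 < n ∧ c.2 = 0) ∨ ∃ l, extra l = c
  row_lt (l : Fin k) : (extra l).1 < n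
  le : n ≤ d

/-! ### Shapes described by a first column and a few extra cells -/

namespace Columns

variable {d : ℕ} {μ : YoungDiagram} {n k : ℕ} (s : Columns d μ n k)

/-- The cell of `μ` with a given label. -/
def cell : Fin n ⊕ Fin k → μ.cells
  | .inl i => ⟨(i, 0), (YoungDiagram.mem_cells _).2 ((s.mem_iff _).2 (Or.inl ⟨i.2, rfl⟩))⟩
  | .inr l => ⟨s.extra l, (YoungDiagram.mem_cells _).2 ((s.mem_iff _).2 (Or.inr ⟨l, rfl⟩))⟩

theorem cell_bijective : Function.Bijective s.cell := by
  constructor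
  · rintro (i | i) (j | j) h <;> have h' := congrArg Subtype.val h
    · exact congrArg _ (Fin.ext (congrArg Prod.fst h'))
    · exact absurd (congrArg Prod.snd h').symm (s.col_ne_zero j)
    · exact absurd (congrArg Prod.snd h') (s.col_ne_zero i)
    · exact congrArg _ (s.injective h')
  · rintro ⟨⟨i, j⟩, h⟩
    rcases (s.mem_iff _).1 ((YoungDiagram.mem_cells _).1 h) with ⟨hi, rfl⟩ | ⟨l, hl⟩
    · exact ⟨.inl ⟨i, hi⟩, rfl⟩
    · exact ⟨.inr l, Subtype.ext hl⟩

/-- The labelling of the cells of `μ`. -/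
def equiv : Fin n ⊕ Fin k ≃ μ.cells := Equiv.ofBijective s.cell s.cell_bijective

theorem equiv_inl (i : Fin n) : (s.equiv (.inl i)).1 = ((i : ℕ), 0) := rfl

theorem equiv_inr (l : Fin k) : (s.equiv (.inr l)).1 = s.extra l := rfl

/-- The row of a cell. -/
def row (c : μ.cells) : Fin d := ⟨c.1.1, by
  refine lt_of_lt_of_le ?_ s.le
  rcases (s.mem_iff _).1 ((YoungDiagram.mem_cells _).1 c.2) with ⟨hi, _⟩ | ⟨l, hl⟩
  · exact hi
  · rw [← hl]; exact s.row_lt l⟩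

/-- The row of an extra cell. -/
def extraRow (l : Fin k) : Fin d := ⟨(s.extra l).1, (s.row_lt l).trans_le s.le⟩

/-! ### Sums over row permutations -/

/-- Multiplying by the transposition of the two cells pairs off the row permutations with opposite
contributions. -/
theorem sum_row_eq_zero {F : (μ.cells → Fin d) → ℂ} {c c' : μ.cells} (hc : c.1.1 = c'.1.1)
    (hne : c ≠ c') (h : ∀ f, F (f ∘ Equiv.swap c c') = -F f) (f : μ.cells → Fin d) :
    ∑ σ ∈ rowPerms μ, F (f ∘ σ) = 0 := by
  refine Finset.sum_involution (fun σ _ => σ * Equiv.swap c c') ?_ ?_ ?_ ?_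
  · intro σ _
    rw [Equiv.Perm.coe_mul, ← Function.comp_assoc, h, add_neg_cancel]
  · intro σ _ _ h1
    have : Equiv.swap c c' = 1 := by simpa using h1
    exact hne (Equiv.swap_eq_one_iff.1 this)
  · intro σ hσ
    rw [mem_rowPerms] at *
    intro x
    rw [Equiv.Perm.mul_apply, hσ]
    rcases eq_or_ne x c with rfl | h1
    · rw [Equiv.swap_apply_left, hc]
    rcases eq_or_ne x c' with rfl | h2
    · rw [Equiv.swap_apply_right, hc]
    rw [Equiv.swap_apply_of_ne_of_ne h1 h2]
  · intro σ _
    rw [mul_assoc, Equiv.swap_mul_self, mul_one]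

theorem comp_swap_equiv (f : μ.cells → Fin d) (x y z : Fin n ⊕ Fin k) :
    f (Equiv.swap (s.equiv x) (s.equiv y) (s.equiv z)) =
      if z = x then f (s.equiv y) else if z = y then f (s.equiv x) else f (s.equiv z) := by
  rw [Equiv.swap_apply_def]
  simp only [s.equiv.injective.eq_iff]
  split_ifs <;> rfl

/-- A function of the labels of the cells that changes sign when the labels of two cells in the same
row, one of them in the first column, are exchanged. -/
theorem sum_row_inl_inr {F : (Fin n → Fin d) → (Fin k → Fin d) → ℂ} {i : Fin n} {l : Fin k}
    (hrow : (s.extra l).1 = i)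
    (h : ∀ p q, F (Function.update p i (q l)) (Function.update q l (p i)) = -F p q)
    (f : μ.cells → Fin d) :
    ∑ σ ∈ rowPerms μ, F (fun i => f (σ (s.equiv (.inl i)))) (fun l => f (σ (s.equiv (.inr l)))) =
      0 := by
  refine sum_row_eq_zero (c := s.equiv (.inl i)) (c' := s.equiv (.inr l))
    (F := fun f => F (fun i => f (s.equiv (.inl i))) (fun l => f (s.equiv (.inr l))))
    (by rw [equiv_inl, equiv_inr, hrow]) (by simp) (fun f => ?_) f
  rw [← h]
  congr 1
  · funext i'
    rw [Function.comp_apply, s.comp_swap_equiv f, Function.update_apply]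
    simp
  · funext i'
    rw [Function.comp_apply, s.comp_swap_equiv f, Function.update_apply]
    simp

theorem sum_row_inr_inr {F : (Fin n → Fin d) → (Fin k → Fin d) → ℂ} {l l' : Fin k}
    (hrow : (s.extra l).1 = (s.extra l').1) (hne : l ≠ l')
    (h : ∀ p q, F p (q ∘ Equiv.swap l l') = -F p q)
    (f : μ.cells → Fin d) :
    ∑ σ ∈ rowPerms μ, F (fun i => f (σ (s.equiv (.inl i)))) (fun l => f (σ (s.equiv (.inr l)))) =
      0 := by
  refine sum_row_eq_zero (c := s.equiv (.inr l)) (c' := s.equiv (.inr l'))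
    (F := fun f => F (fun i => f (s.equiv (.inl i))) (fun l => f (s.equiv (.inr l))))
    (by rw [equiv_inr, equiv_inr, hrow]) (by simpa using hne) (fun f => ?_) f
  rw [← h]
  congr 1
  · funext i'
    rw [Function.comp_apply, s.comp_swap_equiv f]
    simp
  · funext i'
    rw [Function.comp_apply, s.comp_swap_equiv f, Function.comp_apply, Equiv.swap_apply_def]
    simp only [Sum.inr.injEq]
    split_ifs <;> rfl

/-! ### The column antisymmetrizer -/

variable {W : Type*} [AddCommGroup W] [Module ℂ W] (v : Basis (Fin d) ℂ W)

/-- This is the Leibniz formula: permutations that move a cell to another column meet a zero entry.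
-/
theorem _root_.HilbertSymmetric.coef_colAntisymmetrizer_tprod (f : μ.cells → Fin d)
    (y : μ.cells → W) :
    coef v μ f (colAntisymmetrizer W μ (PiTensorProduct.tprod ℂ y)) =
      (Matrix.of fun c c' : μ.cells =>
        if c.1.2 = c'.1.2 then v.coord (f c) (y c') else 0).det := by
  rw [coef_colAntisymmetrizer, Matrix.det_apply']
  symm
  rw [← Finset.sum_subset (Finset.subset_univ (colPerms μ))]
  · refine Finset.sum_congr rfl fun τ hτ => ?_
    rw [coef_tprod]
    congr 1
    refine Finset.prod_congr rfl fun c _ => ?_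
    rw [Matrix.of_apply, if_pos (mem_colPerms.1 hτ c)]
    rfl
  · intro τ _ hτ
    obtain ⟨c, hc⟩ : ∃ c, (τ c).1.2 ≠ c.1.2 := by
      by_contra! h
      exact hτ (mem_colPerms.2 h)
    rw [Finset.prod_eq_zero (Finset.mem_univ c), mul_zero]
    rw [Matrix.of_apply, if_neg hc]

/-- The determinant of the values of covectors on vectors labelled by the extra cells, with the
values for cells in different columns replaced by `0`. -/
def extraDet (q : Fin k → Fin d) (z : Fin k → W) : ℂ :=
  (Matrix.of fun l l' : Fin k =>
    if (s.extra l).2 = (s.extra l').2 then v.coord (q l) (z l') else 0).det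

/-- Cells in different columns do not interact, so the matrix is block diagonal and the first column
splits off. -/
theorem coef_colAntisymmetrizer_blocks (f : μ.cells → Fin d) (y : μ.cells → W) :
    coef v μ f (colAntisymmetrizer W μ (PiTensorProduct.tprod ℂ y)) =
      (Matrix.of fun i j : Fin n =>
        v.coord (f (s.equiv (.inl i))) (y (s.equiv (.inl j)))).det *
      s.extraDet v (fun l => f (s.equiv (.inr l))) (fun l => y (s.equiv (.inr l))) := by
  rw [coef_colAntisymmetrizer_tprod, ← Matrix.det_submatrix_equiv_self s.equiv, extraDet,
    ← Matrix.det_fromBlocks_zero₂₁ _ 0]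
  congr 1
  ext (i | i) (j | j)
  · simp [equiv_inl]
  · simp [equiv_inl, equiv_inr, (s.col_ne_zero j).symm]
  · simp [equiv_inl, equiv_inr, s.col_ne_zero i]
  · simp only [Matrix.submatrix_apply, Matrix.of_apply, Matrix.fromBlocks_apply₂₂, equiv_inr]
    congr

/-! ### Schur functors as subrepresentations -/

variable {T N : Type*} [AddCommGroup T] [Module ℂ T] [AddCommGroup N] [Module ℂ N]

/-- The linear map on the tensor power given by an alternating map of the first column and a
multilinear map of the extra cells. -/
def assemble (A : W [⋀^Fin n]→ₗ[ℂ] N) (Φ : N →ₗ[ℂ] MultilinearMap ℂ (fun _ : Fin k => W) T) :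
    CellTensor W μ →ₗ[ℂ] T :=
  PiTensorProduct.lift
    ((Φ.compMultilinearMap A.toMultilinearMap).uncurrySum.domDomCongr s.equiv)

variable (A : W [⋀^Fin n]→ₗ[ℂ] N) (Φ : N →ₗ[ℂ] MultilinearMap ℂ (fun _ : Fin k => W) T)

theorem assemble_tprod (y : μ.cells → W) : s.assemble A Φ (PiTensorProduct.tprod ℂ y) =
    Φ (A fun i => y (s.equiv (.inl i))) fun l => y (s.equiv (.inr l)) := by
  rw [assemble, PiTensorProduct.lift.tprod]
  rfl

theorem assemble_cellVec : s.assemble A Φ (cellVec v μ s.row) =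
    Φ (A fun i => v (Fin.castLE s.le i)) fun l => v (s.extraRow l) :=
  s.assemble_tprod A Φ _

theorem range_assemble_le {M : Submodule ℂ T} (h : ∀ y z, Φ (A y) z ∈ M) :
    LinearMap.range (s.assemble A Φ) ≤ M := by
  rintro _ ⟨x, rfl⟩
  induction x using PiTensorProduct.induction_on with
  | smul_tprod r y =>
    rw [map_smul, assemble_tprod]
    exact Submodule.smul_mem _ _ (h _ _)
  | add x y hx hy => rw [map_add]; exact Submodule.add_mem _ hx hy

/-- A criterion for the representation generated by a vector to be a Schur functor, for the
representations given by an alternating map of the first column and a multilinear map of the other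
cells. -/
theorem orbit_equiv_schur {τ : Representation ℂ (GLW W) T} {M K : Submodule ℂ T}
    {L : (Fin n → Fin d) → (Fin k → Fin d) → T →ₗ[ℂ] ℂ}
    (hτ : ∀ g y z, τ g (Φ (A y) z) = Φ (A fun i => stdRep W g (y i)) fun l => stdRep W g (z l))
    (hL : ∀ p q y z, L p q (Φ (A y) z) =
      (Matrix.of fun i j => v.coord (p i) (y j)).det * s.extraDet v q z)
    (hK : ∀ x ∈ K, ∀ f : μ.cells → Fin d, ∑ σ ∈ rowPerms μ,
      L (fun i => f (σ (s.equiv (.inl i)))) (fun l => f (σ (s.equiv (.inr l)))) x = 0)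
    {u : T} (hu : u = Φ (A fun i => v (Fin.castLE s.le i)) fun l => v (s.extraRow l))
    (hM : ∀ y z, Φ (A y) z ∈ M) (hMK : M ≤ (orbit τ u).toSubmodule ⊔ K)
    (hstab : ∀ z ∈ M, StabLike τ u z → ∃ c : ℂ, z = c • u) :
    Nonempty ((orbit τ u).toRepresentation.Equiv (schurRep W μ)) ∧
      (orbit τ u).toSubmodule ⊓ K = ⊥ := by
  rw [← s.assemble_cellVec v A Φ] at hu
  subst hu
  let H : T →ₗ[ℂ] CellTensor W μ := ∑ f : μ.cells → Fin d,
    (L (fun i => f (s.equiv (.inl i))) (fun l => f (s.equiv (.inr l)))).smulRight (cellVec v μ f)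
  have hH : ∀ f z, coef v μ f (H z) =
      L (fun i => f (s.equiv (.inl i))) (fun l => f (s.equiv (.inr l))) z := fun f z => by
    simp [H, coef_cellVec]
  refine HilbertSymmetric.orbit_equiv_schur (A := H) (fun c => rfl) (fun g z => ?_) (fun z => ?_)
    (fun x hx => eq_zero_of_coef (v := v) fun f => ?_)
    ((s.range_assemble_le A Φ hM).trans hMK)
    (fun z hz => hstab z (s.range_assemble_le A Φ hM hz))
  · have : s.assemble A Φ ∘ₗ cellRep W μ g = τ g ∘ₗ s.assemble A Φ := by
      refine PiTensorProduct.ext (MultilinearMap.ext fun y => ?_)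
      simp only [LinearMap.compMultilinearMap_apply, LinearMap.comp_apply]
      rw [show cellRep W μ g (PiTensorProduct.tprod ℂ y) =
        PiTensorProduct.tprod ℂ fun c => stdRep W g (y c) from PiTensorProduct.map_tprod _ _,
        assemble_tprod, assemble_tprod, hτ]
    exact LinearMap.congr_fun this z
  · have : H ∘ₗ s.assemble A Φ = colAntisymmetrizer W μ := by
      refine PiTensorProduct.ext (MultilinearMap.ext fun y => ?_)
      simp only [LinearMap.compMultilinearMap_apply, LinearMap.comp_apply]
      rw [← sub_eq_zero]
      refine eq_zero_of_coef (v := v) fun f => ?_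
      rw [map_sub, hH, assemble_tprod, hL, coef_colAntisymmetrizer_blocks s, sub_self]
    exact LinearMap.congr_fun this z
  · rw [coef_rowSymmetrizer]
    simp only [hH]
    exact hK x hx f

end Columns

/-! ### The four shapes -/

/-- The cells of `(3, 2, 1, …, 1, 0)`. -/
def columns321 {d : ℕ} (hd : 3 ≤ d) : Columns d (shape321 d) (d - 1) 3 where
  -- The extra cells carry `w, x, y` in this order: `w` is alone in the third column, and the
  -- alternating pair `x, y` fills the second.
  extra := ![(0, 2), (0, 1), (1, 1)]
  injective := by decide
  col_ne_zero := by decide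
  mem_iff := by
    rintro ⟨i, j⟩
    rw [shape321, YoungDiagram.mem_ofRowLens]
    rcases i with _ | _ | i
    · simp [Fin.exists_fin_succ]; omega
    · simp [Fin.exists_fin_succ]; omega
    · simp [Fin.exists_fin_succ, List.getElem_append, List.getElem_cons]; grind
  row_lt l := by fin_cases l <;> simp <;> omega
  le := by omega

/-- The cells of `(3, 1, …, 1)`. -/
def columns311 {d : ℕ} (hd : 3 ≤ d) : Columns d (shape311 d) d 2 where
  extra := ![(0, 1), (0, 2)]
  injective := by decide
  col_ne_zero := by decide
  mem_iff := by
    rintro ⟨i, j⟩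
    rw [shape311, YoungDiagram.mem_ofRowLens]
    rcases i with _ | i
    · simp [Fin.exists_fin_succ]; omega
    · simp [Fin.exists_fin_succ]; grind
  row_lt l := by fin_cases l <;> simp <;> omega
  le := le_rfl

/-- The cells of `(2, 2, 1, …, 1)`. -/
def columns221 {d : ℕ} (hd : 3 ≤ d) : Columns d (shape221 d) d 2 where
  extra := ![(0, 1), (1, 1)]
  injective := by decide
  col_ne_zero := by decide
  mem_iff := by
    rintro ⟨i, j⟩
    rw [shape221, YoungDiagram.mem_ofRowLens]
    rcases i with _ | _ | i
    · simp [Fin.exists_fin_succ]; omega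
    · simp [Fin.exists_fin_succ]; omega
    · simp [Fin.exists_fin_succ]; grind
  row_lt l := by fin_cases l <;> simp <;> omega
  le := le_rfl

/-- The cells of `(2, 2, 2, 1, …, 1, 0)`. -/
def columns222 {d : ℕ} (hd : 4 ≤ d) : Columns d (shape222 d) (d - 1) 3 where
  -- One column of length three, as the cyclic sums alternate in all three vectors.
  extra := ![(0, 1), (1, 1), (2, 1)]
  injective := by decide
  col_ne_zero := by decide
  mem_iff := by
    rintro ⟨i, j⟩
    rw [shape222, YoungDiagram.mem_ofRowLens]
    rcases i with _ | _ | _ | i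
    · simp [Fin.exists_fin_succ]; omega
    · simp [Fin.exists_fin_succ]; omega
    · simp [Fin.exists_fin_succ]; omega
    · simp [Fin.exists_fin_succ, List.getElem_append, List.getElem_cons]; grind
  row_lt l := by fin_cases l <;> simp <;> omega
  le := by omega

/-! ### The first column as a covector -/

section FirstColumn

variable {d : ℕ} {W : Type*} [AddCommGroup W] [Module ℂ W] (v : Basis (Fin d) ℂ W)

/-- The covector corresponding to an element of `⋀^{d-1} W`. -/
def covec : ⋀[ℂ]^(d - 1) W →ₗ[ℂ] Dual ℂ W :=
  ∑ a : Fin d, (-1 : ℂ) ^ ((a : ℕ) + 1) •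
    (wedgeForm fun i => v.coord (omitIdx a i)).smulRight (v.coord a)

theorem covec_dualWedge (α : Dual ℂ W) : covec v (dualWedge v α) = α := by
  conv_rhs => rw [dual_eq_sum v α]
  simp only [covec, LinearMap.sum_apply, LinearMap.smul_apply, LinearMap.smulRight_apply,
    wedgeForm_dualWedge_coord, smul_smul]
  refine Finset.sum_congr rfl fun a _ => ?_
  rw [← mul_assoc, ← pow_add, ← two_mul, pow_mul]
  simp

theorem dualWedge_covec (hd : 0 < d) (η : ⋀[ℂ]^(d - 1) W) : dualWedge v (covec v η) = η := by
  obtain ⟨α, rfl⟩ := dualWedge_surjective v hd η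
  rw [covec_dualWedge]

theorem covec_extRep (hd : 0 < d) (g : GLW W) (η : ⋀[ℂ]^(d - 1) W) :
    covec v (extRep W (d - 1) g η) =
      LinearMap.det (stdRep W g) • (covec v η ∘ₗ stdRep W g⁻¹) := by
  obtain ⟨α, rfl⟩ := dualWedge_surjective v hd η
  rw [extRep_dualWedge v hd, map_smul, covec_dualWedge, covec_dualWedge]

/-- The covector determined by `d - 1` vectors, normalized to send the first `d - 1` basis vectors
to the last coordinate. -/
def firstColumn : W [⋀^Fin (d - 1)]→ₗ[ℂ] Dual ℂ W :=
  ((-1 : ℂ) ^ d • covec v).compAlternatingMap (exteriorPower.ιMulti ℂ (d - 1))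

theorem firstColumn_apply (y : Fin (d - 1) → W) :
    firstColumn v y = (-1 : ℂ) ^ d • covec v (exteriorPower.ιMulti ℂ (d - 1) y) := rfl

theorem firstColumn_rep (hd : 0 < d) (g : GLW W) (y : Fin (d - 1) → W) :
    firstColumn v (fun i => stdRep W g (y i)) =
      LinearMap.det (stdRep W g) • (firstColumn v y ∘ₗ stdRep W g⁻¹) := by
  rw [firstColumn_apply, firstColumn_apply,
    show exteriorPower.ιMulti ℂ (d - 1) (fun i => stdRep W g (y i)) =
      extRep W (d - 1) g (exteriorPower.ιMulti ℂ (d - 1) y) from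
      (exteriorPower.map_apply_ιMulti _ _).symm, covec_extRep v hd, LinearMap.smul_comp, smul_comm]

/-- The sign `(-1)^d` in the normalization is the sign of `dualWedge` at the last index, counted
from `1`. -/
theorem firstColumn_basis (hd : 0 < d) :
    firstColumn v (fun i => v (Fin.castLE (Nat.sub_le d 1) i)) = v.coord ⟨d - 1, by omega⟩ := by
  have h1 : exteriorPower.ιMulti ℂ (d - 1) (fun i => v (Fin.castLE (Nat.sub_le d 1) i)) =
      wedgeOmit v ⟨d - 1, by omega⟩ := by
    rw [wedgeOmit_eq]
    congr 1
    funext i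
    congr 1
    ext
    simp [omitIdx]
  have h2 := covec_dualWedge v (v.coord ⟨d - 1, by omega⟩)
  rw [dualWedge_coord, map_smul] at h2
  rw [firstColumn_apply, h1, ← h2]
  simp only [Nat.sub_add_cancel hd]

/-- The vector at which the covector of an element of `⋀^{d-1} W` takes the value of a given
coordinate form. -/
def evalVec (p : Fin (d - 1) → Fin d) : W :=
  ∑ a, wedgeForm (fun i => v.coord (p i)) (dualWedge v (v.coord a)) • v a

theorem apply_evalVec (p : Fin (d - 1) → Fin d) (α : Dual ℂ W) :
    α (evalVec v p) = wedgeForm (fun i => v.coord (p i)) (dualWedge v α) := by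
  conv_rhs => rw [dual_eq_sum v α]
  simp only [evalVec, map_sum, map_smul, smul_eq_mul]
  exact Finset.sum_congr rfl fun a _ => mul_comm _ _

theorem firstColumn_evalVec (hd : 0 < d) (p : Fin (d - 1) → Fin d) (y : Fin (d - 1) → W) :
    firstColumn v y (evalVec v p) =
      (-1 : ℂ) ^ d * (Matrix.of fun i j => v.coord (p i) (y j)).det := by
  rw [firstColumn_apply, LinearMap.smul_apply, apply_evalVec, dualWedge_covec v hd,
    wedgeForm_ιMulti, smul_eq_mul]

/-- The exchange rule: forms of contractions change sign when the label of a first column cell is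
swapped with the label at which the covector is evaluated. Hence row symmetrization kills them. -/
theorem coord_evalVec_update (hd : 0 < d) (p : Fin (d - 1) → Fin d) (i : Fin (d - 1))
    (b : Fin d) : v.coord (p i) (evalVec v (Function.update p i b)) =
      -v.coord b (evalVec v p) := by
  rw [apply_evalVec, apply_evalVec, ← wedgeForm_update_dualWedge v hd]
  congr 2
  funext j
  rcases eq_or_ne j i with rfl | h
  · simp
  · simp [h]

theorem det_coord_eq_mul (p : Fin d → Fin d) (y : Fin d → W) :
    (Matrix.of fun i j => v.coord (p i) (y j)).det =
      (Matrix.of fun i j => v.coord (p i) (v j)).det * v.det y := by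
  rw [Basis.det_apply, ← Matrix.det_mul]
  congr 1
  ext i j
  simp only [Matrix.mul_apply, Matrix.of_apply, Basis.toMatrix_apply]
  conv_lhs => rw [← v.sum_repr (y j), map_sum]
  exact Finset.sum_congr rfl fun k _ => by rw [map_smul, smul_eq_mul, mul_comm]

end FirstColumn

/-- A linear family of trilinear maps as a linear family of multilinear maps. -/
def triMultiFamily {N W M : Type*} [AddCommGroup N] [Module ℂ N] [AddCommGroup W] [Module ℂ W]
    [AddCommGroup M] [Module ℂ M] (f : N →ₗ[ℂ] W →ₗ[ℂ] W →ₗ[ℂ] W →ₗ[ℂ] M) :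
    N →ₗ[ℂ] MultilinearMap ℂ (fun _ : Fin 3 => W) M where
  toFun α := triMulti (f α)
  map_add' α β := by ext z; simp [triMulti]
  map_smul' c α := by ext z; simp [triMulti]

theorem triMultiFamily_apply {N W M : Type*} [AddCommGroup N] [Module ℂ N] [AddCommGroup W]
    [Module ℂ W] [AddCommGroup M] [Module ℂ M] (f : N →ₗ[ℂ] W →ₗ[ℂ] W →ₗ[ℂ] W →ₗ[ℂ] M) (α : N)
    (z : Fin 3 → W) : triMultiFamily f α z = f α (z 0) (z 1) (z 2) := rfl

/-- The multiples of a bilinear map as a linear family of multilinear maps. -/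
def biMultiFamily {W M : Type*} [AddCommGroup W] [Module ℂ W]
    [AddCommGroup M] [Module ℂ M] (f : W →ₗ[ℂ] W →ₗ[ℂ] M) :
    ℂ →ₗ[ℂ] MultilinearMap ℂ (fun _ : Fin 2 => W) M :=
  LinearMap.toSpanSingleton ℂ _ (biMulti f)

theorem biMultiFamily_apply {W M : Type*} [AddCommGroup W]
    [Module ℂ W] [AddCommGroup M] [Module ℂ M] (f : W →ₗ[ℂ] W →ₗ[ℂ] M) (c : ℂ)
    (z : Fin 2 → W) : biMultiFamily f c z = c • f (z 0) (z 1) := rfl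

/-! ### Identification of the pieces with Schur functors -/

namespace TensModel

variable {d : ℕ} {W T : Type*} [AddCommGroup W] [Module ℂ W] [AddCommGroup T] [Module ℂ T]
  (m : TensModel W T) (v : Basis (Fin d) ℂ W)

/-- The linear form on `T` labelled by the cells of a shape with three cells outside the first
column. -/
def cellForm (p : Fin (d - 1) → Fin d) (q : Fin 3 → Fin d) : T →ₗ[ℂ] ℂ :=
  (-1 : ℂ) ^ d • m.form (evalVec v p) (v.coord (q 0)) (v.coord (q 1)) (v.coord (q 2))

theorem cellForm_t (p : Fin (d - 1) → Fin d) (q : Fin 3 → Fin d) (α : Dual ℂ W) (w x y : W) :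
    m.cellForm v p q (m.t α w x y) = (-1 : ℂ) ^ d * (α (evalVec v p) * (v.coord (q 0) w *
      (v.coord (q 1) x * v.coord (q 2) y - v.coord (q 1) y * v.coord (q 2) x))) := by
  rw [cellForm, LinearMap.smul_apply, m.form_t, smul_eq_mul]

theorem cellForm_cyc (p : Fin (d - 1) → Fin d) (q : Fin 3 → Fin d) (α : Dual ℂ W) (w x y : W) :
    m.cellForm v p q (m.cyc α w x y) = (-1 : ℂ) ^ d * (α (evalVec v p) *
      (Matrix.of fun l l' => v.coord (q l) (![w, x, y] l')).det) := by
  rw [cyc_apply, map_add, map_add, cellForm_t, cellForm_t, cellForm_t, Matrix.det_fin_three]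
  simp
  ring

theorem sum_coord_mul (ω : W) (β : Dual ℂ W) :
    ∑ a, v.coord a ω * β (v a) = β ω := by
  conv_rhs => rw [← v.sum_repr ω, map_sum]
  simp

/-- Contraction replaces the covector by the coordinate form of an extra cell, bringing the
expression into the shape of the exchange rule. -/
theorem cellForm_trace (p : Fin (d - 1) → Fin d) (q : Fin 3 → Fin d) (x y : W) :
    m.cellForm v p q (m.trace v x y) = (-1 : ℂ) ^ d * (v.coord (q 0) (evalVec v p) *
      (v.coord (q 1) x * v.coord (q 2) y - v.coord (q 1) y * v.coord (q 2) x)) := by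
  rw [trace_apply, map_sum, ← sum_coord_mul v (evalVec v p), Finset.sum_mul, Finset.mul_sum]
  exact Finset.sum_congr rfl fun a _ => by rw [cellForm_t]; ring

theorem cellForm_polar (p : Fin (d - 1) → Fin d) (q : Fin 3 → Fin d) (w x : W) :
    m.cellForm v p q (m.polar v w x) =
      (-1 : ℂ) ^ d * (v.coord (q 2) (evalVec v p) * (v.coord (q 0) w * v.coord (q 1) x)) -
      (-1 : ℂ) ^ d * (v.coord (q 1) (evalVec v p) * (v.coord (q 0) w * v.coord (q 2) x)) := by
  rw [polar_apply, map_sum, ← sum_coord_mul v (evalVec v p) (v.coord (q 2)),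
    ← sum_coord_mul v (evalVec v p) (v.coord (q 1)), Finset.sum_mul, Finset.mul_sum,
    Finset.sum_mul, Finset.mul_sum, ← Finset.sum_sub_distrib]
  exact Finset.sum_congr rfl fun a _ => by rw [cellForm_t]; ring

theorem cellForm_cycTrace (p : Fin (d - 1) → Fin d) (q : Fin 3 → Fin d) (x y : W) :
    m.cellForm v p q (m.cycTrace v x y) =
      (-1 : ℂ) ^ d * (v.coord (q 0) (evalVec v p) *
        (v.coord (q 1) x * v.coord (q 2) y - v.coord (q 1) y * v.coord (q 2) x)) +
      (-1 : ℂ) ^ d * (v.coord (q 1) (evalVec v p) *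
        (v.coord (q 2) x * v.coord (q 0) y - v.coord (q 2) y * v.coord (q 0) x)) +
      (-1 : ℂ) ^ d * (v.coord (q 2) (evalVec v p) *
        (v.coord (q 0) x * v.coord (q 1) y - v.coord (q 0) y * v.coord (q 1) x)) := by
  rw [cycTrace_apply, map_sum, ← sum_coord_mul v (evalVec v p) (v.coord (q 0)),
    ← sum_coord_mul v (evalVec v p) (v.coord (q 1)),
    ← sum_coord_mul v (evalVec v p) (v.coord (q 2))]
  simp only [Finset.sum_mul, Finset.mul_sum, ← Finset.sum_add_distrib]
  refine Finset.sum_congr rfl fun a _ => ?_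
  rw [cyc_apply, map_add, map_add, cellForm_t, cellForm_t, cellForm_t]
  ring

theorem rep_firstColumn (hd : 0 < d) (g : GLW W) (y : Fin (d - 1) → W) (w x z : W) :
    m.rep g (m.t (firstColumn v y) w x z) = m.t (firstColumn v fun i => stdRep W g (y i))
      (stdRep W g w) (stdRep W g x) (stdRep W g z) := by
  rw [m.rep_t, firstColumn_rep v hd, map_smul]
  rfl

theorem rep_firstColumn_cyc (hd : 0 < d) (g : GLW W) (y : Fin (d - 1) → W) (w x z : W) :
    m.rep g (m.cyc (firstColumn v y) w x z) = m.cyc (firstColumn v fun i => stdRep W g (y i))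
      (stdRep W g w) (stdRep W g x) (stdRep W g z) := by
  rw [m.rep_cyc, firstColumn_rep v hd, map_smul]
  rfl

/-- The span of the elements `t(α; w, w, x)` with `α(w) = α(x) = 0` is the Schur functor of
`(3, 2, 1, …, 1, 0)`. -/
theorem primitive_schur (hd : 3 ≤ d) :
    Nonempty ((orbit m.rep (m.t (v.coord ⟨d - 1, by omega⟩) (v ⟨0, by omega⟩) (v ⟨0, by omega⟩)
      (v ⟨1, by omega⟩))).toRepresentation.Equiv (schurRep W (shape321 d))) ∧
      m.primitive ⊓ (m.polarSub v ⊔ (m.traceSub v ⊔ m.cycSub)) = ⊥ := by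
  have hprim := m.primitive_eq_orbit v (a := ⟨d - 1, by omega⟩) (j := ⟨0, by omega⟩)
    (k := ⟨1, by omega⟩) (by simp; omega) (by simp; omega) (by simp)
  rw [hprim]
  refine (columns321 hd).orbit_equiv_schur v (firstColumn v) (triMultiFamily m.t) (M := ⊤)
    (L := m.cellForm v) ?_ ?_ ?_ ?_ ?_ ?_ ?_
  · intro g y z
    exact m.rep_firstColumn v (by omega) g y _ _ _
  · intro p q y z
    rw [triMultiFamily_apply, cellForm_t, firstColumn_evalVec v (by omega), Columns.extraDet,
      Matrix.det_fin_three]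
    -- The signs in `cellForm` and in `firstColumn` cancel.
    have : ((-1 : ℂ) ^ d) * (-1) ^ d = 1 := by rw [← mul_pow]; simp
    simp [columns321]
    linear_combination ((Matrix.of fun i j => (v.repr (y j)) (p i)).det * ((v.repr (z 0)) (q 0) *
      ((v.repr (z 1)) (q 1) * (v.repr (z 2)) (q 2) -
        (v.repr (z 2)) (q 1) * (v.repr (z 1)) (q 2)))) * this
  · intro x hx f
    suffices h : m.polarSub v ⊔ (m.traceSub v ⊔ m.cycSub) ≤ LinearMap.ker
        (∑ σ ∈ rowPerms (shape321 d), m.cellForm v (fun i => f (σ ((columns321 hd).equiv (.inl i))))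
          (fun l => f (σ ((columns321 hd).equiv (.inr l))))) by
      simpa using h hx
    refine sup_le (Submodule.span_le.2 ?_) (sup_le (Submodule.span_le.2 ?_)
      (Submodule.span_le.2 ?_))
    · rintro _ ⟨w, rfl⟩
      rw [SetLike.mem_coe, LinearMap.mem_ker, LinearMap.sum_apply]
      simp only [cellForm_polar, Finset.sum_sub_distrib]
      -- The first term evaluates at the label of the cell `(1, 1)`, the second at that of `(0, 1)`;
      -- each is exchanged with the first cell of its own row.
      rw [(columns321 hd).sum_row_inl_inr (i := ⟨1, by omega⟩) (l := 2) (F := fun p q =>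
          (-1 : ℂ) ^ d * (v.coord (q 2) (evalVec v p) * (v.coord (q 0) w * v.coord (q 1) w))) rfl,
        (columns321 hd).sum_row_inl_inr (i := ⟨0, by omega⟩) (l := 1) (F := fun p q =>
          (-1 : ℂ) ^ d * (v.coord (q 1) (evalVec v p) * (v.coord (q 0) w * v.coord (q 2) w))) rfl,
        sub_zero]
      · intro p q
        have := coord_evalVec_update v (by omega) p ⟨0, by omega⟩ (q 1)
        simp only [Function.update_self, this]
        simp
      · intro p q
        have := coord_evalVec_update v (by omega) p ⟨1, by omega⟩ (q 2)
        simp only [Function.update_self, this]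
        simp
    · rintro _ ⟨x, y, rfl⟩
      rw [SetLike.mem_coe, LinearMap.mem_ker, LinearMap.sum_apply]
      simp only [cellForm_trace]
      refine (columns321 hd).sum_row_inl_inr (i := ⟨0, by omega⟩) (l := 0) (F := fun p q =>
        (-1 : ℂ) ^ d * (v.coord (q 0) (evalVec v p) *
      (v.coord (q 1) x * v.coord (q 2) y - v.coord (q 1) y * v.coord (q 2) x))) rfl ?_ f
      intro p q
      have := coord_evalVec_update v (by omega) p ⟨0, by omega⟩ (q 0)
      simp only [Function.update_self, this]
      simp
    · rintro _ ⟨α, w, x, y, rfl⟩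
      rw [SetLike.mem_coe, LinearMap.mem_ker, LinearMap.sum_apply]
      simp only [cellForm_cyc]
      -- A cyclic sum alternates in all three extra labels, and two of these cells lie in the top
      -- row.
      refine (columns321 hd).sum_row_inr_inr (l := 0) (l' := 1) (F := fun p q =>
        (-1 : ℂ) ^ d * (α (evalVec v p) *
          (Matrix.of fun l l' => v.coord (q l) (![w, x, y] l')).det)) rfl (by decide) ?_ f
      intro p q
      have h2 : Equiv.swap (0 : Fin 3) 1 2 = 2 := rfl
      simp only [Matrix.det_fin_three, Matrix.of_apply, Function.comp_apply,
        Equiv.swap_apply_left, Equiv.swap_apply_right, h2]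
      ring
  · rw [triMultiFamily_apply, firstColumn_basis v (by omega)]
    rfl
  · exact fun _ _ => Submodule.mem_top
  · rw [← hprim, m.sup_eq_top v hd]
  · exact fun z _ hz => ⟨_, m.primitive_eigenvector v (by simp; omega) (by simp; omega)
      (by simp) hz⟩

/-- The span of the cyclic sums `cyc(α; w, x, y)` with `α(w) = α(x) = α(y) = 0` is the Schur functor
of `(2, 2, 2, 1, …, 1, 0)`. -/
theorem cycPrimitive_schur (hd : 4 ≤ d) :
    Nonempty ((orbit m.rep (m.cyc (v.coord ⟨d - 1, by omega⟩) (v ⟨0, by omega⟩) (v ⟨1, by omega⟩)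
      (v ⟨2, by omega⟩))).toRepresentation.Equiv (schurRep W (shape222 d))) := by
  have hprim := m.cycPrimitive_eq_orbit v (a := ⟨d - 1, by omega⟩) (j := ⟨0, by omega⟩)
    (i := ⟨1, by omega⟩) (k := ⟨2, by omega⟩) (by simp; omega) (by simp; omega) (by simp; omega)
    (by simp) (by simp) (by simp)
  refine ((columns222 hd).orbit_equiv_schur v (firstColumn v) (triMultiFamily m.cyc)
    (M := m.cycSub) (K := m.cycTraceSub v) (L := m.cellForm v) ?_ ?_ ?_ ?_ ?_ ?_ ?_).1
  · intro g y z
    exact m.rep_firstColumn_cyc v (by omega) g y _ _ _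
  · intro p q y z
    rw [triMultiFamily_apply, cellForm_cyc, firstColumn_evalVec v (by omega), Columns.extraDet,
      ← mul_assoc, ← mul_assoc, ← mul_pow, neg_one_mul, neg_neg, one_pow, one_mul]
    congr 2
    ext l l'
    fin_cases l <;> fin_cases l' <;> rfl
  · intro x hx f
    suffices h : m.cycTraceSub v ≤ LinearMap.ker
        (∑ σ ∈ rowPerms (shape222 d), m.cellForm v (fun i => f (σ ((columns222 hd).equiv (.inl i))))
          (fun l => f (σ ((columns222 hd).equiv (.inr l))))) by
      simpa using h hx
    refine Submodule.span_le.2 ?_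
    rintro _ ⟨x, y, rfl⟩
    rw [SetLike.mem_coe, LinearMap.mem_ker, LinearMap.sum_apply]
    simp only [cellForm_cycTrace, Finset.sum_add_distrib]
    rw [(columns222 hd).sum_row_inl_inr (i := ⟨0, by omega⟩) (l := 0) (F := fun p q =>
          (-1 : ℂ) ^ d * (v.coord (q 0) (evalVec v p) * (v.coord (q 1) x * v.coord (q 2) y -
            v.coord (q 1) y * v.coord (q 2) x))) rfl,
      (columns222 hd).sum_row_inl_inr (i := ⟨1, by omega⟩) (l := 1) (F := fun p q =>
          (-1 : ℂ) ^ d * (v.coord (q 1) (evalVec v p) * (v.coord (q 2) x * v.coord (q 0) y -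
            v.coord (q 2) y * v.coord (q 0) x))) rfl,
      (columns222 hd).sum_row_inl_inr (i := ⟨2, by omega⟩) (l := 2) (F := fun p q =>
          (-1 : ℂ) ^ d * (v.coord (q 2) (evalVec v p) * (v.coord (q 0) x * v.coord (q 1) y -
            v.coord (q 0) y * v.coord (q 1) x))) rfl, add_zero, add_zero]
    · intro p q
      have := coord_evalVec_update v (by omega) p ⟨2, by omega⟩ (q 2)
      simp only [Function.update_self, this]
      simp
    · intro p q
      have := coord_evalVec_update v (by omega) p ⟨1, by omega⟩ (q 1)
      simp only [Function.update_self, this]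
      simp
    · intro p q
      have := coord_evalVec_update v (by omega) p ⟨0, by omega⟩ (q 0)
      simp only [Function.update_self, this]
      simp
  · rw [triMultiFamily_apply, firstColumn_basis v (by omega)]
    rfl
  · exact fun y z => Submodule.subset_span ⟨_, _, _, _, rfl⟩
  · rw [← hprim]
    exact m.cycSub_le v (by omega)
  · exact fun z _ hz => ⟨_, m.cyc_eigenvector v (by simp; omega) (by simp; omega)
      (by simp; omega) (by simp) (by simp) (by simp) hz⟩

/-- The linear form on `T` that contracts the covector with the last vector. -/
def polarForm (j i : Fin d) : T →ₗ[ℂ] ℂ :=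
  ((d : ℂ) - 1)⁻¹ • ∑ a, m.coord v a j i a

/-- Of the `d` terms of the contraction the one with `a = i` cancels by alternation, which explains
the normalization by `d - 1`. -/
theorem polarForm_polar (hd : 3 ≤ d) (j i : Fin d) (w x : W) :
    m.polarForm v j i (m.polar v w x) = v.coord j w * v.coord i x := by
  have hd' : (d : ℂ) - 1 ≠ 0 := by
    rw [sub_ne_zero]
    exact_mod_cast (by omega : d ≠ 1)
  rw [polarForm, LinearMap.smul_apply, LinearMap.sum_apply, smul_eq_mul, inv_mul_eq_iff_eq_mul₀ hd',
    polar_apply]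
  have h : ∀ a, m.coord v a j i a (∑ b, m.t (v.coord b) w x (v b)) =
      v.coord j w * v.coord i x - if a = i then v.coord j w * v.coord i x else 0 := fun a => by
    rw [map_sum, Finset.sum_eq_single a]
    · simp only [coord_t, coord_basis, if_true]
      rcases eq_or_ne a i with rfl | h
      · simp
      · simp [h, h.symm]
    · intro b _ hb
      simp [coord_t, hb]
    · simp
  simp only [h, Finset.sum_sub_distrib]
  simp
  ring

theorem rep_biMultiFamily {f : W →ₗ[ℂ] W →ₗ[ℂ] T} {τ : Representation ℂ (GLW W) T}
    (hrep : ∀ g x y, τ g (f x y) =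
      LinearMap.det (stdRep W g) • f (stdRep W g x) (stdRep W g y))
    (g : GLW W) (y : Fin d → W) (z : Fin 2 → W) :
    τ g (biMultiFamily f (v.det y) z) =
      biMultiFamily f (v.det fun i => stdRep W g (y i)) fun l => stdRep W g (z l) := by
  rw [biMultiFamily_apply, biMultiFamily_apply, map_smul, hrep, smul_smul, mul_comm]
  congr 1
  exact (v.det_comp (stdRep W g) y).symm

/-- The span of the elements `polar w w` is the Schur functor of `(3, 1, …, 1)`. -/
theorem polarSub_schur (hd : 3 ≤ d) :
    Nonempty ((orbit m.rep (m.polar v (v ⟨0, by omega⟩)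
      (v ⟨0, by omega⟩))).toRepresentation.Equiv (schurRep W (shape311 d))) := by
  refine ((columns311 hd).orbit_equiv_schur v v.det (biMultiFamily (m.polar v))
    (M := Submodule.span ℂ {z | ∃ x y, z = m.polar v x y})
    (K := Submodule.span ℂ {z | ∃ x y, z = m.polar v x y - m.polar v y x})
    (L := fun p q => (Matrix.of fun i j => v.coord (p i) (v j)).det • m.polarForm v (q 0) (q 1))
    ?_ ?_ ?_ ?_ ?_ ?_ ?_).1
  · exact rep_biMultiFamily v (m.rep_polar v)
  · intro p q y z
    rw [biMultiFamily_apply, LinearMap.smul_apply, map_smul, m.polarForm_polar v hd,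
      det_coord_eq_mul v p y, Columns.extraDet, Matrix.det_fin_two]
    simp [columns311, mul_assoc]
  · intro x hx f
    suffices h : Submodule.span ℂ {z | ∃ x y, z = m.polar v x y - m.polar v y x} ≤ LinearMap.ker
        (∑ σ ∈ rowPerms (shape311 d),
          (Matrix.of fun i j => v.coord (f (σ ((columns311 hd).equiv (.inl i)))) (v j)).det •
          m.polarForm v (f (σ ((columns311 hd).equiv (.inr 0))))
            (f (σ ((columns311 hd).equiv (.inr 1))))) by
      simpa using h hx
    refine Submodule.span_le.2 ?_
    rintro _ ⟨x, y, rfl⟩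
    rw [SetLike.mem_coe, LinearMap.mem_ker, LinearMap.sum_apply]
    simp only [LinearMap.smul_apply, map_sub, m.polarForm_polar v hd, smul_eq_mul]
    refine (columns311 hd).sum_row_inr_inr (l := 0) (l' := 1) (F := fun p q =>
        (Matrix.of fun i j => v.coord (p i) (v j)).det * (v.coord (q 0) x * v.coord (q 1) y) -
        (Matrix.of fun i j => v.coord (p i) (v j)).det * (v.coord (q 0) y * v.coord (q 1) x))
      rfl (by decide) ?_ f
    intro p q
    simp only [Function.comp_apply, Equiv.swap_apply_left, Equiv.swap_apply_right]
    ring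
  · rw [biMultiFamily_apply]
    exact ((congrArg (· • _) v.det_self).trans (one_smul ℂ _)).symm
  · exact fun y z => Submodule.smul_mem _ _ (Submodule.subset_span ⟨_, _, rfl⟩)
  · rw [← m.polarSub_eq_orbit v]
    refine Submodule.span_le.2 ?_
    rintro _ ⟨x, y, rfl⟩
    -- The symmetric part is a polarization of the generators; the skew part lies in `K`, killed by
    -- the symmetrizer of the top row.
    have h : m.polar v x y = (2 : ℂ)⁻¹ • (m.polar v (x + y) (x + y) - m.polar v x x -
        m.polar v y y) + (2 : ℂ)⁻¹ • (m.polar v x y - m.polar v y x) := by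
      simp only [map_add, LinearMap.add_apply]
      module
    rw [h]
    refine Submodule.add_mem_sup (Submodule.smul_mem _ _ (Submodule.sub_mem _
      (Submodule.sub_mem _ ?_ ?_) ?_)) (Submodule.smul_mem _ _ ?_)
    · exact Submodule.subset_span ⟨_, rfl⟩
    · exact Submodule.subset_span ⟨_, rfl⟩
    · exact Submodule.subset_span ⟨_, rfl⟩
    · exact Submodule.subset_span ⟨_, _, rfl⟩
  · exact fun z _ hz => ⟨_, m.polar_eigenvector v (b := ⟨1, by omega⟩) (by simp) hz⟩

/-! ### Alternating bilinear maps and the type `(2, 2, 1, …, 1)` -/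

section Alternating

variable {f : W →ₗ[ℂ] W →ₗ[ℂ] T} {Θ : Fin d → Fin d → T →ₗ[ℂ] ℂ}

theorem two_smul_of_mem_span
    (hΘ : ∀ i k x y, Θ i k (f x y) = v.coord i x * v.coord k y - v.coord i y * v.coord k x)
    (hf : ∀ x y, f y x = -f x y) {z : T} (hz : z ∈ Submodule.span ℂ {z | ∃ x y, z = f x y}) :
    (2 : ℂ) • z = ∑ i, ∑ k, Θ i k z • f (v i) (v k) := by
  have : Submodule.span ℂ {z | ∃ x y, z = f x y} ≤ LinearMap.eqLocus ((2 : ℂ) • LinearMap.id)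
      (∑ i, ∑ k, (Θ i k).smulRight (f (v i) (v k))) := by
    refine Submodule.span_le.2 ?_
    rintro _ ⟨x, y, rfl⟩
    have h : ∀ x y, f x y = ∑ i, ∑ k, (v.coord i x * v.coord k y) • f (v i) (v k) := fun x y => by
      conv_lhs => rw [← v.sum_repr x, ← v.sum_repr y]
      simp only [map_sum, LinearMap.sum_apply, map_smul, LinearMap.smul_apply, Finset.smul_sum,
        smul_smul]
      rw [Finset.sum_comm]
      exact Finset.sum_congr rfl fun i _ => Finset.sum_congr rfl fun k _ => by
        rw [mul_comm]; rfl
    change (2 : ℂ) • f x y = _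
    simp only [LinearMap.sum_apply, LinearMap.smulRight_apply, hΘ, sub_smul,
      Finset.sum_sub_distrib]
    rw [← h, show ∑ i, ∑ k, (v.coord i y * v.coord k x) • f (v i) (v k) = f y x from (h y x).symm,
      hf x y, two_smul, sub_neg_eq_add]
  simpa using this hz

/-- On the span the forms `Θ` are skew coordinates, and their weights determine the pair of indices
up to order. Restricting to the span matters, since `T` contains two such families. -/
theorem span_eigenvector
    (hΘ : ∀ i k x y, Θ i k (f x y) = v.coord i x * v.coord k y - v.coord i y * v.coord k x)
    (hf : ∀ x y, f y x = -f x y)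
    (hrep : ∀ g x y, m.rep g (f x y) =
      LinearMap.det (stdRep W g) • f (stdRep W g x) (stdRep W g y))
    {p r : Fin d} (hpr : p ≠ r) {z : T} (hz : z ∈ Submodule.span ℂ {z | ∃ x y, z = f x y})
    (hs : StabLike m.rep (f (v p) (v r)) z) : z = Θ p r z • f (v p) (v r) := by
  rw [← sub_eq_zero]
  have hs' := hs.sub_smul (StabLike.refl _ _) (Θ p r z)
  have hz' : z - Θ p r z • f (v p) (v r) ∈ Submodule.span ℂ {z | ∃ x y, z = f x y} :=
    Submodule.sub_mem _ hz (Submodule.smul_mem _ _ (Submodule.subset_span ⟨_, _, rfl⟩))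
  have h0 : Θ p r (z - Θ p r z • f (v p) (v r)) = 0 := by
    simp [hΘ, hpr, hpr.symm]
  generalize z - Θ p r z • f (v p) (v r) = z' at *
  have hskew : ∀ i k, Θ k i z' = -Θ i k z' := fun i k => by
    have : Submodule.span ℂ {z | ∃ x y, z = f x y} ≤ LinearMap.eqLocus (Θ k i) (-Θ i k) := by
      refine Submodule.span_le.2 ?_
      rintro _ ⟨x, y, rfl⟩
      change Θ k i (f x y) = -Θ i k (f x y)
      rw [hΘ, hΘ]
      ring
    exact this hz'
  have hw : ∀ q i k, Θ i k (m.rep (dilation v q) z') = (LinearMap.det (stdRep W (dilation v q)) *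
      (2 : ℂ) ^ (dilWeight q i + dilWeight q k)) * Θ i k z' := fun q i k => by
    have : Submodule.span ℂ {z | ∃ x y, z = f x y} ≤ LinearMap.eqLocus
        (Θ i k ∘ₗ m.rep (dilation v q)) ((LinearMap.det (stdRep W (dilation v q)) *
      (2 : ℂ) ^ (dilWeight q i + dilWeight q k)) • Θ i k) := by
      refine Submodule.span_le.2 ?_
      rintro _ ⟨x, y, rfl⟩
      change Θ i k (m.rep _ (f x y)) = _ * Θ i k (f x y)
      have hc := fun i z => LinearMap.congr_fun (coord_comp_dilation v q i) z
      simp only [LinearMap.comp_apply, LinearMap.smul_apply, smul_eq_mul] at hc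
      rw [hrep, map_smul, hΘ, hΘ, hc, hc, hc, hc, zpow_add₀ two_ne_zero, smul_eq_mul]
      ring
    exact this hz'
  have h1 : ∀ i k, Θ i k z' = 0 := fun i k => by
    by_contra hne
    have hik : i ≠ k := by
      rintro rfl
      exact hne (self_eq_neg.1 (hskew i i))
    have key : ∀ q, dilWeight q i + dilWeight q k = dilWeight q p + dilWeight q r := fun q => by
      have h2 := hw q i k
      rw [hs' _ _ (m.rep_dilation_bilin v f hrep q p r), map_smul, smul_eq_mul] at h2
      have h3 := mul_left_cancel₀ (det_stdRep_ne_zero _) (mul_right_cancel₀ hne h2)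
      have h4 : (2 : ℝ) ^ (dilWeight q p + dilWeight q r) =
          (2 : ℝ) ^ (dilWeight q i + dilWeight q k) :=
        Complex.ofReal_injective (by push_cast; exact h3)
      exact (zpow_right_injective₀ two_pos (by norm_num) h4).symm
    have k1 := key p
    have k2 := key r
    simp only [dilWeight] at k1 k2
    have h5 : i = p ∧ k = r ∨ i = r ∧ k = p := by
      rw [if_neg hpr.symm] at k1
      rw [if_neg hpr] at k2
      split_ifs at k1 k2 <;> omega
    rcases h5 with ⟨rfl, rfl⟩ | ⟨rfl, rfl⟩
    · exact hne h0
    · exact hne (by rw [hskew, h0, neg_zero])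
  have h2 := two_smul_of_mem_span v hΘ hf hz'
  simpa [h1] using h2

/-- The span of the values of a nondegenerate alternating bilinear map that is equivariant up to
the determinant is the Schur functor of `(2, 2, 1, …, 1)`. -/
theorem span_schur (hd : 3 ≤ d)
    (hΘ : ∀ i k x y, Θ i k (f x y) = v.coord i x * v.coord k y - v.coord i y * v.coord k x)
    (hf : ∀ x y, f y x = -f x y)
    (hrep : ∀ g x y, m.rep g (f x y) =
      LinearMap.det (stdRep W g) • f (stdRep W g x) (stdRep W g y)) :
    Nonempty ((orbit m.rep (f (v ⟨0, by omega⟩) (v ⟨1, by omega⟩))).toRepresentation.Equiv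
      (schurRep W (shape221 d))) := by
  refine ((columns221 hd).orbit_equiv_schur v v.det (biMultiFamily f) (K := ⊥)
    (M := Submodule.span ℂ {z | ∃ x y, z = f x y})
    (L := fun p q => (Matrix.of fun i j => v.coord (p i) (v j)).det • Θ (q 0) (q 1))
    ?_ ?_ ?_ ?_ ?_ ?_ ?_).1
  · exact rep_biMultiFamily v hrep
  · intro p q y z
    rw [biMultiFamily_apply, LinearMap.smul_apply, map_smul, hΘ,
      det_coord_eq_mul v p y, Columns.extraDet, Matrix.det_fin_two]
    simp [columns221, mul_assoc]
  · intro x hx f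
    rw [(Submodule.mem_bot ℂ).1 hx]
    simp
  · rw [biMultiFamily_apply]
    exact ((congrArg (· • _) v.det_self).trans (one_smul ℂ _)).symm
  · exact fun y z => Submodule.smul_mem _ _ (Submodule.subset_span ⟨_, _, rfl⟩)
  · rw [← m.span_eq_orbit v f (fun w => eq_zero_of_eq_neg' (hf w w)) hrep (by simp), sup_bot_eq]
  · exact fun z hz hs => ⟨_, m.span_eigenvector v hΘ hf hrep (by simp) hz hs⟩

end Alternating

/-- The linear form on `T` that contracts the covector with the first vector. -/
def traceForm (i k : Fin d) : T →ₗ[ℂ] ℂ := ∑ a, m.coord v a a i k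

theorem traceForm_t (i k : Fin d) (α : Dual ℂ W) (w x y : W) :
    m.traceForm v i k (m.t α w x y) =
      α w * (v.coord i x * v.coord k y - v.coord i y * v.coord k x) := by
  simp only [traceForm, LinearMap.sum_apply, coord_t]
  rw [← sum_coord_mul v w α, Finset.sum_mul]
  exact Finset.sum_congr rfl fun a _ => by ring

theorem traceForm_trace (i k : Fin d) (x y : W) :
    m.traceForm v i k (m.trace v x y) =
      d * (v.coord i x * v.coord k y - v.coord i y * v.coord k x) := by
  simp [trace_apply, traceForm_t]
  ring

/-- The unrotated term contributes `d` and each of the two rotations contributes `-1`. -/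
theorem traceForm_cycTrace (i k : Fin d) (x y : W) :
    m.traceForm v i k (m.cycTrace v x y) =
      (d - 2) * (v.coord i x * v.coord k y - v.coord i y * v.coord k x) := by
  have h : ∀ a, m.traceForm v i k (m.cyc (v.coord a) (v a) x y) =
      (v.coord i x * v.coord k y - v.coord i y * v.coord k x) +
      (v.coord a x * v.coord k (v a) * v.coord i y - v.coord a x * v.coord i (v a) * v.coord k y) +
      (v.coord a y * v.coord i (v a) * v.coord k x -
        v.coord a y * v.coord k (v a) * v.coord i x) := fun a => by
    rw [cyc_apply, map_add, map_add, traceForm_t, traceForm_t, traceForm_t, coord_basis,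
      if_pos rfl]
    ring
  simp only [cycTrace_apply, map_sum, h, Finset.sum_add_distrib, Finset.sum_sub_distrib,
    ← Finset.sum_mul, sum_coord_mul, Finset.sum_const, Finset.card_univ, Fintype.card_fin,
    nsmul_eq_mul]
  ring

/-- The span of the elements `trace x y` is the Schur functor of `(2, 2, 1, …, 1)`. -/
theorem traceSub_schur (hd : 3 ≤ d) :
    Nonempty ((orbit m.rep (m.trace v (v ⟨0, by omega⟩)
      (v ⟨1, by omega⟩))).toRepresentation.Equiv (schurRep W (shape221 d))) := by
  have hd' : (d : ℂ) ≠ 0 := by exact_mod_cast (by omega : d ≠ 0)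
  refine m.span_schur v hd (Θ := fun i k => (d : ℂ)⁻¹ • m.traceForm v i k) ?_ (m.trace_swap v)
    (m.rep_trace v)
  intro i k x y
  rw [LinearMap.smul_apply, traceForm_trace, smul_eq_mul, inv_mul_cancel_left₀ hd']

/-- The span of the elements `cycTrace x y` is the Schur functor of `(2, 2, 1, …, 1)`. -/
theorem cycTraceSub_schur (hd : 3 ≤ d) :
    Nonempty ((orbit m.rep (m.cycTrace v (v ⟨0, by omega⟩)
      (v ⟨1, by omega⟩))).toRepresentation.Equiv (schurRep W (shape221 d))) := by
  have hd' : (d : ℂ) - 2 ≠ 0 := by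
    rw [sub_ne_zero]
    exact_mod_cast (by omega : d ≠ 2)
  refine m.span_schur v hd (Θ := fun i k => ((d : ℂ) - 2)⁻¹ • m.traceForm v i k) ?_
    (m.cycTrace_swap v) (m.rep_cycTrace v)
  intro i k x y
  rw [LinearMap.smul_apply, traceForm_cycTrace, smul_eq_mul, inv_mul_cancel_left₀ hd']

end TensModel

/-! ### Linear relations among the generators -/

section Generators

variable {d : ℕ}

/-- The coefficient of `x_a` in `P(x_k P(x_i x_j))`. -/
def iterMul (a i j k : Fin d) : R d :=
  (if a = k then p none i j else 0) + ∑ l, p (some l) i j * p (some a) k l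

theorem C_eq_iterMul (a j i k : Fin d) : C a j i k = iterMul a i j k - iterMul a k j i := by
  simp [C, projMul, projQuad, iterMul]

theorem iterMul_comm (a i j k : Fin d) : iterMul a i j k = iterMul a j i k := by
  simp only [iterMul, p_comm _ i j]

theorem C_swap (a j i k : Fin d) : C a j k i = -C a j i k := by
  rw [C_eq_iterMul, C_eq_iterMul, neg_sub]

/-- Each generator is a difference of coefficients of iterated products, symmetric in the inner two
factors; the six terms cancel in pairs. -/
theorem C_cyc (a j i k : Fin d) : C a j i k + C a i k j + C a k j i = 0 := by
  simp only [C_eq_iterMul, iterMul_comm a k j i, iterMul_comm a k i j, iterMul_comm a j i k]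
  ring

/-- The trace of a commutator: the quadratic parts agree after renaming indices, the linear parts by
the symmetry of `p_{0,ik}`. -/
theorem sum_C_diag (i k : Fin d) : ∑ a, C a a i k = 0 := by
  simp only [C_eq_iterMul, iterMul, Finset.sum_sub_distrib, Finset.sum_add_distrib]
  rw [Finset.sum_ite_eq', Finset.sum_ite_eq', if_pos (Finset.mem_univ _),
    if_pos (Finset.mem_univ _), p_comm none k i, sub_eq_zero]
  congr 1
  rw [Finset.sum_comm]
  refine Finset.sum_congr rfl fun l _ => Finset.sum_congr rfl fun a _ => ?_
  rw [mul_comm]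

/-- The point of the affine space with coordinate ring `R` given by a family of symmetric
matrices. -/
def evalAt (E : Option (Fin d) → Fin d → Fin d → ℂ) (hE : ∀ r s t, E r s t = E r t s) :
    R d →ₐ[ℂ] ℂ :=
  MvPolynomial.aeval fun q => Sym2.lift ⟨E q.1, hE q.1⟩ q.2

theorem evalAt_p (E : Option (Fin d) → Fin d → Fin d → ℂ) (hE : ∀ r s t, E r s t = E r t s)
    (r : Option (Fin d)) (s t : Fin d) : evalAt E hE (p r s t) = E r s t := by
  simp [evalAt, p]

end Generators

/-! ### The kernel of the map onto `Y` -/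

namespace TensModel

variable {d : ℕ} {W T : Type*} [AddCommGroup W] [Module ℂ W] [AddCommGroup T] [Module ℂ T]
  (m : TensModel W T) (v : Basis (Fin d) ℂ W)

/-- The linear map `T → R` that sends `t(v_a^*; v_j, v_i, v_k)` to `C(a; j, (i, k))`. -/
def toR : T →ₗ[ℂ] R d :=
  (2 : ℂ)⁻¹ • ∑ a, ∑ j, ∑ i, ∑ k, (m.coord v a j i k).smulRight (C a j i k)

/-- Summing over ordered pairs counts `(i, k)` and `(k, i)` with equal contributions, which the
factor `1/2` compensates. -/
theorem toR_t (a j i k : Fin d) : m.toR v (m.t (v.coord a) (v j) (v i) (v k)) = C a j i k := by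
  simp only [toR, LinearMap.smul_apply, LinearMap.sum_apply, LinearMap.smulRight_apply]
  rw [m.sum_coord_smul v C, C_swap a j i k, sub_neg_eq_add, ← two_smul ℂ, smul_smul,
    inv_mul_cancel₀ two_ne_zero, one_smul]

theorem coord_comp_stdRep_inv (g : GLW W) (a : Fin d) :
    v.coord a ∘ₗ stdRep W g⁻¹ = ∑ a', mat v g⁻¹ a a' • v.coord a' := by
  rw [dual_eq_sum v (v.coord a ∘ₗ stdRep W g⁻¹)]
  refine Finset.sum_congr rfl fun a' _ => ?_
  rw [mat, LinearMap.toMatrix_apply]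
  rfl

theorem stdRep_basis (g : GLW W) (j : Fin d) :
    stdRep W g (v j) = ∑ j', mat v g j' j • v j' := by
  conv_lhs => rw [← v.sum_repr (stdRep W g (v j))]
  refine Finset.sum_congr rfl fun a' _ => ?_
  rw [mat, LinearMap.toMatrix_apply]

/-- The determinant twist on `R` matches the factor from `⋀^{d-1} W`; what remains is the
transformation rule of the generators. -/
theorem toR_rep (g : GLW W) (z : T) : m.toR v (m.rep g z) = twistedRep v g (m.toR v z) := by
  have : m.toR v ∘ₗ m.rep g = twistedRep v g ∘ₗ m.toR v := by
    refine m.ext_basis v fun a j i k => ?_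
    rw [LinearMap.comp_apply, LinearMap.comp_apply, toR_t, m.rep_t, map_smul]
    change _ = LinearMap.det (stdRep W g) • actAlg v g (C a j i k)
    congr 1
    rw [actAlg_C, coord_comp_stdRep_inv, stdRep_basis, stdRep_basis, stdRep_basis]
    simp only [map_sum, map_smul, LinearMap.sum_apply, LinearMap.smul_apply, toR_t,
      Finset.smul_sum, smul_smul]
    refine Finset.sum_congr rfl fun k' _ => Finset.sum_congr rfl fun i' _ => ?_
    rw [Finset.sum_comm]
    refine Finset.sum_congr rfl fun a' _ => Finset.sum_congr rfl fun j' _ => ?_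
    congr 1
    ring
  exact LinearMap.congr_fun this z

theorem traceSub_le_ker : m.traceSub v ≤ LinearMap.ker (m.toR v) := by
  refine Submodule.span_le.2 ?_
  rintro _ ⟨x, y, rfl⟩
  rw [SetLike.mem_coe, LinearMap.mem_ker]
  have : (m.trace v).compr₂ (m.toR v) = 0 := by
    refine LinearMap.ext_basis v v fun i k => ?_
    simp only [LinearMap.compr₂_apply, trace_apply, map_sum, toR_t, sum_C_diag,
      LinearMap.zero_apply]
  exact LinearMap.congr_fun₂ this x y

theorem cycSub_le_ker : m.cycSub ≤ LinearMap.ker (m.toR v) := by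
  refine Submodule.span_le.2 ?_
  rintro _ ⟨α, w, x, y, rfl⟩
  rw [SetLike.mem_coe, LinearMap.mem_ker, dual_eq_sum v α, ← v.sum_repr w, ← v.sum_repr x,
    ← v.sum_repr y]
  simp only [map_sum, map_smul, LinearMap.sum_apply, LinearMap.smul_apply, cyc_apply, map_add,
    toR_t, C_cyc, smul_zero, Finset.sum_const_zero]

theorem toR_eq_sum (z : T) :
    m.toR v z = ∑ a, ∑ j, ∑ i, ∑ k, m.coord v a j i k z • iterMul a i j k := by
  have : m.toR v = ∑ a, ∑ j, ∑ i, ∑ k, (m.coord v a j i k).smulRight (iterMul a i j k) := by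
    refine m.ext_basis v fun a j i k => ?_
    simp only [LinearMap.sum_apply, LinearMap.smulRight_apply]
    rw [m.sum_coord_smul v (fun a j i k => iterMul a i j k), toR_t, C_eq_iterMul]
  rw [this]
  simp

/-- The symmetric part of the coordinates of an element of `T` in the first two vectors. -/
def symCoord (z : T) (a i j k : Fin d) : ℂ := m.coord v a j i k z + m.coord v a i j k z

/-- The symmetric matrix with entries `1` in the places `(i, j)` and `(j, i)`. -/
def _root_.HilbertSymmetric.symUnit (i j s t : Fin d) : ℂ :=
  (if s = i then 1 else 0) * (if t = j then 1 else 0) +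
    (if s = j then 1 else 0) * (if t = i then 1 else 0)

theorem _root_.HilbertSymmetric.symUnit_comm (i j s t : Fin d) :
    symUnit i j s t = symUnit i j t s := by
  simp only [symUnit]; ring

theorem _root_.HilbertSymmetric.sum_mul_symUnit (f : Fin d → Fin d → ℂ) (i j : Fin d) :
    ∑ j', ∑ i', f j' i' * symUnit i j i' j' = f j i + f i j := by
  simp [symUnit, mul_add, Finset.sum_add_distrib]

/-- Evaluation at a point where only the coordinates `p_0` are nonzero sees only the linear part. -/
theorem sum_symCoord_eq_zero {z : T} (hz : m.toR v z = 0) (i j : Fin d) :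
    ∑ a, m.symCoord v z a i j a = 0 := by
  let E : Option (Fin d) → Fin d → Fin d → ℂ := fun r s t =>
    if r = none then symUnit i j s t else 0
  have h := congrArg (evalAt E fun r s t => by simp only [E, symUnit_comm i j s t]) hz
  rw [toR_eq_sum, map_zero] at h
  simp only [map_sum, map_smul, iterMul, map_add, map_mul, apply_ite (evalAt E _), map_zero,
    evalAt_p, smul_eq_mul] at h
  rw [← h]
  refine Finset.sum_congr rfl fun a _ => ?_
  rw [symCoord, ← sum_mul_symUnit fun j i => m.coord v a j i a z]
  refine Finset.sum_congr rfl fun j' _ => Finset.sum_congr rfl fun i' _ => ?_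
  simp [E]

/-- The polarization of the quadratic part of `toR z`. -/
def quadForm (z : T) (E E' : Fin d → Fin d → Fin d → ℂ) : ℂ :=
  ∑ a, ∑ j, ∑ i, ∑ k, m.coord v a j i k z * ∑ l, E l i j * E' a k l

theorem quadForm_add (z : T) (E E' : Fin d → Fin d → Fin d → ℂ) :
    m.quadForm v z (E + E') (E + E') = m.quadForm v z E E + m.quadForm v z E E' +
      m.quadForm v z E' E + m.quadForm v z E' E' := by
  simp only [quadForm, ← Finset.sum_add_distrib, ← mul_add]
  refine Finset.sum_congr rfl fun a _ => Finset.sum_congr rfl fun j _ =>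
    Finset.sum_congr rfl fun i _ => Finset.sum_congr rfl fun k _ => ?_
  congr 1
  refine Finset.sum_congr rfl fun l _ => ?_
  simp only [Pi.add_apply]
  ring

/-- Evaluation at a point with all `p_0` equal to zero sees only the quadratic part. -/
theorem quadForm_self {z : T} (hz : m.toR v z = 0) {E : Fin d → Fin d → Fin d → ℂ}
    (hE : ∀ r s t, E r s t = E r t s) : m.quadForm v z E E = 0 := by
  let E' : Option (Fin d) → Fin d → Fin d → ℂ := fun r => r.elim 0 E
  have hE' : ∀ r s t, E' r s t = E' r t s := by
    rintro (_ | r) s t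
    · rfl
    · exact hE r s t
  have h := congrArg (evalAt E' hE') hz
  rw [toR_eq_sum, map_zero] at h
  simp only [map_sum, map_smul, iterMul, map_add, map_mul, apply_ite (evalAt E' _), map_zero,
    evalAt_p, smul_eq_mul] at h
  rw [← h, quadForm]
  simp [E']

theorem quadForm_symUnit (z : T) (a i j k l r : Fin d) :
    m.quadForm v z (fun b => if b = r then symUnit i j else 0)
      (fun b => if b = a then symUnit k l else 0) =
    (if l = r then m.symCoord v z a i j k else 0) +
      (if k = r then m.symCoord v z a i j l else 0) := by
  have h : ∀ a' j' i' k', m.coord v a' j' i' k' z * ∑ l',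
      (if l' = r then symUnit i j else 0 : Fin d → Fin d → ℂ) i' j' *
        (if a' = a then symUnit k l else 0 : Fin d → Fin d → ℂ) k' l' =
      if a' = a then m.coord v a j' i' k' z * symUnit k l k' r * symUnit i j i' j' else 0 := by
    intro a' j' i' k'
    rw [Finset.sum_eq_single r (fun b _ hb => by simp [hb]) (by simp)]
    rw [if_pos rfl]
    split_ifs with h1
    · subst h1; ring
    · simp
  simp only [quadForm, h]
  rw [Finset.sum_eq_single a (fun b _ hb => by simp [hb]) (by simp)]
  simp only [if_true]
  have h2 : ∀ k', ∑ j', ∑ i', m.coord v a j' i' k' z * symUnit k l k' r * symUnit i j i' j' =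
      m.symCoord v z a i j k' * symUnit k l k' r := fun k' => by
    rw [sum_mul_symUnit fun j' i' => m.coord v a j' i' k' z * symUnit k l k' r, symCoord]
    ring
  have h3 : ∑ j', ∑ i', ∑ k', m.coord v a j' i' k' z * symUnit k l k' r * symUnit i j i' j' =
      ∑ k', m.symCoord v z a i j k' * symUnit k l k' r := by
    simp only [← h2]
    rw [Finset.sum_comm (s := Finset.univ (α := Fin d)) (f := fun k' j' => ∑ i',
      m.coord v a j' i' k' z * symUnit k l k' r * symUnit i j i' j')]
    exact Finset.sum_congr rfl fun j' _ => Finset.sum_comm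
  rw [h3]
  simp [symUnit, mul_add, Finset.sum_add_distrib, eq_comm]

/-- The quadratic part vanishes at two elementary points and at their sum, so the two mixed terms of
the polarization add up to zero. -/
theorem symCoord_relation {z : T} (hz : m.toR v z = 0) (a i j k l r : Fin d) :
    (if l = r then m.symCoord v z a i j k else 0) + (if k = r then m.symCoord v z a i j l else 0) +
      ((if j = a then m.symCoord v z r k l i else 0) +
        (if i = a then m.symCoord v z r k l j else 0)) = 0 := by
  have hsym : ∀ (a i j : Fin d) (b s t : Fin d),
      (fun b => if b = a then symUnit i j else 0 : Fin d → Fin d → Fin d → ℂ) b s t =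
      (fun b => if b = a then symUnit i j else 0 : Fin d → Fin d → Fin d → ℂ) b t s := by
    intro a i j b s t
    change (if b = a then symUnit i j else 0 : Fin d → Fin d → ℂ) s t =
      (if b = a then symUnit i j else 0 : Fin d → Fin d → ℂ) t s
    split_ifs
    · exact symUnit_comm ..
    · rfl
  have h := m.quadForm_add v z (fun b => if b = r then symUnit i j else 0)
    (fun b => if b = a then symUnit k l else 0)
  have h0 := m.quadForm_self v hz (E := (fun b => if b = r then symUnit i j else 0) +
    fun b => if b = a then symUnit k l else 0) fun b s t =>
      congrArg₂ (· + ·) (hsym r i j b s t) (hsym a k l b s t)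
  rw [m.quadForm_self v hz (hsym r i j), m.quadForm_self v hz (hsym a k l), h0,
    quadForm_symUnit, quadForm_symUnit] at h
  linear_combination -h

/-- For `toR z = 0` the symmetrized coordinates are determined by a skew-symmetric matrix. -/
theorem exists_skew {z : T} (hz : m.toR v z = 0) : ∃ c : Fin d → Fin d → ℂ,
    (∀ i j, c j i = -c i j) ∧ ∀ a i j k, ((d : ℂ) + 1) * m.symCoord v z a i j k =
      -(if j = a then c k i else 0) - (if i = a then c k j else 0) := by
  let c : Fin d → Fin d → ℂ := fun k i => ∑ r, m.symCoord v z r k r i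
  have h : ∀ a i j k, ((d : ℂ) + 1) * m.symCoord v z a i j k =
      -(if j = a then c k i else 0) - (if i = a then c k j else 0) := fun a i j k => by
    -- Setting `l = r` and summing over `r`: the first term is counted `d` times and the second
    -- supplies one more copy, whence `d + 1`.
    have h := Finset.sum_eq_zero fun r (_ : r ∈ Finset.univ) =>
      m.symCoord_relation v hz a i j k r r
    simp only [if_true, Finset.sum_add_distrib, Finset.sum_const, Finset.card_univ,
      Fintype.card_fin, nsmul_eq_mul, Finset.sum_ite_eq, Finset.mem_univ] at h
    have h1 : ∑ r, (if j = a then m.symCoord v z r k r i else 0) = if j = a then c k i else 0 := by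
      split_ifs <;> simp [c]
    have h2 : ∑ r, (if i = a then m.symCoord v z r k r j else 0) = if i = a then c k j else 0 := by
      split_ifs <;> simp [c]
    rw [h1, h2] at h
    linear_combination h
  refine ⟨c, fun i j => ?_, h⟩
  -- Contracting with the relation from the linear part forces `c` to be skew.
  have h1 := Finset.sum_congr rfl fun a (_ : a ∈ Finset.univ) => h a i j a
  rw [← Finset.mul_sum, m.sum_symCoord_eq_zero v hz] at h1
  simp only [Finset.sum_sub_distrib, Finset.sum_neg_distrib, Finset.sum_ite_eq,
    Finset.mem_univ, if_true] at h1
  linear_combination h1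

theorem polar_sub_swap_mem (x y : W) :
    m.polar v x y - m.polar v y x ∈ m.traceSub v ⊔ m.cycSub := by
  have h : m.polar v x y - m.polar v y x =
      -m.trace v x y + ∑ a, m.cyc (v.coord a) x y (v a) := by
    rw [polar_apply, polar_apply, trace_apply, ← Finset.sum_sub_distrib, ← Finset.sum_neg_distrib,
      ← Finset.sum_add_distrib]
    refine Finset.sum_congr rfl fun a _ => ?_
    rw [cyc_apply, m.t_swap _ y x (v a)]
    abel
  rw [h]
  exact Submodule.add_mem_sup (Submodule.neg_mem _ (Submodule.subset_span ⟨_, _, rfl⟩))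
    (Submodule.sum_mem _ fun a _ => Submodule.subset_span ⟨_, _, _, _, rfl⟩)

theorem ker_toR_le : LinearMap.ker (m.toR v) ≤ m.traceSub v ⊔ m.cycSub := by
  intro z hz
  rw [LinearMap.mem_ker] at hz
  obtain ⟨c, hc, hy⟩ := m.exists_skew v hz
  set K := m.traceSub v ⊔ m.cycSub with hK
  suffices h : K.mkQ z = 0 by simpa using h
  let τ : Fin d → Fin d → Fin d → Fin d → T ⧸ K :=
    fun a j i k => K.mkQ (m.t (v.coord a) (v j) (v i) (v k))
  let x : Fin d → Fin d → Fin d → Fin d → ℂ := fun a j i k => m.coord v a j i k z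
  have hτ : ∀ a j i k, τ a j k i = -τ a j i k := fun a j i k => by
    simp only [τ]
    rw [m.t_swap, map_neg]
  have hx : ∀ a j i k, x a j k i = -x a j i k := fun a j i k => m.coord_swap v a j i k z
  have hcyc : ∀ a j i k, τ a j i k + τ a i k j + τ a k j i = 0 := fun a j i k => by
    simp only [τ]
    rw [← map_add, ← map_add, ← cyc_apply, Submodule.mkQ_apply, Submodule.Quotient.mk_eq_zero]
    exact Submodule.mem_sup_right (Submodule.subset_span ⟨_, _, _, _, rfl⟩)
  have htr : ∀ i k, ∑ a, τ a a i k = 0 := fun i k => by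
    simp only [τ]
    rw [← map_sum, ← trace_apply, Submodule.mkQ_apply, Submodule.Quotient.mk_eq_zero]
    exact Submodule.mem_sup_left (Submodule.subset_span ⟨_, _, rfl⟩)
  have hpol : ∀ j k, ∑ a, τ a j a k = ∑ a, τ a k a j := fun j k => by
    have h : ∀ j k, ∑ a, τ a j a k = -K.mkQ (m.polar v (v j) (v k)) := fun j k => by
      rw [polar_apply, map_sum, ← Finset.sum_neg_distrib]
      exact Finset.sum_congr rfl fun a _ => hτ a j k a
    rw [h, h, neg_inj, ← sub_eq_zero, ← map_sub, Submodule.mkQ_apply,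
      Submodule.Quotient.mk_eq_zero]
    exact m.polar_sub_swap_mem v _ _
  have h2 : (2 : ℂ) • K.mkQ z = ∑ a, ∑ j, ∑ i, ∑ k, x a j i k • τ a j i k := by
    rw [← map_smul, m.two_smul_eq_sum_coord v z]
    simp only [map_sum, map_smul, τ, x]
  -- Modulo cyclic sums the pairing with the first two vectors interchanged is half of the original
  -- one, so symmetrizing the coordinates multiplies the pairing by `3/2`.
  have h3 : ∀ a, (2 : ℂ) • ∑ j, ∑ i, ∑ k, m.symCoord v z a i j k • τ a j i k =
      (3 : ℂ) • ∑ j, ∑ i, ∑ k, x a j i k • τ a j i k := fun a => by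
    have e1 : ∑ j, ∑ i, ∑ k, x a i j k • τ a j i k = ∑ j, ∑ i, ∑ k, x a j i k • τ a i j k :=
      Finset.sum_comm
    have e2 : ∑ j, ∑ i, ∑ k, x a j i k • τ a i j k =
        -∑ j, ∑ i, ∑ k, x a j i k • τ a k j i := by
      rw [← Finset.sum_neg_distrib]
      refine Finset.sum_congr rfl fun j _ => ?_
      rw [Finset.sum_comm, ← Finset.sum_neg_distrib]
      refine Finset.sum_congr rfl fun i _ => ?_
      rw [← Finset.sum_neg_distrib]
      exact Finset.sum_congr rfl fun k _ => by rw [hx a j i k, neg_smul]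
    have e3 : ∑ j, ∑ i, ∑ k, x a j i k • τ a i j k - ∑ j, ∑ i, ∑ k, x a j i k • τ a k j i =
        ∑ j, ∑ i, ∑ k, x a j i k • τ a j i k := by
      simp only [← Finset.sum_sub_distrib]
      refine Finset.sum_congr rfl fun j _ => Finset.sum_congr rfl fun i _ =>
        Finset.sum_congr rfl fun k _ => ?_
      rw [← smul_sub, hτ a i k j, eq_neg_of_add_eq_zero_right (hcyc a j i k)]
      congr 1
      abel
    have e4 : ∑ j, ∑ i, ∑ k, m.symCoord v z a i j k • τ a j i k =
        ∑ j, ∑ i, ∑ k, x a j i k • τ a j i k + ∑ j, ∑ i, ∑ k, x a i j k • τ a j i k := by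
      simp only [← Finset.sum_add_distrib, ← add_smul, symCoord, x]
    rw [e4, e1]
    linear_combination (norm := module) e3 + e2
  -- One part of the formula for the symmetrized coordinates pairs with traces; the other pairs the
  -- skew matrix `c` with contractions symmetric modulo `K`.
  have h4 : ((d : ℂ) + 1) • ∑ a, ∑ j, ∑ i, ∑ k, m.symCoord v z a i j k • τ a j i k = 0 := by
    have e1 : ∑ a, ∑ j, ∑ i, ∑ k, (if j = a then c k i else 0) • τ a j i k = 0 := by
      have : ∀ a, ∑ j, ∑ i, ∑ k, (if j = a then c k i else 0) • τ a j i k =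
          ∑ i, ∑ k, c k i • τ a a i k := fun a => by
        rw [Finset.sum_eq_single a (fun b _ hb => by simp [hb]) (by simp)]
        simp
      simp only [this]
      rw [Finset.sum_comm]
      refine Finset.sum_eq_zero fun i _ => ?_
      rw [Finset.sum_comm]
      refine Finset.sum_eq_zero fun k _ => ?_
      rw [← Finset.smul_sum, htr, smul_zero]
    have e2 : ∑ a, ∑ j, ∑ i, ∑ k, (if i = a then c k j else 0) • τ a j i k = 0 := by
      have h5 : ∑ a, ∑ j, ∑ i, ∑ k, (if i = a then c k j else 0) • τ a j i k =
          ∑ j, ∑ k, c k j • ∑ a, τ a j a k := by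
        rw [Finset.sum_comm]
        refine Finset.sum_congr rfl fun j _ => ?_
        simp only [Finset.smul_sum]
        rw [Finset.sum_comm (f := fun k a => c k j • τ a j a k)]
        refine Finset.sum_congr rfl fun a _ => ?_
        rw [Finset.sum_eq_single a (fun b _ hb => by simp [hb]) (by simp)]
        simp
      rw [h5]
      refine eq_zero_of_eq_neg' ?_
      conv_lhs => rw [Finset.sum_comm]
      simp only [← Finset.sum_neg_distrib]
      refine Finset.sum_congr rfl fun j _ => Finset.sum_congr rfl fun k _ => ?_
      rw [hc k j, hpol k j, neg_smul]
    simp only [Finset.smul_sum, smul_smul, hy, sub_smul, neg_smul, Finset.sum_sub_distrib,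
      Finset.sum_neg_distrib, e1, e2, neg_zero, sub_zero]
  have hd : (d : ℂ) + 1 ≠ 0 := by exact_mod_cast Nat.succ_ne_zero d
  have h5 := (smul_eq_zero.1 h4).resolve_left hd
  have h6 : (2 : ℂ) • ∑ a, ∑ j, ∑ i, ∑ k, m.symCoord v z a i j k • τ a j i k =
      (3 : ℂ) • ∑ a, ∑ j, ∑ i, ∑ k, x a j i k • τ a j i k := by
    rw [Finset.smul_sum, Finset.smul_sum]
    exact Finset.sum_congr rfl fun a _ => h3 a
  rw [h5, smul_zero, ← h2, smul_smul] at h6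
  exact (smul_eq_zero.1 h6.symm).resolve_left (by norm_num)

theorem ker_toR : LinearMap.ker (m.toR v) = m.traceSub v ⊔ m.cycSub :=
  le_antisymm (m.ker_toR_le v) (sup_le (m.traceSub_le_ker v) (m.cycSub_le_ker v))

/-- The polar elements are independent of the traces and the cyclic sums. -/
theorem polarSub_inf (hd : 3 ≤ d) : m.polarSub v ⊓ (m.traceSub v ⊔ m.cycSub) = ⊥ := by
  -- These symmetrized forms kill traces, whose contractions are skew, and cyclic sums, yet they
  -- recover every element of `polarSub`.
  let S : Fin d → Fin d → T →ₗ[ℂ] ℂ := fun j i => m.polarForm v j i + m.polarForm v i j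
  have hK : ∀ j i, m.traceSub v ⊔ m.cycSub ≤ LinearMap.ker (S j i) := fun j i => by
    refine sup_le (Submodule.span_le.2 ?_) (Submodule.span_le.2 ?_)
    · rintro _ ⟨x, y, rfl⟩
      have h : ∀ j i, ∑ a, m.coord v a j i a (m.trace v x y) =
          v.coord i x * v.coord j y - v.coord i y * v.coord j x := fun j i => by
        have : ∀ a, m.coord v a j i a (m.trace v x y) = if j = a then
            v.coord i x * v.coord a y - v.coord i y * v.coord a x else 0 := fun a => by
          rw [trace_apply, map_sum, Finset.sum_eq_single a]
          · simp only [coord_t, coord_basis]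
            split_ifs <;> simp
          · intro b _ hb
            simp [coord_t, hb]
          · simp
        simp only [this]
        simp
      rw [SetLike.mem_coe, LinearMap.mem_ker]
      simp only [S, polarForm, LinearMap.add_apply, LinearMap.smul_apply, LinearMap.sum_apply, h,
        smul_eq_mul]
      ring
    · rintro _ ⟨α, w, x, y, rfl⟩
      rw [SetLike.mem_coe, LinearMap.mem_ker]
      simp only [S, polarForm, LinearMap.add_apply, LinearMap.smul_apply, LinearMap.sum_apply]
      rw [← smul_add, ← Finset.sum_add_distrib, Finset.sum_eq_zero, smul_zero]
      intro a _
      simp only [cyc_apply, map_add, coord_t]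
      ring
  have hB : m.polarSub v ≤ LinearMap.eqLocus ((2 : ℂ) • LinearMap.id)
      (∑ j, ∑ i, (S j i).smulRight (m.polar v (v j) (v i))) := by
    refine Submodule.span_le.2 ?_
    rintro _ ⟨w, rfl⟩
    change (2 : ℂ) • m.polar v w w = _
    conv_lhs => rw [← v.sum_repr w]
    simp only [map_sum, map_smul, LinearMap.sum_apply, LinearMap.smul_apply, Finset.smul_sum,
      smul_smul, LinearMap.smulRight_apply, S, LinearMap.add_apply, m.polarForm_polar v hd]
    rw [Finset.sum_comm]
    refine Finset.sum_congr rfl fun j _ => Finset.sum_congr rfl fun i _ => ?_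
    congr 1
    simp only [Basis.coord_apply]
    ring
  rw [eq_bot_iff]
  rintro z ⟨hzB, hzK⟩
  have h := hB hzB
  have h0 : ∀ j i, S j i z = 0 := fun j i => hK j i hzK
  change (2 : ℂ) • z = _ at h
  simpa [h0] using h

end TensModel

/-! ### Isotypic components of cyclic type -/

section Isotypic

variable {G V U : Type*} [Group G] [AddCommGroup V] [Module ℂ V] [AddCommGroup U] [Module ℂ U]
  {ρ : Representation ℂ G V} {σ : Representation ℂ G U} {u : V}

theorem le_isotypic {N : Subrepresentation ρ} (h : Nonempty (N.toRepresentation.Equiv σ)) :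
    N.toSubmodule ≤ isotypic ρ σ :=
  le_iSup₂ (f := fun (N : Subrepresentation ρ) (_ : Nonempty (N.toRepresentation.Equiv σ)) =>
    N.toSubmodule) N h

/-- The isotypic component of the type of a cyclic representation is controlled by the vectors that
behave like a generator. -/
theorem isotypic_le (hu : Nonempty ((orbit ρ u).toRepresentation.Equiv σ)) {M : Submodule ℂ V}
    (hM : ∀ g, ∀ z ∈ M, ρ g z ∈ M) (hs : ∀ z, StabLike ρ u z → z ∈ M) : isotypic ρ σ ≤ M := by
  refine iSup₂_le fun N hN => ?_
  obtain ⟨e₁⟩ := hu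
  obtain ⟨e₂⟩ := hN
  let f := e₁.trans e₂.symm
  let F : (orbit ρ u).toSubmodule →ₗ[ℂ] V := N.toSubmodule.subtype ∘ₗ f.toLinearMap
  have hF : ∀ (g : G) (y : (orbit ρ u).toSubmodule),
      F ((orbit ρ u).toRepresentation g y) = ρ g (F y) := fun g y =>
    congrArg Subtype.val
      (Representation.IntertwiningMap.isIntertwining _ _ f.toIntertwiningMap g y)
  let y₀ : (orbit ρ u).toSubmodule := ⟨u, mem_orbit_self ρ u⟩
  -- An intertwining map preserves the eigenvector relations of the generator; equivariance then
  -- carries the whole image into `M`.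
  have h0 : F y₀ ∈ M := hs _ fun g c hg => by
    rw [← hF, ← map_smul]
    exact congrArg F (Subtype.ext hg)
  intro n hn
  obtain ⟨y, hy⟩ := f.toLinearEquiv.surjective ⟨n, hn⟩
  have hn' : n = F y := congrArg Subtype.val hy.symm
  rw [hn']
  have h1 : Submodule.map (orbit ρ u).toSubmodule.subtype (M.comap F) =
      (orbit ρ u).toSubmodule := by
    refine le_antisymm (Submodule.map_subtype_le _ _) (orbit_le _ fun g => ?_)
    refine ⟨(orbit ρ u).toRepresentation g y₀, ?_, rfl⟩
    rw [SetLike.mem_coe, Submodule.mem_comap, hF]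
    exact hM g _ h0
  obtain ⟨y', hy', h2⟩ := h1.ge y.2
  rw [← Subtype.ext h2]
  exact hy'

theorem isotypic_eq_orbit (hu : Nonempty ((orbit ρ u).toRepresentation.Equiv σ))
    (hs : ∀ z, StabLike ρ u z → ∃ c : ℂ, z = c • u) :
    isotypic ρ σ = (orbit ρ u).toSubmodule := by
  refine le_antisymm (isotypic_le hu (fun g z hz => (orbit ρ u).apply_mem_toSubmodule g hz) ?_)
    (le_isotypic hu)
  intro z hz
  obtain ⟨c, rfl⟩ := hs z hz
  exact Submodule.smul_mem _ _ (mem_orbit_self ρ u)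

end Isotypic

/-! ### Equivariant sections -/

section Splitting

variable {G T Y A B : Type*} [Group G] [AddCommGroup T] [Module ℂ T] [AddCommGroup Y] [Module ℂ Y]
  [AddCommGroup A] [Module ℂ A] [AddCommGroup B] [Module ℂ B]
  {τ : Representation ℂ G T} {η : Representation ℂ G Y} {α : Representation ℂ G A}
  {β : Representation ℂ G B} {Q : T →ₗ[ℂ] Y} {u w : T}

/-- A surjective equivariant map whose kernel is complementary to the sum of two independent cyclic
subrepresentations has a unique equivariant section. -/
theorem exists_unique_section (hQ : Function.Surjective Q) (hQg : ∀ g z, Q (τ g z) = η g (Q z))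
    (hu : Nonempty ((orbit τ u).toRepresentation.Equiv α))
    (hw : Nonempty ((orbit τ w).toRepresentation.Equiv β))
    (hus : ∀ z, StabLike τ u z → ∃ c : ℂ, z = c • u)
    (hws : ∀ z, StabLike τ w z → ∃ c : ℂ, z = c • w)
    (htop : (orbit τ u).toSubmodule ⊔ ((orbit τ w).toSubmodule ⊔ LinearMap.ker Q) = ⊤)
    (hu0 : (orbit τ u).toSubmodule ⊓ ((orbit τ w).toSubmodule ⊔ LinearMap.ker Q) = ⊥)
    (hw0 : (orbit τ w).toSubmodule ⊓ LinearMap.ker Q = ⊥) :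
    ∃ (φ : η.IntertwiningMap τ) (e : η.Equiv (α.prod β)),
      (∀ y, Q (φ y) = y) ∧ (∀ ψ : η.IntertwiningMap τ, (∀ y, Q (ψ y) = y) → ψ = φ) ∧
      Submodule.map φ.toLinearMap
          (Submodule.comap e.toLinearMap (LinearMap.range (LinearMap.inl ℂ A B))) =
        (orbit τ u).toSubmodule ∧
      Submodule.map φ.toLinearMap
          (Submodule.comap e.toLinearMap (LinearMap.range (LinearMap.inr ℂ A B))) =
        (orbit τ w).toSubmodule ∧
      IsCompl (LinearMap.range φ.toLinearMap) (LinearMap.ker Q) := by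
  obtain ⟨eu⟩ := hu
  obtain ⟨ew⟩ := hw
  set M := (orbit τ u).toSubmodule with hM
  set N := (orbit τ w).toSubmodule with hN
  have indep : ∀ a ∈ M, ∀ b ∈ N, a + b ∈ LinearMap.ker Q → a = 0 ∧ b = 0 := by
    intro a ha b hb hab
    have h1 : a ∈ M ⊓ (N ⊔ LinearMap.ker Q) := ⟨ha, by
      have : a = -b + (a + b) := by abel
      rw [this]
      exact Submodule.add_mem_sup (Submodule.neg_mem _ hb) hab⟩
    rw [hu0, Submodule.mem_bot] at h1
    subst h1
    rw [zero_add] at hab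
    have h2 : b ∈ N ⊓ LinearMap.ker Q := ⟨hb, hab⟩
    rw [hw0, Submodule.mem_bot] at h2
    exact ⟨rfl, h2⟩
  let S : (M × N) →ₗ[ℂ] T := M.subtype.coprod N.subtype
  have hS : ∀ a b, S (a, b) = a + b := fun a b => rfl
  have hbij : Function.Bijective (Q ∘ₗ S) := by
    constructor
    · rw [← LinearMap.ker_eq_bot, LinearMap.ker_eq_bot']
      rintro ⟨a, b⟩ h
      obtain ⟨h1, h2⟩ := indep a a.2 b b.2 h
      exact Prod.ext (Subtype.ext h1) (Subtype.ext h2)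
    · intro y
      obtain ⟨z, rfl⟩ := hQ y
      have hz : z ∈ M ⊔ (N ⊔ LinearMap.ker Q) := by rw [htop]; exact Submodule.mem_top
      obtain ⟨a, ha, r, hr, rfl⟩ := Submodule.mem_sup.1 hz
      obtain ⟨b, hb, k, hk, rfl⟩ := Submodule.mem_sup.1 hr
      refine ⟨(⟨a, ha⟩, ⟨b, hb⟩), ?_⟩
      change Q (a + b) = Q (a + (b + k))
      rw [map_add, map_add, map_add, LinearMap.mem_ker.1 hk, add_zero]
  let F : (M × N) ≃ₗ[ℂ] Y := LinearEquiv.ofBijective (Q ∘ₗ S) hbij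
  have hF : ∀ x, F x = Q (S x) := fun x => rfl
  let ρ := (orbit τ u).toRepresentation.prod (orbit τ w).toRepresentation
  have hSg : ∀ g x, S (ρ g x) = τ g (S x) := fun g x => (map_add (τ g) _ _).symm
  have hFg : ∀ g x, F (ρ g x) = η g (F x) := fun g x => by rw [hF, hF, hSg, hQg]
  have hFs : ∀ g y, F.symm (η g y) = ρ g (F.symm y) := fun g y => by
    rw [LinearEquiv.symm_apply_eq, hFg, LinearEquiv.apply_symm_apply]
  let φ : η.IntertwiningMap τ := ⟨S ∘ₗ F.symm.toLinearMap, fun g => LinearMap.ext fun y => by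
    change S (F.symm (η g y)) = τ g (S (F.symm y))
    rw [hFs, hSg]⟩
  have hφ : ∀ x, φ (F x) = S x := fun x => congrArg S (F.symm_apply_apply x)
  let e : η.Equiv (α.prod β) := Representation.Equiv.mk
    (F.symm ≪≫ₗ LinearEquiv.prodCongr eu.toLinearEquiv ew.toLinearEquiv)
    fun g => LinearMap.ext fun y => by
      change (eu (F.symm (η g y)).1, ew (F.symm (η g y)).2) =
        (α g (eu (F.symm y).1), β g (ew (F.symm y).2))
      rw [hFs]
      exact Prod.ext (Representation.IntertwiningMap.isIntertwining _ _ eu.toIntertwiningMap g _)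
        (Representation.IntertwiningMap.isIntertwining _ _ ew.toIntertwiningMap g _)
  have he : ∀ x, e.toLinearMap (F x) = (eu x.1, ew x.2) := fun x =>
    congrArg (fun x : M × N => (eu x.1, ew x.2)) (F.symm_apply_apply x)
  have hQφ : ∀ y, Q (φ y) = y := fun y => F.apply_symm_apply y
  refine ⟨φ, e, hQφ, fun ψ hψ => ?_, ?_, ?_, ?_⟩
  · have hδ : ∀ y, ψ y - φ y ∈ LinearMap.ker Q := fun y => by
      rw [LinearMap.mem_ker, map_sub, hψ, hQφ, sub_self]
    -- Composing the difference of two sections with `Q` gives an equivariant endomorphism of `T`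
    -- with values in the kernel. It sends `u` and `w` to multiples of themselves, which must
    -- vanish.
    let D : T →ₗ[ℂ] T := (ψ.toLinearMap - φ.toLinearMap) ∘ₗ Q
    have hD : ∀ z, D z = ψ (Q z) - φ (Q z) := fun z => rfl
    have hDg : ∀ g z, D (τ g z) = τ g (D z) := fun g z => by
      rw [hD, hD, hQg, ψ.isIntertwining, φ.isIntertwining, map_sub]
    have hDorb : ∀ x : T, (orbit τ x).toSubmodule ⊓ LinearMap.ker Q = ⊥ →
        (∀ z, StabLike τ x z → ∃ c : ℂ, z = c • x) →
        (orbit τ x).toSubmodule ≤ LinearMap.ker D := fun x hx hxs => by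
      obtain ⟨c, hc⟩ := hxs (D x) fun g c hg => by rw [← hDg, hg, map_smul]
      have h0 : D x ∈ (orbit τ x).toSubmodule ⊓ LinearMap.ker Q :=
        ⟨hc ▸ Submodule.smul_mem _ _ (mem_orbit_self τ x), hδ _⟩
      rw [hx, Submodule.mem_bot] at h0
      refine orbit_le _ fun g => ?_
      rw [LinearMap.mem_ker, hDg, h0, map_zero]
    have hD0 : LinearMap.ker D = ⊤ := by
      rw [eq_top_iff, ← htop]
      refine sup_le (hDorb u ?_ hus) (sup_le (hDorb w hw0 hws) fun z hz => ?_)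
      · rw [eq_bot_iff, ← hu0]
        exact inf_le_inf_left _ le_sup_right
      · rw [LinearMap.mem_ker, hD, LinearMap.mem_ker.1 hz, map_zero, map_zero, sub_zero]
    refine Representation.IntertwiningMap.ext (LinearMap.ext fun y => ?_)
    obtain ⟨z, rfl⟩ := hQ y
    have : z ∈ LinearMap.ker D := by rw [hD0]; exact Submodule.mem_top
    exact sub_eq_zero.1 this
  · ext z
    constructor
    · rintro ⟨y, hy, rfl⟩
      obtain ⟨x, rfl⟩ := F.surjective y
      obtain ⟨s, hs⟩ := hy
      rw [he] at hs
      have h2 : x.2 = 0 := by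
        have := (congrArg Prod.snd hs).symm
        exact ew.toLinearEquiv.map_eq_zero_iff.1 this
      change φ (F x) ∈ M
      rw [hφ, ← Prod.mk.eta (p := x), hS, h2]
      simp
    · intro hz
      refine ⟨F (⟨z, hz⟩, 0), ⟨eu ⟨z, hz⟩, ?_⟩, ?_⟩
      · rw [he]
        exact Prod.ext rfl (map_zero ew.toLinearEquiv).symm
      · change φ (F _) = z
        rw [hφ, hS]
        simp
  · ext z
    constructor
    · rintro ⟨y, hy, rfl⟩
      obtain ⟨x, rfl⟩ := F.surjective y
      obtain ⟨s, hs⟩ := hy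
      rw [he] at hs
      have h2 : x.1 = 0 := by
        have := (congrArg Prod.fst hs).symm
        exact eu.toLinearEquiv.map_eq_zero_iff.1 this
      change φ (F x) ∈ N
      rw [hφ, ← Prod.mk.eta (p := x), hS, h2]
      simp
    · intro hz
      refine ⟨F (0, ⟨z, hz⟩), ⟨ew ⟨z, hz⟩, ?_⟩, ?_⟩
      · rw [he]
        exact Prod.ext (map_zero eu.toLinearEquiv).symm rfl
      · change φ (F _) = z
        rw [hφ, hS]
        simp
  · refine ⟨Submodule.disjoint_def.2 ?_, codisjoint_iff.2 (eq_top_iff.2 fun z _ => ?_)⟩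
    · rintro _ ⟨y, rfl⟩ h
      change Q (φ y) = 0 at h
      rw [hQφ] at h
      rw [h, map_zero]
    · have : z = φ (Q z) + (z - φ (Q z)) := by abel
      rw [this]
      refine Submodule.add_mem_sup ⟨Q z, rfl⟩ ?_
      rw [LinearMap.mem_ker, map_sub, hQφ, sub_self]

end Splitting

/-! ### The kernel as a sum of isotypic components -/

namespace TensModel

variable {d : ℕ} {W T : Type*} [AddCommGroup W] [Module ℂ W] [AddCommGroup T] [Module ℂ T]
  (m : TensModel W T) (v : Basis (Fin d) ℂ W)

/-- Vectors with the eigenvector relations of a trace are combinations of the two contractions;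
their sum need not be shown direct. -/
theorem isotypic_shape221 (hd : 3 ≤ d) (v : Basis (Fin d) ℂ W) :
    isotypic m.rep (schurRep W (shape221 d)) = m.traceSub v ⊔ m.cycTraceSub v := by
  have h01 : (⟨0, by omega⟩ : Fin d) ≠ ⟨1, by omega⟩ := by simp
  have htr : m.traceSub v = _ := m.span_eq_orbit v (m.trace v)
    (fun w => eq_zero_of_eq_neg' (m.trace_swap v w w)) (m.rep_trace v) h01
  have hcy : m.cycTraceSub v = _ := m.span_eq_orbit v (m.cycTrace v)
    (fun w => eq_zero_of_eq_neg' (m.cycTrace_swap v w w)) (m.rep_cycTrace v) h01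
  refine le_antisymm (isotypic_le (m.traceSub_schur v hd) ?_ ?_) (sup_le ?_ ?_)
  · rw [htr, hcy]
    exact fun g z hz => (orbit m.rep _ ⊔ orbit m.rep _).apply_mem_toSubmodule g hz
  · intro z hz
    rw [m.trace_eigenvector v h01 (s := ⟨2, by omega⟩) (by simp) (by simp) hz]
    exact Submodule.add_mem_sup (Submodule.smul_mem _ _ (Submodule.subset_span ⟨_, _, rfl⟩))
      (Submodule.smul_mem _ _ (Submodule.subset_span ⟨_, _, rfl⟩))
  · rw [htr]
    exact le_isotypic (m.traceSub_schur v hd)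
  · rw [hcy]
    exact le_isotypic (m.cycTraceSub_schur v hd)

theorem isotypic_shape222 (hd : 4 ≤ d) (v : Basis (Fin d) ℂ W) :
    isotypic m.rep (schurRep W (shape222 d)) = m.cycPrimitive := by
  rw [m.cycPrimitive_eq_orbit v (a := ⟨d - 1, by omega⟩) (j := ⟨0, by omega⟩)
    (i := ⟨1, by omega⟩) (k := ⟨2, by omega⟩) (by simp; omega) (by simp; omega) (by simp; omega)
    (by simp) (by simp) (by simp)]
  exact isotypic_eq_orbit (m.cycPrimitive_schur v hd) fun z hz => ⟨_, m.cyc_eigenvector v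
    (by simp; omega) (by simp; omega) (by simp; omega) (by simp) (by simp) (by simp) hz⟩

theorem cycSub_eq (hd : 3 ≤ d) : m.cycSub = m.cycPrimitive ⊔ m.cycTraceSub v := by
  refine le_antisymm (m.cycSub_le v hd) (sup_le (Submodule.span_mono ?_) (Submodule.span_le.2 ?_))
  · rintro _ ⟨α, w, x, y, -, -, -, rfl⟩
    exact ⟨α, w, x, y, rfl⟩
  · rintro _ ⟨x, y, rfl⟩
    rw [cycTrace_apply]
    exact Submodule.sum_mem _ fun a _ => Submodule.subset_span ⟨_, _, _, _, rfl⟩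

theorem isotypic_sup (hd : 3 ≤ d) :
    isotypic m.rep (schurRep W (shape221 d)) ⊔
      ⨆ _ : 4 ≤ d, isotypic m.rep (schurRep W (shape222 d)) = m.traceSub v ⊔ m.cycSub := by
  rw [m.isotypic_shape221 hd v, m.cycSub_eq v hd, sup_assoc, sup_comm m.cycPrimitive]
  by_cases h : 4 ≤ d
  · simp only [h, iSup_pos, m.isotypic_shape222 h v]
  · simp [h, m.cycPrimitive_eq_bot (by omega) v]

end TensModel

/-! ### The surjection onto `Y` -/

section ToY

variable {d : ℕ} {W : Type*} [AddCommGroup W] [Module ℂ W] (hd : 0 < d) (v : Basis (Fin d) ℂ W)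

theorem toR_mem_Y (z) : (ambientModel v hd).toR v z ∈ (Y v).toSubmodule := by
  rw [TensModel.toR]
  simp only [LinearMap.smul_apply, LinearMap.sum_apply, LinearMap.smulRight_apply]
  exact Submodule.smul_mem _ _ (Submodule.sum_mem _ fun a _ => Submodule.sum_mem _ fun j _ =>
    Submodule.sum_mem _ fun i _ => Submodule.sum_mem _ fun k _ =>
      Submodule.smul_mem _ _ (Submodule.subset_span ⟨a, j, i, k, rfl⟩))

/-- The surjection from `⋀^{d-1} W ⊗ W ⊗ ⋀² W` onto `Y`. -/
def toY : ⋀[ℂ]^(d - 1) W ⊗[ℂ] (W ⊗[ℂ] ⋀[ℂ]^2 W) →ₗ[ℂ] (Y v).toSubmodule :=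
  ((ambientModel v hd).toR v).codRestrict _ (toR_mem_Y hd v)

theorem toY_genT (a j i k : Fin d) : toY hd v (genT v a j i k) = genY v a j i k := by
  rw [genT_eq_tens]
  exact Subtype.ext ((ambientModel v hd).toR_t v a j i k)

theorem toY_rep (g : GLW W) (z) : toY hd v (ambientRep W d g z) = Yrep v g (toY hd v z) :=
  Subtype.ext ((ambientModel v hd).toR_rep v g z)

theorem ker_toY : LinearMap.ker (toY hd v) =
    (ambientModel v hd).traceSub v ⊔ (ambientModel v hd).cycSub :=
  (LinearMap.ker_codRestrict ..).trans ((ambientModel v hd).ker_toR v)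

theorem span_genY : Submodule.span ℂ {y | ∃ a j i k, y = genY v a j i k} = ⊤ := by
  refine Submodule.map_injective_of_injective (Y v).toSubmodule.injective_subtype ?_
  rw [Submodule.map_top, Submodule.range_subtype, Submodule.map_span]
  change _ = Submodule.span ℂ _
  congr 1
  ext f
  constructor
  · rintro ⟨_, ⟨a, j, i, k, rfl⟩, rfl⟩
    exact ⟨a, j, i, k, rfl⟩
  · rintro ⟨a, j, i, k, rfl⟩
    exact ⟨_, ⟨a, j, i, k, rfl⟩, rfl⟩

theorem toY_surjective : Function.Surjective (toY hd v) := by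
  rw [← LinearMap.range_eq_top, eq_top_iff, ← span_genY v, Submodule.span_le]
  rintro _ ⟨a, j, i, k, rfl⟩
  exact ⟨_, toY_genT hd v a j i k⟩

end ToY

end

end HilbertSymmetric

open HilbertSymmetric in
theorem mainTheorem6 (d : ℕ) (hd : 3 ≤ d) {W : Type*} [AddCommGroup W] [Module ℂ W]
    (v : Module.Basis (Fin d) ℂ W) :
    ∃ (φ : (Yrep v).IntertwiningMap (ambientRep W d))
      (e : (Yrep v).Equiv ((schurRep W (shape321 d)).prod (schurRep W (shape311 d)))),
      (∀ a j i k : Fin d, φ (genY v a j i k) - genT v a j i k ∈ remainingIsotypic W d) ∧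
      (∀ ψ : (Yrep v).IntertwiningMap (ambientRep W d),
        (∀ a j i k : Fin d, ψ (genY v a j i k) - genT v a j i k ∈ remainingIsotypic W d) →
          ψ = φ) ∧
      Function.Injective φ ∧
      Submodule.map φ.toLinearMap
          (Submodule.comap e.toLinearMap (LinearMap.range (LinearMap.inl ℂ _ _))) =
        isotypic (ambientRep W d) (schurRep W (shape321 d)) ∧
      Submodule.map φ.toLinearMap
          (Submodule.comap e.toLinearMap (LinearMap.range (LinearMap.inr ℂ _ _))) =
        isotypic (ambientRep W d) (schurRep W (shape311 d)) ∧
      IsCompl (LinearMap.range φ.toLinearMap) (remainingIsotypic W d) := by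
  have hd0 : 0 < d := by omega
  let m := ambientModel v hd0
  let Q := toY hd0 v
  have hQ : ∀ a j i k, Q (genT v a j i k) = genY v a j i k := fun a j i k => toY_genT hd0 v a j i k
  have hker' : LinearMap.ker Q = m.traceSub v ⊔ m.cycSub := ker_toY hd0 v
  have hker : LinearMap.ker Q = remainingIsotypic W d := by
    rw [hker']
    exact (m.isotypic_sup v hd).symm
  have hprim := m.primitive_eq_orbit v (a := ⟨d - 1, by omega⟩) (j := ⟨0, by omega⟩)
    (k := ⟨1, by omega⟩) (by simp; omega) (by simp; omega) (by simp)
  have hpol := m.polarSub_eq_orbit v ⟨0, by omega⟩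
  have hus : ∀ z, StabLike m.rep (m.t (v.coord ⟨d - 1, by omega⟩) (v ⟨0, by omega⟩)
      (v ⟨0, by omega⟩) (v ⟨1, by omega⟩)) z → ∃ c : ℂ, z = c • _ := fun z hz =>
    ⟨_, m.primitive_eigenvector v (by simp; omega) (by simp; omega) (by simp) hz⟩
  have hws : ∀ z, StabLike m.rep (m.polar v (v ⟨0, by omega⟩) (v ⟨0, by omega⟩)) z →
      ∃ c : ℂ, z = c • _ := fun z hz =>
    ⟨_, m.polar_eigenvector v (b := ⟨1, by omega⟩) (by simp) hz⟩
  have htop := m.sup_eq_top v hd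
  have hu0 := (m.primitive_schur v hd).2
  have hw0 := m.polarSub_inf v hd
  rw [← hker', hprim, hpol] at htop hu0
  rw [← hker', hpol] at hw0
  obtain ⟨φ, e, h1, h2, h3, h4, h5⟩ := exists_unique_section (toY_surjective hd0 v)
    (toY_rep hd0 v) (m.primitive_schur v hd).1 (m.polarSub_schur v hd) hus hws htop hu0 hw0
  -- As `T'` is the kernel of `Q`, the congruences on generators say exactly that `ψ` is a section
  -- of `Q`.
  have hmem : ∀ ψ : (Yrep v).IntertwiningMap (ambientRep W d),
      (∀ a j i k, ψ (genY v a j i k) - genT v a j i k ∈ remainingIsotypic W d) ↔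
        ∀ y, Q (ψ y) = y := fun ψ => by
    rw [← hker]
    simp only [LinearMap.mem_ker, map_sub, hQ, sub_eq_zero]
    refine ⟨fun h y => ?_, fun h a j i k => h _⟩
    have : Q ∘ₗ ψ.toLinearMap = LinearMap.id := LinearMap.ext_on (span_genY v) (by
      rintro _ ⟨a, j, i, k, rfl⟩
      exact h a j i k)
    exact LinearMap.congr_fun this y
  refine ⟨φ, e, (hmem φ).2 h1, fun ψ hψ => h2 ψ ((hmem ψ).1 hψ),
    Function.LeftInverse.injective h1, h3.trans ?_, h4.trans ?_, hker ▸ h5⟩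
  · exact (isotypic_eq_orbit (m.primitive_schur v hd).1 hus).symm
  · exact (isotypic_eq_orbit (m.polarSub_schur v hd) hws).symm
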